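/- Let $n\ge 1$, $\beta>1$, $p>0$, and let $|\cdot|$ denote the max-norm of matrices. Let $X_\beta$ be the Banach space of continuous functions $B:\mathbb{R}\to\mathbb{R}^{n\times n}$ with symmetric values and $\|B\|_{X_\beta}=\sup_{x\in\mathbb{R}}|B(x)|(1+|x|)^\beta<\infty$. Let $A:\mathbb{R}\to\mathbb{R}^{n\times n}$ be continuous with $A(x)$ diagonal for every $x$, and let $A_p:\mathbb{R}\to\mathbb{R}^{n\times n}$ satisfy $A_p(x+p)=A_p(x)$ for all $x$ and $\sup_{x\in\mathbb{R}}|A(x)-A_p(x)|(1+|x|)^\beta<\infty$. Let $\mathcal{L}=-\frac{d^2}{dx^2}+A(x)$ on $L^2(\mathbb{R};\mathbb{R}^n)$, with domain $H^2(\mathbb{R};\mathbb{R}^n)$, and let $\lambda_0\in\mathbb{R}$ be a simple eigenvalue of $\mathcal{L}$ with an eigenfunction $\mathbf{u}_*$ whose components other than the $j$-th vanish, where $j\in\{1,\dots,n\}$ (without loss of generality $j=1$). Let $\Phi$ be the matrix solution with $\Phi(0)=I$ of the first order system with coefficient matrix $$\begin{bmatrix}0&I\\ A_p(x)-\lambda_0I&0\end{bmatrix}.$$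 Assume that $e^{p\lambda_0}$ is not an eigenvalue of $\Phi(p)$, and that every complex eigenvalue of $\Phi(p)$ of modulus $1$ is semisimple (all its generalized eigenvectors are eigenvectors). Let $T_\beta\subset X_\beta$ be the subspace of those $B=(b_{ik})$ with $b_{ii}=0$ for all $i$ and $b_{ik}=0$ unless $i=j$ or $k=j$ (for $j=1$: nonzero entries only off the diagonal in the first row and the first column), and let $Y_\beta$ be any linear subspace with $T_\beta\subset Y_\beta\subset X_\beta$, normed by $\|\cdot\|_{X_\beta}$. For $\varepsilon>0$ put $$\mathscr{T}_\varepsilon=\{B\in Y_\beta:\ \text{there is } \lambda\in(\lambda_0-\varepsilon,\lambda_0+\varepsilon)\text{ that is an eigenvalue of }\mathcal{L}+B\}.$$ Then the number of eigenvalues of $\Phi(p)$ of modulus $1$, counted with algebraic multiplicity, is an even number $2m$, and there exist $\varepsilon>0$ and an open neighbourhood $\mathcal{U}$ of $0$ in $Y_\beta$ such that $\mathscr{T}_\varepsilon\cap\mathcal{U}$ is a smooth submanifold of codimension $2m$ in $Y_\beta$. -/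

import Mathlib

open MeasureTheory Set Topology
open scoped ContDiff Matrix BoundedContinuousFunction

-- The norm of a matrix is the maximum of the absolute values of its entries.
attribute [local instance] Matrix.normedAddCommGroup Matrix.normedSpace

noncomputable section

/-- The Hilbert space `L²(ℝ; ℝⁿ)`. -/
abbrev L2Space (n : ℕ) : Type :=
  Lp (EuclideanSpace ℝ (Fin n)) 2 (volume : Measure ℝ)

/-- The graph of the operator `-d²/dx² + A(x)` in `L²(ℝ; ℝⁿ)` on its natural domain, which is
`H²(ℝ; ℝⁿ)` for bounded `A`: the pairs `(u, -u'' + A u)` of elements of `L²`, where `u` is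
continuously differentiable, `u'` is locally absolutely continuous and `g = u''` is in `L²`. -/
def schrodingerGraph {n : ℕ} (A : ℝ → Matrix (Fin n) (Fin n) ℝ) :
    Submodule ℝ (L2Space n × L2Space n) where
  carrier := {q | ∃ (u v : ℝ → EuclideanSpace ℝ (Fin n)) (g : L2Space n),
    q.1 =ᵐ[volume] u ∧ (∀ x, HasDerivAt u (v x) x) ∧
    (∀ x, v x = v 0 + ∫ t in (0 : ℝ)..x, g t) ∧
    q.2 =ᵐ[volume] fun x => -(g x) + Matrix.toEuclideanLin (A x) (u x)}
  zero_mem' := by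
    refine ⟨0, 0, 0, Lp.coeFn_zero _ _ _, fun x => hasDerivAt_const x _, fun x => ?_, ?_⟩
    · have h : ∫ t in (0 : ℝ)..x, (0 : L2Space n) t =
          ∫ t in (0 : ℝ)..x, (0 : EuclideanSpace ℝ (Fin n)) := by
        refine intervalIntegral.integral_congr_ae ?_
        filter_upwards [Lp.coeFn_zero (EuclideanSpace ℝ (Fin n)) 2 (volume : Measure ℝ)] with t ht _
        exact ht
      rw [h]; simp
    · filter_upwards [Lp.coeFn_zero (EuclideanSpace ℝ (Fin n)) 2 (volume : Measure ℝ)] with t ht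
      simp only [Prod.snd_zero, ht]; simp
  add_mem' := by
    rintro ⟨a, b⟩ ⟨a', b'⟩ ⟨u, v, g, h1, h2, h3, h4⟩ ⟨u', v', g', h1', h2', h3', h4'⟩
    refine ⟨u + u', v + v', g + g', ?_, fun x => (h2 x).add (h2' x), fun x => ?_, ?_⟩
    · filter_upwards [Lp.coeFn_add a a', h1, h1'] with t e1 e2 e3
      change (a + a') t = u t + u' t
      rw [e1, Pi.add_apply]
      exact congrArg₂ _ e2 e3
    · have h : ∫ t in (0 : ℝ)..x, (g + g') t = ∫ t in (0 : ℝ)..x, (g t + g' t) := by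
        refine intervalIntegral.integral_congr_ae ?_
        filter_upwards [Lp.coeFn_add g g'] with t ht _
        simpa using ht
      have hi : ∀ f : L2Space n, IntervalIntegrable f volume 0 x := fun f =>
        (((Lp.memLp f).locallyIntegrable (by norm_num)).integrableOn_isCompact
          isCompact_uIcc).intervalIntegrable
      rw [h, intervalIntegral.integral_add (hi g) (hi g'), Pi.add_apply, Pi.add_apply, h3 x, h3' x]
      abel
    · filter_upwards [Lp.coeFn_add b b', Lp.coeFn_add g g', h4, h4'] with t e1 e2 e3 e4
      simp only [Prod.snd_add, Pi.add_apply, map_add] at *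
      rw [e1, e2, e3, e4]; abel
  smul_mem' := by
    rintro c ⟨a, b⟩ ⟨u, v, g, h1, h2, h3, h4⟩
    refine ⟨c • u, c • v, c • g, ?_, fun x => (h2 x).const_smul c, fun x => ?_, ?_⟩
    · filter_upwards [Lp.coeFn_smul c a, h1] with t e1 e2
      change (c • a) t = c • u t
      rw [e1, Pi.smul_apply]
      exact congrArg _ e2
    · have h : ∫ t in (0 : ℝ)..x, (c • g) t = ∫ t in (0 : ℝ)..x, c • g t := by
        refine intervalIntegral.integral_congr_ae ?_
        filter_upwards [Lp.coeFn_smul c g] with t ht _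
        simpa using ht
      rw [h, intervalIntegral.integral_smul, Pi.smul_apply, Pi.smul_apply, h3 x]
      simp [smul_add]
    · filter_upwards [Lp.coeFn_smul c b, Lp.coeFn_smul c g, h4] with t e1 e2 e3
      simp only [Prod.smul_snd, Pi.smul_apply, map_smul] at *
      rw [e1, e2, e3]; simp [smul_add]

/-- The graph is single-valued. -/
theorem schrodingerGraph_snd_eq_zero {n : ℕ} (A : ℝ → Matrix (Fin n) (Fin n) ℝ)
    (q : L2Space n × L2Space n) (hq : q ∈ schrodingerGraph A) (h0 : q.1 = 0) : q.2 = 0 := by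
  obtain ⟨u, v, g, h1, h2, h3, h4⟩ := hq
  have hu : u = 0 := by
    have hc : Continuous u := continuous_iff_continuousAt.2 fun x => (h2 x).continuousAt
    refine (Continuous.ae_eq_iff_eq volume hc continuous_const).1 ?_
    rw [h0] at h1
    exact h1.symm.trans (Lp.coeFn_zero _ _ _)
  have hv : ∀ x, v x = 0 := fun x => by
    have := h2 x
    rw [hu] at this
    exact this.unique (hasDerivAt_const x _)
  have hg : ∀ x, ∫ t in (0 : ℝ)..x, g t = 0 := fun x => by
    have := h3 x
    rw [hv, hv, zero_add] at this
    exact this.symm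
  have hl : LocallyIntegrable g volume := (Lp.memLp g).locallyIntegrable (by norm_num)
  have hg0 : g =ᵐ[volume] 0 := by
    filter_upwards [LocallyIntegrable.ae_hasDerivAt_integral hl] with x hx
    have h := hx 0
    simp only [hg] at h
    exact h.unique (hasDerivAt_const x _)
  refine (Lp.eq_zero_iff_ae_eq_zero).2 ?_
  filter_upwards [h4, hg0] with x e1 e2
  rw [e1, e2, hu]; simp

/-- The Schrödinger operator `-d²/dx² + A(x)` in `L²(ℝ; ℝⁿ)`, as an unbounded operator. -/
def schrodingerOp {n : ℕ} (A : ℝ → Matrix (Fin n) (Fin n) ℝ) : L2Space n →ₗ.[ℝ] L2Space n :=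
  (schrodingerGraph A).toLinearPMap

theorem schrodingerOp_graph {n : ℕ} (A : ℝ → Matrix (Fin n) (Fin n) ℝ) :
    (schrodingerOp A).graph = schrodingerGraph A :=
  Submodule.toLinearPMap_graph_eq _ (schrodingerGraph_snd_eq_zero A)

/-- `u` is an eigenfunction of the operator `T` to the eigenvalue `l`. -/
def IsEigenfunction {n : ℕ} (T : L2Space n →ₗ.[ℝ] L2Space n) (l : ℝ) (u : L2Space n) : Prop :=
  u ≠ 0 ∧ ∃ h : u ∈ T.domain, T ⟨u, h⟩ = l • u

/-- `l` is an eigenvalue of `T`. -/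
def IsEigenvalue {n : ℕ} (T : L2Space n →ₗ.[ℝ] L2Space n) (l : ℝ) : Prop :=
  ∃ u, IsEigenfunction T l u

/-- `l` is a simple eigenvalue of `T`: it is an eigenvalue with one-dimensional eigenspace. -/
def IsSimpleEigenvalue {n : ℕ} (T : L2Space n →ₗ.[ℝ] L2Space n) (l : ℝ) : Prop :=
  IsEigenvalue T l ∧
    ∀ u w, IsEigenfunction T l u → IsEigenfunction T l w → ∃ c : ℝ, w = c • u

/-- The vector space underlying `X_β`. -/
def perturbationSubmodule (n : ℕ) (β : ℝ) : Submodule ℝ (ℝ → Matrix (Fin n) (Fin n) ℝ) where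
  carrier := {B | Continuous B ∧ (∀ x, (B x)ᵀ = B x) ∧
    BddAbove (range fun x : ℝ => ‖B x‖ * (1 + |x|) ^ β)}
  zero_mem' := ⟨continuous_const, fun x => by simp, ⟨0, by rintro _ ⟨x, rfl⟩; simp⟩⟩
  add_mem' := by
    rintro B B' ⟨h1, h2, C, h3⟩ ⟨h1', h2', C', h3'⟩
    refine ⟨h1.add h1', fun x => by simp [h2, h2'], C + C', ?_⟩
    rintro _ ⟨x, rfl⟩
    have e1 := h3 ⟨x, rfl⟩
    have e2 := h3' ⟨x, rfl⟩
    have e3 : ‖(B + B') x‖ * (1 + |x|) ^ β ≤ (‖B x‖ + ‖B' x‖) * (1 + |x|) ^ β := by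
      gcongr
      exact norm_add_le _ _
    simp only at e1 e2 ⊢
    linarith
  smul_mem' := by
    rintro c B ⟨h1, h2, C, h3⟩
    refine ⟨h1.const_smul c, fun x => by simp [h2], |c| * C, ?_⟩
    rintro _ ⟨x, rfl⟩
    have e1 := h3 ⟨x, rfl⟩
    simp only [Pi.smul_apply, norm_smul, Real.norm_eq_abs, mul_assoc] at e1 ⊢
    gcongr

/-- The space `X_β` of continuous functions `B` on `ℝ` with values in the symmetric `n × n`
matrices such that `sup_x |B(x)| (1 + |x|)^β` is finite. -/
def PerturbationSpace (n : ℕ) (β : ℝ) : Type := ↥(perturbationSubmodule n β)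

namespace PerturbationSpace

variable {n : ℕ} {β : ℝ}

instance : AddCommGroup (PerturbationSpace n β) :=
  inferInstanceAs (AddCommGroup ↥(perturbationSubmodule n β))

instance : Module ℝ (PerturbationSpace n β) :=
  inferInstanceAs (Module ℝ ↥(perturbationSubmodule n β))

instance : CoeFun (PerturbationSpace n β) (fun _ => ℝ → Matrix (Fin n) (Fin n) ℝ) :=
  ⟨fun B => B.1⟩

/-- The bounded continuous function `x ↦ (1 + |x|)^β B(x)`. -/
def weighted (n : ℕ) (β : ℝ) :
    PerturbationSpace n β →ₗ[ℝ] (ℝ →ᵇ Matrix (Fin n) (Fin n) ℝ) where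
  toFun B := BoundedContinuousFunction.ofNormedAddCommGroup
    (fun x : ℝ => ((1 + |x|) ^ β : ℝ) • B x)
    (((continuous_const.add continuous_abs).rpow_const
      fun x => Or.inl (ne_of_gt (show (0 : ℝ) < 1 + |x| by positivity))).smul B.2.1)
    B.2.2.2.choose
    (fun x => by
      have h := B.2.2.2.choose_spec ⟨x, rfl⟩
      rw [norm_smul, Real.norm_of_nonneg (by positivity), mul_comm]
      exact h)
  map_add' B B' := by
    ext x i k
    exact congrFun (congrFun (smul_add _ (B x) (B' x)) i) k
  map_smul' c B := by
    ext x i k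
    exact congrFun (congrFun (smul_comm _ c (B x)) i) k

theorem weighted_apply (B : PerturbationSpace n β) (x : ℝ) :
    weighted n β B x = ((1 + |x|) ^ β : ℝ) • B x := rfl

theorem weighted_injective : Function.Injective (weighted n β) := by
  intro B B' h
  refine Subtype.ext (funext fun x => ?_)
  have hx := DFunLike.congr_fun h x
  rw [weighted_apply, weighted_apply] at hx
  exact smul_right_injective _ (ne_of_gt (by positivity)) hx

instance : NormedAddCommGroup (PerturbationSpace n β) :=
  NormedAddCommGroup.induced _ _ (weighted n β) weighted_injective

instance : NormedSpace ℝ (PerturbationSpace n β) :=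
  NormedSpace.induced ℝ _ _ (weighted n β)

/-- The norm of `X_β` is the weighted supremum norm. -/
theorem norm_eq (B : PerturbationSpace n β) :
    ‖B‖ = ⨆ x : ℝ, ‖B x‖ * (1 + |x|) ^ β := by
  change ‖weighted n β B‖ = _
  rw [BoundedContinuousFunction.norm_eq_iSup_norm]
  refine iSup_congr fun x => ?_
  rw [weighted_apply, norm_smul, Real.norm_of_nonneg (by positivity), mul_comm]

end PerturbationSpace

/-- The subspace `T_β` of `X_β`, relative to the index `j`: all entries on the diagonal vanish,
and so do all entries outside row `j` and column `j`. -/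
def minimalSubspace (n : ℕ) (β : ℝ) (j : Fin n) : Submodule ℝ (PerturbationSpace n β) where
  carrier := {B | ∀ x i k, (i = k ∨ (i ≠ j ∧ k ≠ j)) → B x i k = 0}
  zero_mem' := fun _ _ _ _ => rfl
  add_mem' := by
    intro B B' h h' x i k hik
    change B x i k + B' x i k = 0
    rw [h x i k hik, h' x i k hik, add_zero]
  smul_mem' := by
    intro c B h x i k hik
    change c * B x i k = 0
    rw [h x i k hik, mul_zero]

/-- `Φ` is the matrix solution, with `Φ(0) = I`, of the first order system with coefficient matrix
`[0, I; A(x) - l I, 0]`. -/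
def IsFundamentalMatrix {n : ℕ} (A : ℝ → Matrix (Fin n) (Fin n) ℝ) (l : ℝ)
    (Φ : ℝ → Matrix (Fin n ⊕ Fin n) (Fin n ⊕ Fin n) ℝ) : Prop :=
  Φ 0 = 1 ∧ ∀ x, HasDerivAt Φ (Matrix.fromBlocks 0 1 (A x - l • 1) 0 * Φ x) x

/-- The number of complex eigenvalues of modulus `1`, counted with algebraic multiplicity. -/
def unimodularCount {ι : Type*} [Fintype ι] [DecidableEq ι] (M : Matrix ι ι ℝ) : ℕ :=
  by classical exact
    Multiset.card ((M.map (fun r : ℝ => (r : ℂ))).charpoly.roots.filter fun z => ‖z‖ = 1)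

/-- Every complex eigenvalue of modulus `1` is semisimple: its generalized eigenvectors are
eigenvectors. -/
def UnimodularSemisimple {ι : Type*} [Fintype ι] [DecidableEq ι] (M : Matrix ι ι ℝ) : Prop :=
  ∀ z : ℂ, ‖z‖ = 1 →
    Module.End.maxGenEigenspace (Matrix.toLin' (M.map (fun r : ℝ => (r : ℂ)))) z =
      Module.End.eigenspace (Matrix.toLin' (M.map (fun r : ℝ => (r : ℂ)))) z

/-- `S` is a smooth (embedded) submanifold of codimension `k` of the normed space `E`: near each of
its points, some smooth diffeomorphism between open subsets of `E` maps `S` onto a closed linear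
subspace of codimension `k`, the kernel of a continuous linear surjection `f : E → ℝᵏ`. -/
def IsSubmanifoldOfCodim {E : Type*} [NormedAddCommGroup E] [NormedSpace ℝ E] (k : ℕ)
    (S : Set E) : Prop :=
  ∀ b ∈ S, ∃ (e : OpenPartialHomeomorph E E) (f : E →L[ℝ] (Fin k → ℝ)),
    b ∈ e.source ∧ ContDiffOn ℝ ∞ e e.source ∧ ContDiffOn ℝ ∞ e.symm e.target ∧
    Function.Surjective f ∧ ∀ y ∈ e.source, (y ∈ S ↔ f (e y) = 0)

/-- The set of the perturbations `B` in `Y` for which `-d²/dx² + A + B` has an eigenvalue in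
`(l - ε, l + ε)`. -/
def persistenceSet {n : ℕ} {β : ℝ} (A : ℝ → Matrix (Fin n) (Fin n) ℝ) (l ε : ℝ)
    (Y : Submodule ℝ (PerturbationSpace n β)) : Set Y :=
  {B | ∃ l' ∈ Ioo (l - ε) (l + ε),
    IsEigenvalue (schrodingerOp fun x => A x + (B : PerturbationSpace n β) x) l'}

end

open Filter

/-! Since `A` is diagonal, the equation L u = λ₀ u splits into scalar equations y'' = (a_k - λ₀) y,
each an integrable perturbation of a periodic one. Every periodic equation has a monodromy matrix of
determinant 1: it has two unimodular eigenvalues if its trace satisfies |trace| ≤ 2 (elliptic) and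
none otherwise (hyperbolic), so m is the number of elliptic components. Semisimplicity makes the
monodromy matrix ±I when |trace| = 2, hence all solutions of an elliptic equation are bounded, and
no nontrivial one decays. In particular component j, which carries the eigenfunction u*, is
hyperbolic. By simplicity of λ₀ the other hyperbolic components have no decaying solution.

The problem is posed on functions e^{-η|x|} g with g bounded and continuous. There L - λ₀ is
invertible in a hyperbolic component k ≠ j (`DichotomyPair.exists_inverse`), has the kernel spanned
by u* and one solvability condition in component j (`exists_resonant_inverse`), and has two
solvability conditions, orthogonality to the bounded solutions φ_k and ψ_k, in an elliptic component
(`DichotomyPair.exists_partial_inverse`). So (L + B - λ)u = 0 becomes u = c u* + K(Bu - (λ - λ₀)u)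
together with 1 + 2m scalar conditions on Bu - (λ - λ₀)u. For small B and λ - λ₀ the first equation
determines u up to a factor. The condition of component j can be solved for λ = Λ(B), because ∫ u*²
≠ 0. The remaining 2m conditions cut out the set, and their derivative at B = 0 consists of the
moments ∫ φ_k b_kj u* and ∫ ψ_k b_kj u*. These can be prescribed already on T_β, since φ_k and ψ_k
are independent on every interval where u* does not vanish (`exists_moments`,
`exists_isSubmanifoldOfCodim_of_reduction`).

This reduction misses no eigenvalue only if every L² eigenfunction of L + B with λ near λ₀ decays at
the fixed rate η. `exists_exp_decay` proves such decay by integrating elliptic components back from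
infinity, where the solution vanishes, and by using the dichotomy in hyperbolic ones. It needs rates
that are uniform in λ (`exists_dichotomyPair_near`). The danger is weak hyperbolicity near |trace| =
2. There the monodromy matrix at λ₀ is ±I, and a strict Cauchy-Schwarz inequality shows that the
equation is elliptic for all nearby λ. -/

/-! ### Integral operators with exponentially decaying kernels. -/

theorem integrable_exp_neg_mul_abs {δ : ℝ} (hδ : 0 < δ) :
    Integrable (fun s : ℝ => Real.exp (-δ * |s|)) := by
  have h1 : IntegrableOn (fun s : ℝ => Real.exp (-δ * |s|)) (Ioi 0) := by
    refine (integrableOn_exp_mul_Ioi (a := -δ) (by linarith) 0).congr_fun ?_ measurableSet_Ioi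
    intro s hs
    simp only [abs_of_pos (mem_Ioi.1 hs)]
  have h2 : IntegrableOn (fun s : ℝ => Real.exp (-δ * |s|)) (Iic 0) := by
    refine (integrableOn_exp_mul_Iic (a := δ) hδ 0).congr_fun ?_ measurableSet_Iic
    intro s hs
    simp only [abs_of_nonpos (mem_Iic.1 hs)]
    congr 1; ring
  rw [← integrableOn_univ, ← Iic_union_Ioi (a := (0 : ℝ))]
  exact h2.union h1

theorem integral_exp_neg_mul_abs {δ : ℝ} (hδ : 0 < δ) :
    ∫ s : ℝ, Real.exp (-δ * |s|) = 2 / δ := by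
  rw [integral_comp_abs (f := fun s => Real.exp (-δ * s)), integral_exp_mul_Ioi (by linarith)]
  simp
  ring

/-- A kernel with exponential off-diagonal decay that is almost everywhere continuous in its first
variable acts as a bounded operator on bounded continuous functions. -/
theorem exists_kernelOperator (k : ℝ → ℝ → ℝ) (C δ : ℝ) (hδ : 0 < δ)
    (hm : ∀ x, AEStronglyMeasurable (k x) volume)
    (hb : ∀ x s, |k x s| ≤ C * Real.exp (-δ * |x - s|))
    (hc : ∀ x₀, ∀ᵐ s, ContinuousAt (fun x => k x s) x₀) :
    ∃ T : (ℝ →ᵇ ℝ) →L[ℝ] (ℝ →ᵇ ℝ),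
      (∀ g x, T g x = ∫ s, k x s * g s) ∧ ‖T‖ ≤ C * (2 / δ) := by
  have hC : 0 ≤ C := by
    have := (abs_nonneg _).trans (hb 0 0)
    simpa using this
  have hie : ∀ x : ℝ, Integrable (fun s : ℝ => Real.exp (-δ * |x - s|)) := fun x =>
    (integrable_exp_neg_mul_abs hδ).comp_sub_left x
  have hbd : ∀ (g : ℝ →ᵇ ℝ) x s, ‖k x s * g s‖ ≤ C * Real.exp (-δ * |x - s|) * ‖g‖ := by
    intro g x s
    rw [norm_mul]
    exact mul_le_mul (hb x s) (g.norm_coe_le_norm s) (norm_nonneg _) (by positivity)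
  have hmg : ∀ (g : ℝ →ᵇ ℝ) x, AEStronglyMeasurable (fun s => k x s * g s) volume :=
    fun g x => (hm x).mul g.continuous.aestronglyMeasurable
  have hint : ∀ (g : ℝ →ᵇ ℝ) x, Integrable (fun s => k x s * g s) := fun g x =>
    Integrable.mono' (((hie x).const_mul C).mul_const ‖g‖) (hmg g x) (.of_forall (hbd g x))
  have hval : ∀ (g : ℝ →ᵇ ℝ) x, ‖∫ s, k x s * g s‖ ≤ C * (2 / δ) * ‖g‖ := by
    intro g x
    refine (norm_integral_le_of_norm_le (((hie x).const_mul C).mul_const ‖g‖)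
      (.of_forall (hbd g x))).trans_eq ?_
    rw [integral_mul_const, integral_const_mul,
      integral_sub_left_eq_self (fun s => Real.exp (-δ * |s|)) volume x,
      integral_exp_neg_mul_abs hδ]
  have hcont : ∀ g : ℝ →ᵇ ℝ, Continuous fun x => ∫ s, k x s * g s := by
    intro g
    refine continuous_iff_continuousAt.2 fun x₀ => ?_
    -- Moving x by less than one changes the exponential by a factor of at most e^δ, so a single
    -- majorant centred at x₀ serves a whole neighbourhood.
    refine continuousAt_of_dominated
      (bound := fun s => C * (Real.exp δ * Real.exp (-δ * |x₀ - s|)) * ‖g‖)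
      (.of_forall (hmg g)) ?_ ((((hie x₀).const_mul _).const_mul C).mul_const ‖g‖) ?_
    · filter_upwards [Metric.ball_mem_nhds x₀ one_pos] with x hx
      refine .of_forall fun s => (hbd g x s).trans ?_
      rw [← Real.exp_add]
      gcongr
      have h1 : |x₀ - s| ≤ |x - s| + 1 := by
        have := abs_sub_le x₀ x s
        rw [Metric.mem_ball, Real.dist_eq, abs_sub_comm] at hx
        linarith
      nlinarith
    · filter_upwards [hc x₀] with s hs
      exact hs.mul continuousAt_const
  let T₀ : (ℝ →ᵇ ℝ) →ₗ[ℝ] (ℝ →ᵇ ℝ) :=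
    { toFun := fun g => BoundedContinuousFunction.ofNormedAddCommGroup _ (hcont g) _ (hval g)
      map_add' := by
        intro g g'
        ext x
        change ∫ s, k x s * (g s + g' s) = (∫ s, k x s * g s) + ∫ s, k x s * g' s
        rw [← integral_add (hint g x) (hint g' x)]
        simp only [mul_add]
      map_smul' := by
        intro c g
        ext x
        change ∫ s, k x s * (c * g s) = c * ∫ s, k x s * g s
        rw [← integral_const_mul]
        congr 1 with s
        ring }
  refine ⟨T₀.mkContinuous (C * (2 / δ)) fun g => ?_, fun g x => rfl, ?_⟩
  · exact (BoundedContinuousFunction.norm_le (by positivity)).2 (hval g)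
  · exact LinearMap.mkContinuous_norm_le _ (by positivity) _

/-! ### Scalar second order equations: Wronskians and variation of constants. -/

/-- `y` with derivative `y'` is a classical solution of `y'' = q y + f`. -/
structure IsSol (q f y y' : ℝ → ℝ) : Prop where
  deriv_fst : ∀ x, HasDerivAt y (y' x) x
  deriv_snd : ∀ x, HasDerivAt y' (q x * y x + f x) x

namespace IsSol

variable {q f g y y' z z' φ φ' ψ ψ' u u' : ℝ → ℝ}

theorem continuous (h : IsSol q f y y') : Continuous y :=
  continuous_iff_continuousAt.2 fun x => (h.deriv_fst x).continuousAt

theorem continuous_deriv (h : IsSol q f y y') : Continuous y' :=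
  continuous_iff_continuousAt.2 fun x => (h.deriv_snd x).continuousAt

theorem add (h : IsSol q f y y') (h' : IsSol q g z z') :
    IsSol q (fun x => f x + g x) (fun x => y x + z x) (fun x => y' x + z' x) :=
  ⟨fun x => (h.deriv_fst x).add (h'.deriv_fst x), fun x => by
    exact ((h.deriv_snd x).add (h'.deriv_snd x)).congr_deriv (by ring)⟩

theorem const_mul (c : ℝ) (h : IsSol q f y y') :
    IsSol q (fun x => c * f x) (fun x => c * y x) (fun x => c * y' x) :=
  ⟨fun x => (h.deriv_fst x).const_mul c, fun x => by
    exact ((h.deriv_snd x).const_mul c).congr_deriv (by ring)⟩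

theorem lin (c d : ℝ) (h : IsSol q 0 y y') (h' : IsSol q 0 z z') :
    IsSol q 0 (fun x => c * y x + d * z x) (fun x => c * y' x + d * z' x) := by
  have := (h.const_mul c).add (h'.const_mul d)
  simpa using! this

theorem reflect (h : IsSol q f y y') :
    IsSol (fun x => q (-x)) (fun x => f (-x)) (fun x => y (-x)) (fun x => -y' (-x)) :=
  ⟨fun x => by simpa [Function.comp_def] using! (h.deriv_fst (-x)).comp x (hasDerivAt_neg x), fun x => by
    simpa using! ((h.deriv_snd (-x)).comp x (hasDerivAt_neg x)).neg⟩

theorem shift (p : ℝ) (h : IsSol q f y y') :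
    IsSol (fun x => q (x + p)) (fun x => f (x + p)) (fun x => y (x + p)) (fun x => y' (x + p)) :=
  ⟨fun x => (h.deriv_fst (x + p)).comp_add_const x p,
    fun x => (h.deriv_snd (x + p)).comp_add_const x p⟩

theorem congr_potential {r : ℝ → ℝ} (h : IsSol (fun x => q x + r x) f y y') :
    IsSol q (fun x => r x * y x + f x) y y' :=
  ⟨h.deriv_fst, fun x => (h.deriv_snd x).congr_deriv (by ring)⟩

/-- Variation of the Wronskian. -/
theorem hasDerivAt_wronskian (hφ : IsSol q 0 φ φ') (hu : IsSol q f u u') (x : ℝ) :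
    HasDerivAt (fun x => φ x * u' x - φ' x * u x) (φ x * f x) x := by
  refine (((hφ.deriv_fst x).mul (hu.deriv_snd x)).sub
    ((hφ.deriv_snd x).mul (hu.deriv_fst x))).congr_deriv ?_
  simp only [Pi.zero_apply]
  ring

theorem wronskian_eq (hφ : IsSol q 0 φ φ') (hψ : IsSol q 0 ψ ψ') (x t : ℝ) :
    φ x * ψ' x - φ' x * ψ x = φ t * ψ' t - φ' t * ψ t := by
  refine is_const_of_deriv_eq_zero (f := fun x => φ x * ψ' x - φ' x * ψ x)
    (fun x => (hφ.hasDerivAt_wronskian hψ x).differentiableAt) (fun x => ?_) x t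
  simpa using (hφ.hasDerivAt_wronskian hψ x).deriv

/-- The Wronskians with two homogeneous solutions are the coordinates of `u` in that fundamental
system. They change only through the forcing, so all later estimates follow these coordinates
instead of `u`. -/
theorem wronskian_sub (hφ : IsSol q 0 φ φ') (hu : IsSol q f u u') (hf : Continuous f) (a x : ℝ) :
    φ x * u' x - φ' x * u x = (φ a * u' a - φ' a * u a) + ∫ t in a..x, φ t * f t := by
  rw [intervalIntegral.integral_eq_sub_of_hasDerivAt
    (fun t _ => hφ.hasDerivAt_wronskian hu t) ((hφ.continuous.mul hf).intervalIntegrable _ _)]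
  ring

/-- The representation of a solution by variation of constants. -/
theorem eq_varConst (hφ : IsSol q 0 φ φ') (hψ : IsSol q 0 ψ ψ')
    (hW : ∀ x, φ x * ψ' x - φ' x * ψ x = 1) (hu : IsSol q f u u') (hf : Continuous f) (a x : ℝ) :
    u x = φ x * (-(ψ a * u' a - ψ' a * u a) - ∫ t in a..x, ψ t * f t) +
      ψ x * ((φ a * u' a - φ' a * u a) + ∫ t in a..x, φ t * f t) ∧
    u' x = φ' x * (-(ψ a * u' a - ψ' a * u a) - ∫ t in a..x, ψ t * f t) +
      ψ' x * ((φ a * u' a - φ' a * u a) + ∫ t in a..x, φ t * f t) := by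
  have h1 := hφ.wronskian_sub hu hf a x
  have h2 := hψ.wronskian_sub hu hf a x
  rw [← h1]
  have h3 : -(ψ a * u' a - ψ' a * u a) - ∫ t in a..x, ψ t * f t = -(ψ x * u' x - ψ' x * u x) := by
    rw [h2]; ring
  rw [h3]
  have h4 := hW x
  constructor
  · linear_combination (-u x) * h4
  · linear_combination (-u' x) * h4

/-- The derivatives of the two coefficients cancel in the first derivative, and Wronskian 1 turns
them into exactly `f` in the second. The constants `a` and `b` are free, so every normalization of
the integrals is covered. -/
theorem varConst (hφ : IsSol q 0 φ φ') (hψ : IsSol q 0 ψ ψ')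
    (hW : ∀ x, φ x * ψ' x - φ' x * ψ x = 1) (hf : Continuous f) (a b : ℝ) :
    IsSol q f
      (fun x => φ x * (a - ∫ t in (0 : ℝ)..x, ψ t * f t) + ψ x * (b + ∫ t in (0 : ℝ)..x, φ t * f t))
      (fun x => φ' x * (a - ∫ t in (0 : ℝ)..x, ψ t * f t) +
        ψ' x * (b + ∫ t in (0 : ℝ)..x, φ t * f t)) := by
  have hI : ∀ {h : ℝ → ℝ}, Continuous h → ∀ x, HasDerivAt (fun x => ∫ t in (0 : ℝ)..x, h t) (h x) x :=
    fun hh x => intervalIntegral.integral_hasDerivAt_right (hh.intervalIntegrable _ _)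
      (hh.stronglyMeasurableAtFilter _ _) hh.continuousAt
  have h1 := fun x => (hI (h := fun t => ψ t * f t) (hψ.continuous.mul hf) x).const_sub a
  have h2 := fun x => (hI (h := fun t => φ t * f t) (hφ.continuous.mul hf) x).const_add b
  refine ⟨fun x => ?_, fun x => ?_⟩
  · refine (((hφ.deriv_fst x).mul (h1 x)).add ((hψ.deriv_fst x).mul (h2 x))).congr_deriv ?_
    ring
  · refine (((hφ.deriv_snd x).mul (h1 x)).add ((hψ.deriv_snd x).mul (h2 x))).congr_deriv ?_
    simp only [Pi.zero_apply]
    linear_combination f x * hW x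

theorem eq_lin (hφ : IsSol q 0 φ φ') (hψ : IsSol q 0 ψ ψ')
    (hW : ∀ x, φ x * ψ' x - φ' x * ψ x = 1) (hu : IsSol q 0 u u') :
    ∃ a b : ℝ, ∀ x, u x = a * φ x + b * ψ x ∧ u' x = a * φ' x + b * ψ' x := by
  refine ⟨-(ψ 0 * u' 0 - ψ' 0 * u 0), φ 0 * u' 0 - φ' 0 * u 0, fun x => ?_⟩
  obtain ⟨h1, h2⟩ := hφ.eq_varConst hψ hW hu continuous_const 0 x
  simp at h1 h2
  constructor
  · linear_combination h1
  · linear_combination h2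

theorem eq_zero_of_initial (hφ : IsSol q 0 φ φ') (hψ : IsSol q 0 ψ ψ')
    (hW : ∀ x, φ x * ψ' x - φ' x * ψ x = 1) (hu : IsSol q 0 u u') (a : ℝ) (h0 : u a = 0)
    (h0' : u' a = 0) (x : ℝ) : u x = 0 ∧ u' x = 0 := by
  obtain ⟨h1, h2⟩ := hφ.eq_varConst hψ hW hu continuous_const a x
  simp [h0, h0'] at h1 h2
  exact ⟨h1, h2⟩

end IsSol

/-! ### Step functions, and existence of solutions by a Neumann series. -/

/-- The indicator function of `(-∞, a]`. -/
noncomputable def leStep (a t : ℝ) : ℝ := (Iic a).indicator 1 t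

theorem leStep_of_le {a t : ℝ} (h : t ≤ a) : leStep a t = 1 := by simp [leStep, h]

theorem leStep_of_lt {a t : ℝ} (h : a < t) : leStep a t = 0 := by simp [leStep, h]

theorem measurable_leStep (a : ℝ) : Measurable (leStep a) :=
  measurable_one.indicator measurableSet_Iic

theorem continuousAt_leStep {t a : ℝ} (h : t ≠ a) : ContinuousAt (fun x => leStep x t) a := by
  rcases lt_or_gt_of_ne h with h | h
  · refine (continuousAt_const (y := (1 : ℝ))).congr ?_
    filter_upwards [Ioi_mem_nhds h] with x hx
    exact (leStep_of_le (le_of_lt hx)).symm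
  · refine (continuousAt_const (y := (0 : ℝ))).congr ?_
    filter_upwards [Iio_mem_nhds h] with x hx
    exact (leStep_of_lt hx).symm

theorem ae_continuousAt_leStep (a : ℝ) : ∀ᵐ t, ContinuousAt (fun x => leStep x t) a := by
  filter_upwards [Measure.ae_ne volume a] with t ht
  exact continuousAt_leStep ht

/-- The two steps differ only for t between 0 and x, where |x| - |t| = |x - t|. Thus a weight in |x|
turns into off-diagonal decay of a Volterra kernel. -/
theorem abs_leStep_sub_mul_exp_le (δ x t : ℝ) :
    |leStep x t - leStep 0 t| * Real.exp (-δ * (|x| - |t|)) ≤ Real.exp (-δ * |x - t|) := by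
  rcases le_or_gt t x with h | h <;> rcases le_or_gt t 0 with h' | h' <;>
    simp only [leStep_of_le, leStep_of_lt, h, h', sub_self, abs_zero, zero_mul, sub_zero, zero_sub,
      abs_neg, abs_one, one_mul, Real.exp_nonneg, Real.exp_le_exp]
  · rw [abs_of_pos (h'.trans_le h), abs_of_pos h', abs_of_nonneg (by linarith)]
  · rw [abs_of_nonpos (by linarith : x ≤ 0), abs_of_nonpos h', abs_of_neg (by linarith)]
    exact le_of_eq (by ring)

/-- Oriented integrals written over the whole line become kernels to which `exists_kernelOperator`
applies. -/
theorem integral_leStep_sub_mul (F : ℝ → ℝ) (a x : ℝ) :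
    ∫ t, (leStep x t - leStep a t) * F t = ∫ t in a..x, F t := by
  rcases le_total a x with h | h
  · rw [intervalIntegral.integral_of_le h, ← integral_indicator measurableSet_Ioc]
    congr 1 with t
    rcases le_or_gt t x with h1 | h1 <;> rcases le_or_gt t a with h2 | h2 <;>
      simp [leStep_of_le, leStep_of_lt, h1, h2, indicator]
    linarith
  · rw [intervalIntegral.integral_of_ge h, ← integral_indicator measurableSet_Ioc, ← integral_neg]
    congr 1 with t
    rcases le_or_gt t x with h1 | h1 <;> rcases le_or_gt t a with h2 | h2 <;>
      simp [leStep_of_le, leStep_of_lt, h1, h2, indicator]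
    linarith

/-- Half of the exponential rate absorbs the linear factor. -/
theorem abs_mul_exp_neg_le {κ : ℝ} (hκ : 0 < κ) (u : ℝ) :
    |u| * Real.exp (-κ * |u|) ≤ 2 / κ * Real.exp (-(κ / 2) * |u|) := by
  have h1 : κ / 2 * |u| ≤ Real.exp (κ / 2 * |u|) := by
    linarith [Real.add_one_le_exp (κ / 2 * |u|)]
  have h2 : Real.exp (-(κ / 2) * |u|) = Real.exp (κ / 2 * |u|) * Real.exp (-κ * |u|) := by
    rw [← Real.exp_add]; congr 1; ring
  rw [h2, ← mul_assoc]
  gcongr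
  rw [div_mul_eq_mul_div, le_div_iff₀ hκ]
  linarith

/-- Existence of solutions of `y'' = (q - l) y` for bounded continuous `q`, with continuous
dependence on `l`. -/
theorem exists_isSol_family (q : ℝ → ℝ) (hq : Continuous q) (M : ℝ) (hM : ∀ x, |q x| ≤ M)
    (l₀ y₀ y₁ : ℝ) :
    ∃ y y' : ℝ → ℝ → ℝ,
      (∀ l, |l - l₀| < 1 → IsSol (fun x => q x - l) 0 (y l) (y' l) ∧ y l 0 = y₀ ∧ y' l 0 = y₁) ∧
      (∀ x, ContinuousAt (fun l => y l x) l₀) ∧ (∀ x, ContinuousAt (fun l => y' l x) l₀) ∧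
      ∀ h : ℝ → ℝ, Continuous h → ∀ x, ContinuousAt (fun l => ∫ t in (0 : ℝ)..x, y l t * h t) l₀ := by
  have hM0 : 0 ≤ M := (abs_nonneg _).trans (hM 0)
  set M' : ℝ := M + |l₀| + 1 with hM'
  have hM'0 : 0 < M' := by positivity
  -- The weighted Volterra operator will have norm at most 8M'/κ², which this choice makes less than
  -- 1.
  set κ : ℝ := 4 * (M' + 1) with hκdef
  have hκ : 0 < κ := by positivity
  -- `S` is the double integration from 0, conjugated by e^{κ|x|}. The unknown is w = e^{-κ|x|} y,
  -- for which the initial value problem reads (1 - S(q - l))w = g₀.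
  obtain ⟨S, hS, hSn⟩ := exists_kernelOperator
    (fun x t => (x - t) * (leStep x t - leStep 0 t) * Real.exp (-κ * (|x| - |t|)))
    (2 / κ) (κ / 2) (by positivity)
    (fun x => by
      have := measurable_leStep x
      have := measurable_leStep 0
      exact Measurable.aestronglyMeasurable (by fun_prop))
    (fun x t => by
      rw [abs_mul, abs_mul, Real.abs_exp, mul_assoc]
      exact (mul_le_mul_of_nonneg_left (abs_leStep_sub_mul_exp_le κ x t) (abs_nonneg _)).trans
        (abs_mul_exp_neg_le hκ _))
    (fun x₀ => by
      filter_upwards [ae_continuousAt_leStep x₀] with t ht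
      fun_prop)
  let Q : ℝ → (ℝ →ᵇ ℝ) := fun l =>
    BoundedContinuousFunction.ofNormedAddCommGroup q hq M hM - l • 1
  have hQ : ∀ l t, Q l t = q t - l := fun l t => by
    change q t - l * 1 = _
    rw [mul_one]
  have hQn : ∀ l, |l - l₀| < 1 → ‖Q l‖ ≤ M' := fun l hl => by
    refine (BoundedContinuousFunction.norm_le hM'0.le).2 fun t => ?_
    rw [hQ, Real.norm_eq_abs]
    have h1 := abs_sub (q t) l
    have h2 := abs_sub_abs_le_abs_sub l l₀
    linarith [hM t]
  have hQc : Continuous Q := continuous_const.sub (continuous_id.smul continuous_const)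
  let Op : ℝ → ((ℝ →ᵇ ℝ) →L[ℝ] (ℝ →ᵇ ℝ)) := fun l => 1 - S ∘L ContinuousLinearMap.mul ℝ _ (Q l)
  have hOpc : Continuous Op :=
    continuous_const.sub (continuous_const.clm_comp
      ((ContinuousLinearMap.mul ℝ (ℝ →ᵇ ℝ)).continuous.comp hQc))
  have hunit : ∀ l, |l - l₀| < 1 → IsUnit (Op l) := fun l hl => by
    refine isUnit_one_sub_of_norm_lt_one
      (x := S ∘L ContinuousLinearMap.mul ℝ (ℝ →ᵇ ℝ) (Q l)) ?_
    calc ‖S ∘L ContinuousLinearMap.mul ℝ _ (Q l)‖ ≤ 2 / κ * (2 / (κ / 2)) * M' := by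
          refine (ContinuousLinearMap.opNorm_comp_le _ _).trans ?_
          gcongr
          exact (ContinuousLinearMap.opNorm_mul_apply_le ℝ _ _).trans (hQn l hl)
      _ < 1 := by
          have : 2 / κ * (2 / (κ / 2)) * M' = 8 * M' / κ ^ 2 := by field_simp; ring
          rw [this, div_lt_one (by positivity)]
          nlinarith
  let g₀ : ℝ →ᵇ ℝ := BoundedContinuousFunction.ofNormedAddCommGroup
    (fun x => Real.exp (-κ * |x|) * (y₀ + y₁ * x)) (by fun_prop) (|y₀| + |y₁| * (2 / κ)) (fun x => by
      have e1 : Real.exp (-κ * |x|) ≤ 1 := Real.exp_le_one_iff.2 (by nlinarith [abs_nonneg x])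
      have e2 : |x| * Real.exp (-κ * |x|) ≤ 2 / κ := (abs_mul_exp_neg_le hκ x).trans
        (mul_le_of_le_one_right (by positivity) (Real.exp_le_one_iff.2 (by nlinarith [abs_nonneg x])))
      rw [Real.norm_eq_abs, abs_mul, Real.abs_exp]
      calc Real.exp (-κ * |x|) * |y₀ + y₁ * x| ≤ Real.exp (-κ * |x|) * (|y₀| + |y₁| * |x|) := by
            gcongr
            exact (abs_add_le _ _).trans_eq (by rw [abs_mul])
        _ = Real.exp (-κ * |x|) * |y₀| + |y₁| * (|x| * Real.exp (-κ * |x|)) := by ring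
        _ ≤ 1 * |y₀| + |y₁| * (2 / κ) := by gcongr
        _ = _ := by ring)
  let w : ℝ → (ℝ →ᵇ ℝ) := fun l => Ring.inverse (Op l) g₀
  have hw : ∀ l, |l - l₀| < 1 → ∀ x, w l x = g₀ x + S (Q l * w l) x := fun l hl x => by
    have h1 : Op l (w l) = g₀ := by
      change (Op l * Ring.inverse (Op l)) g₀ = g₀
      rw [Ring.mul_inverse_cancel _ (hunit l hl)]; rfl
    have h2 : w l - S (Q l * w l) = g₀ := h1
    have h3 : w l x - S (Q l * w l) x = g₀ x := DFunLike.congr_fun h2 x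
    linarith
  -- Inversion is continuous at units, so w depends on l continuously in the sup norm. Continuity of
  -- the values and of the integrals of y follows.
  have hwc : ContinuousAt w l₀ := by
    have h1 : ContinuousAt (fun l => Ring.inverse (Op l)) l₀ := by
      obtain ⟨u, hu⟩ := hunit l₀ (by simp)
      refine ContinuousAt.comp (g := Ring.inverse) ?_ hOpc.continuousAt
      rw [← hu]
      exact NormedRing.inverse_continuousAt (R := (ℝ →ᵇ ℝ) →L[ℝ] (ℝ →ᵇ ℝ)) u
    exact h1.clm_apply continuousAt_const
  let y : ℝ → ℝ → ℝ := fun l x => Real.exp (κ * |x|) * w l x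
  have hyc : ∀ l, Continuous (y l) := fun l => by
    have := (w l).continuous
    fun_prop
  -- The integral equation in the form of variation of constants over the solutions 1 and x of y'' =
  -- 0, so that `IsSol.varConst` yields differentiability.
  have hy : ∀ l, |l - l₀| < 1 → ∀ x,
      y l x = 1 * (y₀ - ∫ t in (0 : ℝ)..x, t * ((q t - l) * y l t)) +
        x * (y₁ + ∫ t in (0 : ℝ)..x, 1 * ((q t - l) * y l t)) := fun l hl x => by
    have := hyc l
    have h1 : Real.exp (κ * |x|) * S (Q l * w l) x =
        ∫ t in (0 : ℝ)..x, (x * (1 * ((q t - l) * y l t)) - t * ((q t - l) * y l t)) := by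
      rw [hS, ← integral_const_mul, ← integral_leStep_sub_mul]
      congr 1 with t
      change Real.exp (κ * |x|) * (_ * (Q l t * w l t)) = _
      rw [hQ]
      have : Real.exp (κ * |t|) = Real.exp (κ * |x|) * Real.exp (-κ * (|x| - |t|)) := by
        rw [← Real.exp_add]; congr 1; ring
      change _ = (leStep x t - leStep 0 t) * (x * (1 * ((q t - l) * (Real.exp (κ * |t|) * w l t))) -
        t * ((q t - l) * (Real.exp (κ * |t|) * w l t)))
      rw [this]
      ring
    rw [intervalIntegral.integral_sub (Continuous.intervalIntegrable (by fun_prop) _ _)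
      (Continuous.intervalIntegrable (by fun_prop) _ _), intervalIntegral.integral_const_mul] at h1
    have h2 : Real.exp (κ * |x|) * g₀ x = y₀ + y₁ * x := by
      change Real.exp (κ * |x|) * (Real.exp (-κ * |x|) * (y₀ + y₁ * x)) = _
      rw [← mul_assoc, ← Real.exp_add]
      simp
    change Real.exp (κ * |x|) * w l x = _
    rw [hw l hl x, mul_add, h1, h2]
    ring
  have hi : ∀ h : ℝ → ℝ, Continuous h → ∀ x,
      ContinuousAt (fun l => ∫ t in (0 : ℝ)..x, y l t * h t) l₀ := fun h hh x => by
    have h1 : Continuous fun g : ℝ →ᵇ ℝ => ∫ t in (0 : ℝ)..x, Real.exp (κ * |t|) * g t * h t := by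
      refine intervalIntegral.continuous_parametric_intervalIntegral_of_continuous' ?_ 0 x
      have h2 : Continuous fun z : (ℝ →ᵇ ℝ) × ℝ => z.1 z.2 := continuous_eval
      have h3 : Continuous fun z : (ℝ →ᵇ ℝ) × ℝ => Real.exp (κ * |z.2|) * z.1 z.2 * h z.2 := by
        fun_prop
      exact h3
    exact h1.continuousAt.comp hwc
  refine ⟨y, fun l x => y₁ + ∫ t in (0 : ℝ)..x, 1 * ((q t - l) * y l t), fun l hl => ⟨?_, ?_, ?_⟩,
    fun x => ?_, fun x => ?_, hi⟩
  · have h1 : IsSol 0 0 (fun _ => 1) (fun _ => 0) :=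
      ⟨fun x => hasDerivAt_const _ _, fun x => by simpa using hasDerivAt_const x (0 : ℝ)⟩
    have h2 : IsSol 0 0 (fun x => x) (fun _ => 1) :=
      ⟨fun x => hasDerivAt_id' x, fun x => by simpa using hasDerivAt_const x (1 : ℝ)⟩
    have := hyc l
    have h3 := h1.varConst (f := fun t => (q t - l) * y l t) h2 (fun x => by simp) (by fun_prop) y₀ y₁
    refine ⟨fun x => ?_, fun x => ?_⟩
    · have := h3.deriv_fst x
      simp only [← hy l hl] at this
      exact this.congr_deriv (by simp)
    · have := h3.deriv_snd x
      simp at this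
      simpa using this
  · rw [hy l hl]; simp
  · simp
  · have h1 : ContinuousAt (fun l => w l x) l₀ :=
      (BoundedContinuousFunction.evalCLM ℝ x).continuous.continuousAt.comp hwc
    exact continuousAt_const.mul h1
  · have h1 : (fun l => y₁ + ∫ t in (0 : ℝ)..x, 1 * ((q t - l) * y l t)) = fun l =>
        y₁ + ((∫ t in (0 : ℝ)..x, y l t * q t) - l * ∫ t in (0 : ℝ)..x, y l t * 1) := by
      funext l
      have := hyc l
      rw [← intervalIntegral.integral_const_mul, ← intervalIntegral.integral_sub
        (Continuous.intervalIntegrable (by fun_prop) _ _)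
        (Continuous.intervalIntegrable (by fun_prop) _ _)]
      congr 2 with t
      ring
    rw [h1]
    exact continuousAt_const.add ((hi q hq x).sub (continuousAt_id.mul (hi _ continuous_const x)))

theorem exists_isSol (q : ℝ → ℝ) (hq : Continuous q) (M : ℝ) (hM : ∀ x, |q x| ≤ M) (y₀ y₁ : ℝ) :
    ∃ y y' : ℝ → ℝ, IsSol q 0 y y' ∧ y 0 = y₀ ∧ y' 0 = y₁ := by
  obtain ⟨y, y', h, -⟩ := exists_isSol_family q hq M hM 0 y₀ y₁
  obtain ⟨h1, h2, h3⟩ := h 0 (by simp)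
  exact ⟨y 0, y' 0, by simpa using h1, h2, h3⟩

/-! ### Integrable perturbations of dichotomies on a half-line. -/

/-- An integral inequality with small total mass implies exponential decay up to the size `δ` of
the error at the right end point. -/
theorem le_two_mul_of_le_integral {x₀ N κ η c δ : ℝ} {ρ v : ℝ → ℝ} (hκ : 0 ≤ κ)
    (hη : 0 ≤ η) (hc : 0 ≤ c) (hδ : 0 < δ) (hρc : Continuous ρ) (hρ : ∀ x, 0 ≤ ρ x)
    (hvc : Continuous v) (hv : ∀ x, 0 ≤ v x) (hsmall : κ * ∫ t in x₀..N, ρ t ≤ 1 / 2)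
    (h : ∀ x ∈ Icc x₀ N, v x ≤ c * Real.exp (-η * (x - x₀)) + δ +
      κ * (∫ t in x₀..x, Real.exp (-η * (x - t)) * (ρ t * v t)) + κ * ∫ t in x..N, ρ t * v t) :
    ∀ x ∈ Icc x₀ N, v x ≤ 2 * (c * Real.exp (-η * (x - x₀)) + δ) := by
  intro x hx
  have hN : x₀ ≤ N := hx.1.trans hx.2
  set g : ℝ → ℝ := fun x => c * Real.exp (-η * (x - x₀)) + δ with hg
  have hgpos : ∀ x, 0 < g x := fun x => by positivity
  have hgc : Continuous g := by fun_prop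
  -- At a maximum of v/g both integrals together are at most half of the maximum times g(z), so the
  -- maximum w satisfies w ≤ 1 + w/2. Positivity of δ keeps g away from zero.
  obtain ⟨z, hz, hmax⟩ := isCompact_Icc.exists_isMaxOn (nonempty_Icc.2 hN)
    (hvc.div hgc fun x => (hgpos x).ne').continuousOn
  set w := v z / g z with hw
  have hw0 : 0 ≤ w := div_nonneg (hv z) (hgpos z).le
  have hvw : ∀ t ∈ Icc x₀ N, v t ≤ w * g t := fun t ht =>
    (div_le_iff₀ (hgpos t)).1 (hmax ht)
  have h1 : ∫ t in x₀..z, Real.exp (-η * (z - t)) * (ρ t * v t) ≤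
      ∫ t in x₀..z, w * g z * ρ t := by
    refine intervalIntegral.integral_mono_on hz.1 (Continuous.intervalIntegrable (by fun_prop) _ _)
      (Continuous.intervalIntegrable (by fun_prop) _ _) fun t ht => ?_
    have e1 : Real.exp (-η * (z - t)) * g t ≤ g z := by
      simp only [hg, mul_add]
      have : Real.exp (-η * (z - t)) * (c * Real.exp (-η * (t - x₀))) =
          c * Real.exp (-η * (z - x₀)) := by
        rw [mul_left_comm, ← Real.exp_add]; congr 2; ring
      rw [this]
      have : Real.exp (-η * (z - t)) ≤ 1 := Real.exp_le_one_iff.2 (by nlinarith [ht.2])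
      nlinarith
    calc Real.exp (-η * (z - t)) * (ρ t * v t)
        ≤ Real.exp (-η * (z - t)) * (ρ t * (w * g t)) := by
          have := hρ t
          gcongr
          exact hvw t ⟨ht.1, ht.2.trans hz.2⟩
      _ = (ρ t * w) * (Real.exp (-η * (z - t)) * g t) := by ring
      _ ≤ (ρ t * w) * g z := mul_le_mul_of_nonneg_left e1 (mul_nonneg (hρ t) hw0)
      _ = _ := by ring
  have h2 : ∫ t in z..N, ρ t * v t ≤ ∫ t in z..N, w * g z * ρ t := by
    refine intervalIntegral.integral_mono_on hz.2 (Continuous.intervalIntegrable (by fun_prop) _ _)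
      (Continuous.intervalIntegrable (by fun_prop) _ _) fun t ht => ?_
    have e1 : g t ≤ g z := by
      simp only [hg]
      gcongr c * Real.exp ?_ + δ
      nlinarith [ht.1]
    calc ρ t * v t ≤ ρ t * (w * g z) := by
          have := hρ t
          gcongr
          exact (hvw t ⟨hz.1.trans ht.1, ht.2⟩).trans (by gcongr)
      _ = _ := by ring
  rw [intervalIntegral.integral_const_mul] at h1 h2
  have h3 := intervalIntegral.integral_add_adjacent_intervals
    (hρc.intervalIntegrable x₀ z (μ := volume)) (hρc.intervalIntegrable z N)
  have h4 : v z ≤ g z + w * g z * (1 / 2) := by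
    calc v z ≤ g z + κ * (∫ t in x₀..z, Real.exp (-η * (z - t)) * (ρ t * v t)) +
          κ * ∫ t in z..N, ρ t * v t := h z hz
      _ ≤ g z + κ * (w * g z * ∫ t in x₀..z, ρ t) + κ * (w * g z * ∫ t in z..N, ρ t) := by gcongr
      _ = g z + w * g z * (κ * ∫ t in x₀..N, ρ t) := by rw [← h3]; ring
      _ ≤ _ := by
          have := hgpos z
          gcongr
  have h5 : v z = w * g z := by rw [hw, div_mul_cancel₀ _ (hgpos z).ne']
  have h6 : w ≤ 2 := by
    rw [h5] at h4
    by_contra hcon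
    nlinarith [hgpos z]
  exact (hvw x hx).trans (mul_le_mul_of_nonneg_right h6 (hgpos x).le)

theorem exists_small_tail {ρ : ℝ → ℝ} (hρ : ∀ x, 0 ≤ ρ x) (hi : Integrable ρ) (κ : ℝ) (hκ : 0 ≤ κ) :
    ∃ x₀, 0 ≤ x₀ ∧ ∀ N, x₀ ≤ N → κ * ∫ t in x₀..N, ρ t ≤ 1 / 2 := by
  have h := intervalIntegral_tendsto_integral_Ioi (f := ρ) 0 hi.integrableOn tendsto_id
  -- The denominator κ + 1 in place of κ also covers κ = 0.
  have h1 : ∀ᶠ x in atTop, (∫ t in Ioi (0 : ℝ), ρ t) - 1 / (2 * (κ + 1)) < ∫ t in (0 : ℝ)..x, ρ t :=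
    h.eventually (lt_mem_nhds (sub_lt_self _ (by positivity)))
  obtain ⟨x₀, hx, hx0⟩ := (h1.and (eventually_ge_atTop 0)).exists
  refine ⟨x₀, hx0, fun N hN => ?_⟩
  have h2 : ∫ t in (0 : ℝ)..N, ρ t ≤ ∫ t in Ioi (0 : ℝ), ρ t := by
    rw [intervalIntegral.integral_of_le (hx0.trans hN)]
    exact setIntegral_mono_set hi.integrableOn (.of_forall hρ) (Ioc_subset_Ioi_self.eventuallyLE)
  have h3 := intervalIntegral.integral_add_adjacent_intervals
    (hi.intervalIntegrable (a := 0) (b := x₀)) (hi.intervalIntegrable (a := x₀) (b := N))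
  have h4 : ∫ t in x₀..N, ρ t ≤ 1 / (2 * (κ + 1)) := by linarith
  calc κ * ∫ t in x₀..N, ρ t ≤ κ * (1 / (2 * (κ + 1))) := by gcongr
    _ ≤ 1 / 2 := by
        rw [mul_one_div, div_le_div_iff₀ (by positivity) (by norm_num)]
        linarith

/-- A pair of solutions of `y'' = q y` with Wronskian `1`, the first bounded by `e^{-αx}` and the
second by `e^{αx}`. -/
structure DichotomyPair (q : ℝ → ℝ) (α : ℝ) where
  φ : ℝ → ℝ
  φ' : ℝ → ℝ
  ψ : ℝ → ℝ
  ψ' : ℝ → ℝ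
  C : ℝ
  sol_φ : IsSol q 0 φ φ'
  sol_ψ : IsSol q 0 ψ ψ'
  wronskian : ∀ x, φ x * ψ' x - φ' x * ψ x = 1
  φ_le : ∀ x, |φ x| ≤ C * Real.exp (-α * x)
  φ'_le : ∀ x, |φ' x| ≤ C * Real.exp (-α * x)
  ψ_le : ∀ x, |ψ x| ≤ C * Real.exp (α * x)
  ψ'_le : ∀ x, |ψ' x| ≤ C * Real.exp (α * x)

namespace DichotomyPair

variable {q f u u' : ℝ → ℝ} {α : ℝ}

theorem C_nonneg (P : DichotomyPair q α) : 0 ≤ P.C := by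
  have := (abs_nonneg _).trans (P.φ_le 0)
  simpa using this

/-- The image of a pair under `x ↦ -x`. -/
def reflect (P : DichotomyPair q α) : DichotomyPair (fun x => q (-x)) α where
  φ x := P.ψ (-x)
  φ' x := -P.ψ' (-x)
  ψ x := P.φ (-x)
  ψ' x := -P.φ' (-x)
  C := P.C
  sol_φ := by simpa using! P.sol_ψ.reflect
  sol_ψ := by simpa using! P.sol_φ.reflect
  wronskian x := by linear_combination P.wronskian (-x)
  φ_le x := by simpa using P.ψ_le (-x)
  φ'_le x := by simpa using P.ψ'_le (-x)
  ψ_le x := by simpa using P.φ_le (-x)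
  ψ'_le x := by simpa using P.φ'_le (-x)

/-- For `α = 0` the two solutions may be interchanged. -/
def swap (P : DichotomyPair q 0) : DichotomyPair q 0 where
  φ := P.ψ
  φ' := P.ψ'
  ψ x := -P.φ x
  ψ' x := -P.φ' x
  C := P.C
  sol_φ := P.sol_ψ
  sol_ψ := by simpa using! P.sol_φ.const_mul (-1)
  wronskian x := by linear_combination P.wronskian x
  φ_le x := by simpa using P.ψ_le x
  φ'_le x := by simpa using P.ψ'_le x
  ψ_le x := by simpa using P.φ_le x
  ψ'_le x := by simpa using P.φ'_le x

theorem abs_coeff_φ_le (P : DichotomyPair q α) (x : ℝ) :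
    |P.ψ x * u' x - P.ψ' x * u x| ≤ 2 * P.C * Real.exp (α * x) * max |u x| |u' x| := by
  have h1 := P.ψ_le x
  have h2 := P.ψ'_le x
  have h3 := le_max_left |u x| |u' x|
  have h4 := le_max_right |u x| |u' x|
  have h5 := abs_sub (P.ψ x * u' x) (P.ψ' x * u x)
  rw [abs_mul, abs_mul] at h5
  have h6 := mul_le_mul h1 h4 (abs_nonneg _) ((abs_nonneg _).trans h1)
  have h7 := mul_le_mul h2 h3 (abs_nonneg _) ((abs_nonneg _).trans h1)
  linarith

theorem abs_coeff_ψ_le (P : DichotomyPair q α) (x : ℝ) :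
    |P.φ x * u' x - P.φ' x * u x| ≤ 2 * P.C * Real.exp (-α * x) * max |u x| |u' x| := by
  have h1 := P.φ_le x
  have h2 := P.φ'_le x
  have h3 := le_max_left |u x| |u' x|
  have h4 := le_max_right |u x| |u' x|
  have h5 := abs_sub (P.φ x * u' x) (P.φ' x * u x)
  rw [abs_mul, abs_mul] at h5
  have h6 := mul_le_mul h1 h4 (abs_nonneg _) ((abs_nonneg _).trans h1)
  have h7 := mul_le_mul h2 h3 (abs_nonneg _) ((abs_nonneg _).trans h1)
  linarith

/-- Wronskian 1 lets `u` and `u'` be reassembled from their two coordinates; the bounds of the pair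
then weigh each coordinate. -/
theorem max_abs_le (P : DichotomyPair q α) (x : ℝ) :
    max |u x| |u' x| ≤
      P.C * Real.exp (-α * x) * |P.ψ x * u' x - P.ψ' x * u x| +
      P.C * Real.exp (α * x) * |P.φ x * u' x - P.φ' x * u x| := by
  have h1 : u x = P.ψ x * (P.φ x * u' x - P.φ' x * u x) -
      P.φ x * (P.ψ x * u' x - P.ψ' x * u x) := by
    linear_combination (-u x) * P.wronskian x
  have h2 : u' x = P.ψ' x * (P.φ x * u' x - P.φ' x * u x) -
      P.φ' x * (P.ψ x * u' x - P.ψ' x * u x) := by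
    linear_combination (-u' x) * P.wronskian x
  refine max_le ?_ ?_
  · rw [add_comm]
    nth_rw 1 [h1]
    refine (abs_sub _ _).trans ?_
    rw [abs_mul, abs_mul]
    gcongr
    exacts [P.ψ_le x, P.φ_le x]
  · rw [add_comm]
    nth_rw 1 [h2]
    refine (abs_sub _ _).trans ?_
    rw [abs_mul, abs_mul]
    gcongr
    exacts [P.ψ'_le x, P.φ'_le x]

theorem abs_integral_mul_le {χ F G : ℝ → ℝ} (hF : Continuous F) (hG : Continuous G)
    (hχ : ∀ x, |χ x| ≤ G x) (hf : ∀ x, |f x| ≤ F x) {a b : ℝ} (hab : a ≤ b) :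
    |∫ t in a..b, χ t * f t| ≤ ∫ t in a..b, G t * F t := by
  rw [← Real.norm_eq_abs]
  refine intervalIntegral.norm_integral_le_of_norm_le hab (.of_forall fun t _ => ?_)
    ((hG.mul hF).intervalIntegrable _ _)
  rw [norm_mul]
  exact mul_le_mul (hχ t) (hf t) (norm_nonneg _) ((abs_nonneg _).trans (hχ t))

/-- The contribution of the decaying solution, integrated from the left. -/
theorem stable_le (P : DichotomyPair q α) {η : ℝ} (hη : η ≤ α) (hu : IsSol q f u u')
    (hf : Continuous f) {F : ℝ → ℝ} (hF : Continuous F) (hfF : ∀ x, |f x| ≤ F x) {x₀ x : ℝ}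
    (hx : x₀ ≤ x) :
    P.C * Real.exp (-α * x) * |P.ψ x * u' x - P.ψ' x * u x| ≤
      2 * P.C ^ 2 * max |u x₀| |u' x₀| * Real.exp (-η * (x - x₀)) +
      P.C ^ 2 * ∫ t in x₀..x, Real.exp (-η * (x - t)) * F t := by
  have hC := P.C_nonneg
  have hF0 : ∀ t, 0 ≤ F t := fun t => (abs_nonneg _).trans (hfF t)
  rw [P.sol_ψ.wronskian_sub hu hf x₀ x]
  have h1 := abs_integral_mul_le hF (G := fun t => P.C * Real.exp (α * t)) (by fun_prop) P.ψ_le hfF hx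
  have h2 : P.C * Real.exp (-α * x) * ∫ t in x₀..x, P.C * Real.exp (α * t) * F t =
      P.C ^ 2 * ∫ t in x₀..x, Real.exp (-α * (x - t)) * F t := by
    rw [← intervalIntegral.integral_const_mul, ← intervalIntegral.integral_const_mul]
    congr 1 with t
    have : Real.exp (-α * (x - t)) = Real.exp (-α * x) * Real.exp (α * t) := by
      rw [← Real.exp_add]; congr 1; ring
    rw [this]; ring
  have h3 : ∫ t in x₀..x, Real.exp (-α * (x - t)) * F t ≤
      ∫ t in x₀..x, Real.exp (-η * (x - t)) * F t := by
    refine intervalIntegral.integral_mono_on hx (Continuous.intervalIntegrable (by fun_prop) _ _)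
      (Continuous.intervalIntegrable (by fun_prop) _ _) fun t ht => ?_
    have := hF0 t
    gcongr ?_ * F t
    refine Real.exp_le_exp.2 ?_
    nlinarith [ht.2]
  have h4 : P.C * Real.exp (-α * x) *
      (2 * P.C * Real.exp (α * x₀) * max |u x₀| |u' x₀|) ≤
      2 * P.C ^ 2 * max |u x₀| |u' x₀| * Real.exp (-η * (x - x₀)) := by
    have e1 : Real.exp (-α * x) * Real.exp (α * x₀) ≤ Real.exp (-η * (x - x₀)) := by
      rw [← Real.exp_add]
      refine Real.exp_le_exp.2 ?_
      nlinarith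
    calc _ = 2 * P.C ^ 2 * max |u x₀| |u' x₀| * (Real.exp (-α * x) * Real.exp (α * x₀)) := by ring
      _ ≤ _ := by gcongr
  calc _ ≤ P.C * Real.exp (-α * x) * (|P.ψ x₀ * u' x₀ - P.ψ' x₀ * u x₀| +
        |∫ t in x₀..x, P.ψ t * f t|) := by
        gcongr
        exact abs_add_le _ _
    _ ≤ P.C * Real.exp (-α * x) * (2 * P.C * Real.exp (α * x₀) * max |u x₀| |u' x₀| +
        ∫ t in x₀..x, P.C * Real.exp (α * t) * F t) := by
        gcongr
        exact P.abs_coeff_φ_le x₀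
    _ = P.C * Real.exp (-α * x) * (2 * P.C * Real.exp (α * x₀) * max |u x₀| |u' x₀|) +
        P.C ^ 2 * ∫ t in x₀..x, Real.exp (-α * (x - t)) * F t := by rw [mul_add, h2]
    _ ≤ _ := by gcongr

/-- The contribution of the growing solution, integrated from the right. -/
theorem unstable_le (P : DichotomyPair q α) (hα : 0 ≤ α) (hu : IsSol q f u u')
    (hf : Continuous f) {F : ℝ → ℝ} (hF : Continuous F) (hfF : ∀ x, |f x| ≤ F x) {x N : ℝ}
    (hx : x ≤ N) :
    P.C * Real.exp (α * x) * |P.φ x * u' x - P.φ' x * u x| ≤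
      P.C * Real.exp (α * x) * |P.φ N * u' N - P.φ' N * u N| + P.C ^ 2 * ∫ t in x..N, F t := by
  have hC := P.C_nonneg
  have hF0 : ∀ t, 0 ≤ F t := fun t => (abs_nonneg _).trans (hfF t)
  have h0 : P.φ x * u' x - P.φ' x * u x =
      (P.φ N * u' N - P.φ' N * u N) - ∫ t in x..N, P.φ t * f t := by
    rw [P.sol_φ.wronskian_sub hu hf x N]; ring
  rw [h0]
  have h1 := abs_integral_mul_le hF (G := fun t => P.C * Real.exp (-α * t)) (by fun_prop) P.φ_le hfF hx
  have h2 : P.C * Real.exp (α * x) * ∫ t in x..N, P.C * Real.exp (-α * t) * F t ≤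
      P.C ^ 2 * ∫ t in x..N, F t := by
    rw [← intervalIntegral.integral_const_mul, ← intervalIntegral.integral_const_mul]
    refine intervalIntegral.integral_mono_on hx (Continuous.intervalIntegrable (by fun_prop) _ _)
      (Continuous.intervalIntegrable (by fun_prop) _ _) fun t ht => ?_
    have e1 : Real.exp (α * x) * Real.exp (-α * t) ≤ 1 := by
      rw [← Real.exp_add]
      refine Real.exp_le_one_iff.2 ?_
      nlinarith [ht.1]
    have := hF0 t
    calc _ = P.C ^ 2 * F t * (Real.exp (α * x) * Real.exp (-α * t)) := by ring
      _ ≤ P.C ^ 2 * F t * 1 := by gcongr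
      _ = _ := by ring
  calc _ ≤ P.C * Real.exp (α * x) * (|P.φ N * u' N - P.φ' N * u N| +
        |∫ t in x..N, P.φ t * f t|) := by
        gcongr
        exact abs_sub _ _
    _ ≤ P.C * Real.exp (α * x) * (|P.φ N * u' N - P.φ' N * u N| +
        ∫ t in x..N, P.C * Real.exp (-α * t) * F t) := by gcongr
    _ ≤ _ := by rw [mul_add]; gcongr

theorem exp_mul_abs_coeff_le (P : DichotomyPair q α) (hα : 0 ≤ α) {x N : ℝ} (hx : x ≤ N) :
    P.C * Real.exp (α * x) * |P.φ N * u' N - P.φ' N * u N| ≤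
      2 * P.C ^ 2 * max |u N| |u' N| := by
  have hC := P.C_nonneg
  have e1 : Real.exp (α * x) * Real.exp (-α * N) ≤ 1 := by
    rw [← Real.exp_add]
    refine Real.exp_le_one_iff.2 ?_
    nlinarith
  calc _ ≤ P.C * Real.exp (α * x) * (2 * P.C * Real.exp (-α * N) * max |u N| |u' N|) := by
        gcongr
        exact P.abs_coeff_ψ_le N
    _ = 2 * P.C ^ 2 * max |u N| |u' N| * (Real.exp (α * x) * Real.exp (-α * N)) := by ring
    _ ≤ 2 * P.C ^ 2 * max |u N| |u' N| * 1 := by gcongr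
    _ = _ := by ring

/-- A solution of a perturbed equation is estimated by its values at two points. -/
theorem max_abs_le_two_point (P : DichotomyPair q α) {η : ℝ} (hη : 0 ≤ η) (hα : α = 0 ∨ η ≤ α)
    (hu : IsSol q f u u') (hf : Continuous f) {F : ℝ → ℝ} (hF : Continuous F)
    (hfF : ∀ x, |f x| ≤ F x) {x₀ x N : ℝ} (hx₀ : x₀ ≤ x) (hx : x ≤ N) :
    max |u x| |u' x| ≤ 2 * P.C ^ 2 * max |u x₀| |u' x₀| * Real.exp (-η * (x - x₀)) +
      4 * P.C ^ 2 * max |u N| |u' N| +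
      2 * P.C ^ 2 * (∫ t in x₀..x, Real.exp (-η * (x - t)) * F t) +
      2 * P.C ^ 2 * ∫ t in x..N, F t := by
  have hF0 : ∀ t, 0 ≤ F t := fun t => (abs_nonneg _).trans (hfF t)
  have hm := fun x => (abs_nonneg _).trans (le_max_left |u x| |u' x|)
  have i1 : 0 ≤ P.C ^ 2 * ∫ t in x₀..x, Real.exp (-η * (x - t)) * F t :=
    mul_nonneg (sq_nonneg _) (intervalIntegral.integral_nonneg hx₀ fun t _ =>
      mul_nonneg (Real.exp_nonneg _) (hF0 t))
  have i2 : 0 ≤ P.C ^ 2 * ∫ t in x..N, F t :=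
    mul_nonneg (sq_nonneg _) (intervalIntegral.integral_nonneg hx fun t _ => hF0 t)
  have i3 : 0 ≤ P.C ^ 2 * max |u N| |u' N| := mul_nonneg (sq_nonneg _) (hm N)
  have i4 : 0 ≤ 2 * P.C ^ 2 * max |u x₀| |u' x₀| * Real.exp (-η * (x - x₀)) :=
    mul_nonneg (mul_nonneg (by positivity) (hm _)) (Real.exp_nonneg _)
  have hα0 : 0 ≤ α := by rcases hα with h | h <;> linarith
  have h1 := P.max_abs_le (u := u) (u' := u') x
  have h2 := P.unstable_le hα0 hu hf hF hfF hx
  have h3 := P.exp_mul_abs_coeff_le (u := u) (u' := u') hα0 hx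
  rcases hα with h | h
  · subst h
    -- With α = 0 neither solution decays, so after interchanging them both coordinates are
    -- continued back from N.
    have h4 := P.swap.unstable_le le_rfl hu hf hF hfF hx
    have h5 := P.swap.exp_mul_abs_coeff_le (u := u) (u' := u') le_rfl hx
    simp only [swap, neg_zero, zero_mul, Real.exp_zero, mul_one] at h1 h2 h3 h4 h5
    linarith
  · have h4 := P.stable_le h hu hf hF hfF hx₀
    linarith

/-- Every solution of a perturbed equation grows at most like `e^{αx}`. -/
theorem exists_growth_le (P : DichotomyPair q α) (hα : 0 ≤ α) {r ρ y y' : ℝ → ℝ}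
    (hr : Continuous r) (hρc : Continuous ρ) (hρi : Integrable ρ) (hrρ : ∀ x, |r x| ≤ ρ x)
    (hy : IsSol (fun x => q x + r x) 0 y y') :
    ∃ C, ∀ x, 0 ≤ x → |y x| ≤ C * Real.exp (α * x) ∧ |y' x| ≤ C * Real.exp (α * x) := by
  have hρ : ∀ x, 0 ≤ ρ x := fun x => (abs_nonneg _).trans (hrρ x)
  have hyc := hy.continuous
  have hyc' := hy.continuous_deriv
  set m : ℝ → ℝ := fun x => max |y x| |y' x| with hm
  have hmc : Continuous m := by fun_prop
  have hm0 : ∀ x, 0 ≤ m x := fun x => (abs_nonneg _).trans (le_max_left _ _)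
  have hsol := hy.congr_potential
  simp only [Pi.zero_apply, add_zero] at hsol
  obtain ⟨x₀, hx₀, hsmall⟩ := exists_small_tail hρ hρi (2 * P.C ^ 2) (by positivity)
  obtain ⟨K, hK⟩ := (isCompact_Icc (a := (0 : ℝ)) (b := x₀)).exists_bound_of_continuousOn
    (f := fun x => Real.exp (-α * x) * m x) (by fun_prop)
  set v : ℝ → ℝ := fun x => Real.exp (-α * x) * m x with hv
  -- The inequality is used with rate 0 on [x₀, x] and evaluated at the right end point. The value δ
  -- = 1 only keeps the comparison function positive.
  have key : ∀ x, x₀ ≤ x → v x ≤ 2 * (4 * P.C ^ 2 * v x₀ + 1) := by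
    intro x hx
    have hv0 : 0 ≤ v x₀ := mul_nonneg (Real.exp_nonneg _) (hm0 x₀)
    have := le_two_mul_of_le_integral (x₀ := x₀) (N := x) (κ := 2 * P.C ^ 2) (η := 0)
      (c := 4 * P.C ^ 2 * v x₀) (δ := 1) (ρ := ρ) (v := v) (by positivity) le_rfl
      (by positivity) one_pos hρc hρ (by fun_prop) (fun x => mul_nonneg (Real.exp_nonneg _) (hm0 x))
      (hsmall x hx) (fun z hz => ?_) x ⟨hx, le_rfl⟩
    · simpa using this
    · have hz' := neg_le_neg hz.1
      have hF : Continuous fun t => ρ t * m t := by fun_prop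
      have hfF : ∀ t, |r t * y t| ≤ ρ t * m t := fun t => by
        rw [abs_mul]
        exact mul_le_mul (hrρ t) (le_max_left _ _) (abs_nonneg _) (hρ t)
      have h1 := P.max_abs_le (u := y) (u' := y') z
      have h2 := P.stable_le (η := -α) (by linarith) hsol (hr.mul hyc) hF hfF hz.1
      -- For an upper growth bound the growing coordinate is integrated from the left as well, so
      -- nothing needs to be known at infinity.
      have h3 : P.C * Real.exp (α * z) * |P.φ z * y' z - P.φ' z * y z| ≤
          2 * P.C ^ 2 * m x₀ * Real.exp (α * (z - x₀)) +
          P.C ^ 2 * ∫ t in x₀..z, Real.exp (α * (z - t)) * (ρ t * m t) := by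
        have hC := P.C_nonneg
        have i1 := abs_integral_mul_le hF (G := fun t => P.C * Real.exp (-α * t)) (by fun_prop)
          P.φ_le hfF hz.1
        have i2 : P.C * Real.exp (α * z) * ∫ t in x₀..z, P.C * Real.exp (-α * t) * (ρ t * m t) =
            P.C ^ 2 * ∫ t in x₀..z, Real.exp (α * (z - t)) * (ρ t * m t) := by
          rw [← intervalIntegral.integral_const_mul, ← intervalIntegral.integral_const_mul]
          congr 1 with t
          have : Real.exp (α * (z - t)) = Real.exp (α * z) * Real.exp (-α * t) := by
            rw [← Real.exp_add]; congr 1; ring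
          rw [this]; ring
        have i3 : Real.exp (α * (z - x₀)) = Real.exp (α * z) * Real.exp (-α * x₀) := by
          rw [← Real.exp_add]; congr 1; ring
        rw [P.sol_φ.wronskian_sub hsol (hr.mul hyc) x₀ z]
        calc _ ≤ P.C * Real.exp (α * z) * (|P.φ x₀ * y' x₀ - P.φ' x₀ * y x₀| +
              |∫ t in x₀..z, P.φ t * (r t * y t)|) := by
              gcongr
              exact abs_add_le _ _
          _ ≤ P.C * Real.exp (α * z) * (2 * P.C * Real.exp (-α * x₀) * m x₀ +
              ∫ t in x₀..z, P.C * Real.exp (-α * t) * (ρ t * m t)) := by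
              gcongr
              exact P.abs_coeff_ψ_le x₀
          _ = _ := by rw [mul_add, i2, i3]; ring
      simp only [neg_neg] at h2
      have h4 : m z ≤ 4 * P.C ^ 2 * m x₀ * Real.exp (α * (z - x₀)) +
          2 * P.C ^ 2 * ∫ t in x₀..z, Real.exp (α * (z - t)) * (ρ t * m t) := by
        linarith
      have h5 : Real.exp (-α * z) * ∫ t in x₀..z, Real.exp (α * (z - t)) * (ρ t * m t) =
          ∫ t in x₀..z, Real.exp (-0 * (z - t)) * (ρ t * v t) := by
        rw [← intervalIntegral.integral_const_mul]
        congr 1 with t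
        have : Real.exp (-α * t) = Real.exp (-α * z) * Real.exp (α * (z - t)) := by
          rw [← Real.exp_add]; congr 1; ring
        simp only [hv, this, neg_zero, zero_mul, Real.exp_zero]
        ring
      have h6 : Real.exp (-α * x₀) = Real.exp (-α * z) * Real.exp (α * (z - x₀)) := by
        rw [← Real.exp_add]; congr 1; ring
      have h7 := mul_le_mul_of_nonneg_left h4 (Real.exp_nonneg (-α * z))
      have h8 : 0 ≤ 2 * P.C ^ 2 * ∫ t in z..x, ρ t * v t :=
        mul_nonneg (by positivity) (intervalIntegral.integral_nonneg hz.2 fun t _ =>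
          mul_nonneg (hρ t) (mul_nonneg (Real.exp_nonneg _) (hm0 t)))
      rw [← h5]
      simp only [neg_zero, zero_mul, Real.exp_zero, hv, h6] at h7 h8 ⊢
      linarith
  have hall : ∀ x, 0 ≤ x → m x ≤ (K + 2 * (4 * P.C ^ 2 * v x₀ + 1)) * Real.exp (α * x) := by
    intro x hx
    have hK0 : 0 ≤ K := (norm_nonneg _).trans (hK 0 ⟨le_rfl, hx₀⟩)
    have hv0 : 0 ≤ v x₀ := mul_nonneg (Real.exp_nonneg _) (hm0 x₀)
    have h1 : v x ≤ K + 2 * (4 * P.C ^ 2 * v x₀ + 1) := by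
      rcases le_total x x₀ with h | h
      · have := (le_abs_self _).trans (hK x ⟨hx, h⟩)
        have : 0 ≤ 2 * (4 * P.C ^ 2 * v x₀ + 1) := by positivity
        simp only [hv] at *
        linarith
      · linarith [key x h]
    have h2 : m x = v x * Real.exp (α * x) := by
      simp only [hv]
      rw [mul_right_comm, ← Real.exp_add]
      simp
    rw [h2]
    gcongr
  exact ⟨_, fun x hx => ⟨(le_max_left _ _).trans (hall x hx), (le_max_right _ _).trans (hall x hx)⟩⟩

/-- A perturbed equation with `α ≥ 0` keeps a nontrivial solution of size `e^{-αx}` at `+∞`. -/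
theorem exists_decaying (P : DichotomyPair q α) (hα : 0 ≤ α) {r ρ c c' s s' : ℝ → ℝ}
    (hr : Continuous r) (hρc : Continuous ρ) (hρi : Integrable ρ) (hrρ : ∀ x, |r x| ≤ ρ x)
    (hcs : IsSol (fun x => q x + r x) 0 c c') (hss : IsSol (fun x => q x + r x) 0 s s') :
    ∃ a b : ℝ, (a ≠ 0 ∨ b ≠ 0) ∧ ∃ C, ∀ x, 0 ≤ x →
      |a * c x + b * s x| ≤ C * Real.exp (-α * x) ∧
      |a * c' x + b * s' x| ≤ C * Real.exp (-α * x) := by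
  have hρ : ∀ x, 0 ≤ ρ x := fun x => (abs_nonneg _).trans (hrρ x)
  obtain ⟨x₀, hx₀, hsmall⟩ := exists_small_tail hρ hρi (2 * P.C ^ 2) (by positivity)
  set m : ℝ × ℝ → ℝ → ℝ := fun v x => max |v.1 * c x + v.2 * s x| |v.1 * c' x + v.2 * s' x| with hm
  have hcc := hcs.continuous
  have hcc' := hcs.continuous_deriv
  have hsc := hss.continuous
  have hsc' := hss.continuous_deriv
  have hmc : ∀ v, Continuous (m v) := fun v => by fun_prop
  have hmv : ∀ x, Continuous fun v => m v x := fun x => by fun_prop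
  have hm0 : ∀ v x, 0 ≤ m v x := fun v x => (abs_nonneg _).trans (le_max_left _ _)
  obtain ⟨K, hK⟩ := (isCompact_sphere (0 : ℝ × ℝ) 1).exists_bound_of_continuousOn
    (f := fun v => m v x₀) (hmv x₀).continuousOn
  have hK' : ∀ v ∈ Metric.sphere (0 : ℝ × ℝ) 1, m v x₀ ≤ K := fun v hv =>
    (le_abs_self _).trans (hK v hv)
  -- Among the normalized initial data some make the growing coordinate vanish at N, this being one
  -- linear condition on two parameters.
  have hchoice : ∀ N : ℝ, ∃ v ∈ Metric.sphere (0 : ℝ × ℝ) 1,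
      P.φ N * (v.1 * c' N + v.2 * s' N) - P.φ' N * (v.1 * c N + v.2 * s N) = 0 := by
    intro N
    set bc := P.φ N * c' N - P.φ' N * c N with hbc
    set bs := P.φ N * s' N - P.φ' N * s N with hbs
    by_cases h : ((-bs, bc) : ℝ × ℝ) = 0
    · rw [Prod.ext_iff] at h
      simp only [Prod.fst_zero, neg_eq_zero, Prod.snd_zero] at h
      refine ⟨(1, 0), by simp, ?_⟩
      simp only
      linear_combination h.2
    · refine ⟨‖((-bs, bc) : ℝ × ℝ)‖⁻¹ • (-bs, bc), ?_, ?_⟩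
      · rw [mem_sphere_zero_iff_norm, norm_smul, norm_inv, norm_norm,
          inv_mul_cancel₀ (norm_ne_zero_iff.2 h)]
      · simp only [Prod.smul_mk, smul_eq_mul]
        rw [hbc, hbs]
        ring
  choose v hv hvN using hchoice
  have key : ∀ N x, x₀ ≤ x → x ≤ N → m (v N) x ≤ 4 * P.C ^ 2 * K * Real.exp (-α * (x - x₀)) := by
    intro N x hx hxN
    have hsol := (hcs.lin (v N).1 (v N).2 hss).congr_potential
    simp only [Pi.zero_apply, add_zero] at hsol
    have hF : Continuous fun t => ρ t * m (v N) t := by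
      have := hmc (v N)
      fun_prop
    have hfF : ∀ t, |r t * ((v N).1 * c t + (v N).2 * s t)| ≤ ρ t * m (v N) t := fun t => by
      rw [abs_mul]
      exact mul_le_mul (hrρ t) (le_max_left _ _) (abs_nonneg _) (hρ t)
    have hK0 : 0 ≤ K := (hm0 _ _).trans (hK' _ (hv N))
    refine le_of_forall_pos_le_add fun ε hε => ?_
    have := le_two_mul_of_le_integral (x₀ := x₀) (N := N) (κ := 2 * P.C ^ 2) (η := α)
      (c := 2 * P.C ^ 2 * K) (δ := ε / 2) (ρ := ρ) (v := m (v N)) (by positivity) hα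
      (by positivity) (by positivity) hρc hρ (hmc _) (hm0 _)
      (hsmall N (hx.trans hxN)) (fun z hz => ?_) x ⟨hx, hxN⟩
    · linarith
    · have hrc : Continuous fun t => r t * ((v N).1 * c t + (v N).2 * s t) := by fun_prop
      have h1 := P.max_abs_le (u := fun x => (v N).1 * c x + (v N).2 * s x)
        (u' := fun x => (v N).1 * c' x + (v N).2 * s' x) z
      have h2 := P.stable_le le_rfl hsol hrc hF hfF hz.1
      have h3 := P.unstable_le hα hsol hrc hF hfF hz.2
      rw [hvN, abs_zero, mul_zero, zero_add] at h3
      have h4 : 2 * P.C ^ 2 * m (v N) x₀ * Real.exp (-α * (z - x₀)) ≤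
          2 * P.C ^ 2 * K * Real.exp (-α * (z - x₀)) := by
        gcongr
        exact hK' _ (hv N)
      have i1 : 0 ≤ P.C ^ 2 * ∫ t in x₀..z, Real.exp (-α * (z - t)) * (ρ t * m (v N) t) :=
        mul_nonneg (sq_nonneg _) (intervalIntegral.integral_nonneg hz.1 fun t _ =>
          mul_nonneg (Real.exp_nonneg _) (mul_nonneg (hρ t) (hm0 _ t)))
      have i2 : 0 ≤ P.C ^ 2 * ∫ t in z..N, ρ t * m (v N) t :=
        mul_nonneg (sq_nonneg _) (intervalIntegral.integral_nonneg hz.2 fun t _ =>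
          mul_nonneg (hρ t) (hm0 _ t))
      simp only [hm] at *
      linarith
  -- The bound on [x₀, N] does not depend on N, so a limit of the normalized data gives a nontrivial
  -- solution that is small on the whole half-line.
  obtain ⟨v₀, hv₀, θ, hθ, hlim⟩ := (isCompact_sphere (0 : ℝ × ℝ) 1).tendsto_subseq
    (x := fun N : ℕ => v N) fun N => hv N
  have hbd : ∀ x, x₀ ≤ x → m v₀ x ≤ 4 * P.C ^ 2 * K * Real.exp (-α * (x - x₀)) := by
    intro x hx
    refine le_of_tendsto (((hmv x).tendsto v₀).comp hlim) ?_
    have : Tendsto (fun i => ((θ i : ℕ) : ℝ)) atTop atTop :=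
      tendsto_natCast_atTop_atTop.comp hθ.tendsto_atTop
    filter_upwards [this.eventually_ge_atTop x] with i hi
    exact key _ x hx hi
  obtain ⟨K₂, hK₂⟩ := (isCompact_Icc (a := (0 : ℝ)) (b := x₀)).exists_bound_of_continuousOn
    (f := fun x => Real.exp (α * x) * m v₀ x) (by have := hmc v₀; fun_prop)
  have hK0 : 0 ≤ K := (hm0 _ _).trans (hK' _ hv₀)
  have hK₂0 : 0 ≤ K₂ := (norm_nonneg _).trans (hK₂ 0 ⟨le_rfl, hx₀⟩)
  have hall : ∀ x, 0 ≤ x →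
      m v₀ x ≤ (K₂ + 4 * P.C ^ 2 * K * Real.exp (α * x₀)) * Real.exp (-α * x) := by
    intro x hx
    have h0 : 0 ≤ 4 * P.C ^ 2 * K * Real.exp (α * x₀) := by positivity
    rcases le_total x x₀ with h | h
    · have h1 := (le_abs_self _).trans (hK₂ x ⟨hx, h⟩)
      have h2 : m v₀ x = (Real.exp (α * x) * m v₀ x) * Real.exp (-α * x) := by
        rw [mul_right_comm, ← Real.exp_add]
        simp
      rw [h2]
      gcongr
      linarith
    · refine (hbd x h).trans ?_
      have : Real.exp (-α * (x - x₀)) = Real.exp (α * x₀) * Real.exp (-α * x) := by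
        rw [← Real.exp_add]; congr 1; ring
      rw [this, ← mul_assoc]
      gcongr
      linarith
  refine ⟨v₀.1, v₀.2, ?_, _, fun x hx =>
    ⟨(le_max_left _ _).trans (hall x hx), (le_max_right _ _).trans (hall x hx)⟩⟩
  by_contra! hcon
  have : v₀ = 0 := Prod.ext hcon.1 hcon.2
  rw [this] at hv₀
  simp at hv₀

end DichotomyPair

/-- Decaying solutions of a weakly coupled system decay exponentially at `+∞`. -/
theorem exists_exp_decay {ι : Type*} [Fintype ι] {q f u u' : ι → ℝ → ℝ} {α : ι → ℝ}
    (P : ∀ i, DichotomyPair (q i) (α i)) {η : ℝ} (hη : 0 ≤ η) (hα : ∀ i, α i = 0 ∨ η ≤ α i)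
    (hu : ∀ i, IsSol (q i) (f i) (u i) (u' i)) (hf : ∀ i, Continuous (f i)) {ρ : ℝ → ℝ}
    (hρc : Continuous ρ) (hρi : Integrable ρ) (hρ : ∀ x, 0 ≤ ρ x)
    (hfρ : ∀ i x, |f i x| ≤ ρ x * ‖fun i => u i x‖)
    (hu0 : ∀ i, Tendsto (u i) atTop (𝓝 0)) (hu0' : ∀ i, Tendsto (u' i) atTop (𝓝 0)) :
    ∃ C, 0 ≤ C ∧ ∀ i x, 0 ≤ x → |u i x| ≤ C * Real.exp (-η * x) ∧ |u' i x| ≤ C * Real.exp (-η * x) := by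
  have huc := fun i => (hu i).continuous
  have huc' := fun i => (hu i).continuous_deriv
  set m : ℝ → ℝ := fun x => ‖fun i => (u i x, u' i x)‖ with hm
  have hmc : Continuous m := by fun_prop
  have hm0 : ∀ x, 0 ≤ m x := fun x => norm_nonneg _
  have hmi : ∀ i x, max |u i x| |u' i x| ≤ m x := fun i x =>
    norm_le_pi_norm (fun i => (u i x, u' i x)) i
  have hum : ∀ x, ‖fun i => u i x‖ ≤ m x := fun x =>
    (pi_norm_le_iff_of_nonneg (hm0 x)).2 fun i => (le_max_left _ _).trans (hmi i x)
  have hmt : Tendsto m atTop (𝓝 0) := by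
    have h1 : Tendsto (fun x => fun i => (u i x, u' i x)) atTop (𝓝 (0 : ι → ℝ × ℝ)) :=
      tendsto_pi_nhds.2 fun i => (hu0 i).prodMk_nhds (hu0' i)
    simpa using h1.norm
  set Cm : ℝ := ∑ i, (P i).C with hCm
  have hCm0 : 0 ≤ Cm := Finset.sum_nonneg fun i _ => (P i).C_nonneg
  have hCi : ∀ i, (P i).C ≤ Cm := fun i =>
    Finset.single_le_sum (f := fun i => (P i).C) (fun i _ => (P i).C_nonneg) (Finset.mem_univ i)
  obtain ⟨x₀, hx₀, hsmall⟩ := exists_small_tail hρ hρi (2 * Cm ^ 2) (by positivity)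
  have hF : Continuous fun t => ρ t * m t := by fun_prop
  have hF0 : ∀ t, 0 ≤ ρ t * m t := fun t => mul_nonneg (hρ t) (hm0 t)
  have key : ∀ x, x₀ ≤ x → m x ≤ 4 * Cm ^ 2 * m x₀ * Real.exp (-η * (x - x₀)) := by
    intro x hx
    have hstep : ∀ ε > 0, ∀ N, x ≤ N →
        m x ≤ 2 * (2 * Cm ^ 2 * m x₀ * Real.exp (-η * (x - x₀)) + (4 * Cm ^ 2 * m N + ε)) := by
      intro ε hε N hN
      have hmN := hm0 N
      have hmx := hm0 x₀
      refine le_two_mul_of_le_integral (x₀ := x₀) (N := N) (κ := 2 * Cm ^ 2) (η := η)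
        (c := 2 * Cm ^ 2 * m x₀) (δ := 4 * Cm ^ 2 * m N + ε) (ρ := ρ) (v := m) (by positivity) hη
        (by positivity) (by positivity) hρc hρ hmc hm0 (hsmall N (hx.trans hN)) (fun z hz => ?_) x
        ⟨hx, hN⟩
      have i1 : 0 ≤ ∫ t in x₀..z, Real.exp (-η * (z - t)) * (ρ t * m t) :=
        intervalIntegral.integral_nonneg hz.1 fun t _ => mul_nonneg (Real.exp_nonneg _) (hF0 t)
      have i2 : 0 ≤ ∫ t in z..N, ρ t * m t := intervalIntegral.integral_nonneg hz.2 fun t _ => hF0 t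
      refine (pi_norm_le_iff_of_nonneg (by positivity)).2 fun i => ?_
      refine ((P i).max_abs_le_two_point hη (hα i) (hu i) (hf i) hF
        (fun t => (hfρ i t).trans (mul_le_mul_of_nonneg_left (hum t) (hρ t))) hz.1 hz.2).trans ?_
      have hC := (P i).C_nonneg
      have hn : 0 ≤ max |u i N| |u' i N| := (abs_nonneg _).trans (le_max_left _ _)
      have hn' : 0 ≤ max |u i x₀| |u' i x₀| := (abs_nonneg _).trans (le_max_left _ _)
      have g1 : 2 * (P i).C ^ 2 * max |u i x₀| |u' i x₀| * Real.exp (-η * (z - x₀)) ≤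
          2 * Cm ^ 2 * m x₀ * Real.exp (-η * (z - x₀)) := by
        gcongr
        exacts [hCi i, hmi i _]
      have g2 : 4 * (P i).C ^ 2 * max |u i N| |u' i N| ≤ 4 * Cm ^ 2 * m N := by
        gcongr
        exacts [hCi i, hmi i _]
      have g3 : 2 * (P i).C ^ 2 * (∫ t in x₀..z, Real.exp (-η * (z - t)) * (ρ t * m t)) ≤
          2 * Cm ^ 2 * ∫ t in x₀..z, Real.exp (-η * (z - t)) * (ρ t * m t) := by
        gcongr
        exact hCi i
      have g4 : 2 * (P i).C ^ 2 * (∫ t in z..N, ρ t * m t) ≤ 2 * Cm ^ 2 * ∫ t in z..N, ρ t * m t := by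
        gcongr
        exact hCi i
      linarith
    refine le_of_forall_pos_le_add fun ε hε => ?_
    -- As N tends to infinity the contribution of the right end point disappears, because the
    -- solution is known to tend to zero.
    have hlim : Tendsto (fun N => 2 * (2 * Cm ^ 2 * m x₀ * Real.exp (-η * (x - x₀)) +
        (4 * Cm ^ 2 * m N + ε / 2))) atTop
        (𝓝 (2 * (2 * Cm ^ 2 * m x₀ * Real.exp (-η * (x - x₀)) + (4 * Cm ^ 2 * 0 + ε / 2)))) :=
      (((hmt.const_mul _).add_const _).const_add _).const_mul _
    have h1 := ge_of_tendsto hlim ((eventually_ge_atTop x).mono fun N hN => hstep (ε / 2) (by positivity) N hN)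
    linarith
  obtain ⟨K, hK⟩ := (isCompact_Icc (a := (0 : ℝ)) (b := x₀)).exists_bound_of_continuousOn
    (f := fun x => Real.exp (η * x) * m x) (by fun_prop)
  have hK0 : 0 ≤ K := (norm_nonneg _).trans (hK 0 ⟨le_rfl, hx₀⟩)
  have hmx := hm0 x₀
  have h0 : 0 ≤ 4 * Cm ^ 2 * m x₀ * Real.exp (η * x₀) := by positivity
  have hall : ∀ x, 0 ≤ x → m x ≤ (K + 4 * Cm ^ 2 * m x₀ * Real.exp (η * x₀)) * Real.exp (-η * x) := by
    intro x hx
    rcases le_total x x₀ with h | h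
    · have h1 := (le_abs_self _).trans (hK x ⟨hx, h⟩)
      have h2 : m x = (Real.exp (η * x) * m x) * Real.exp (-η * x) := by
        rw [mul_right_comm, ← Real.exp_add]
        simp
      rw [h2]
      gcongr
      linarith
    · refine (key x h).trans ?_
      have : Real.exp (-η * (x - x₀)) = Real.exp (η * x₀) * Real.exp (-η * x) := by
        rw [← Real.exp_add]; congr 1; ring
      rw [this, ← mul_assoc]
      gcongr
      linarith
  exact ⟨_, by positivity, fun i x hx => ⟨(le_max_left _ _).trans ((hmi i x).trans (hall x hx)),
    (le_max_right _ _).trans ((hmi i x).trans (hall x hx))⟩⟩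

/-! ### Floquet theory of scalar periodic equations. -/

/-- The solutions of `y'' = q y` with initial data `(1, 0)` and `(0, 1)`. -/
structure FundamentalPair (q : ℝ → ℝ) where
  c : ℝ → ℝ
  c' : ℝ → ℝ
  s : ℝ → ℝ
  s' : ℝ → ℝ
  sol_c : IsSol q 0 c c'
  sol_s : IsSol q 0 s s'
  c_zero : c 0 = 1
  c'_zero : c' 0 = 0
  s_zero : s 0 = 0
  s'_zero : s' 0 = 1

namespace FundamentalPair

variable {q : ℝ → ℝ}

theorem wronskian (F : FundamentalPair q) (x : ℝ) : F.c x * F.s' x - F.c' x * F.s x = 1 := by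
  rw [F.sol_c.wronskian_eq F.sol_s x 0, F.c_zero, F.c'_zero, F.s_zero, F.s'_zero]
  ring

theorem eq_of_isSol (F : FundamentalPair q) {y y' : ℝ → ℝ} (h : IsSol q 0 y y') (x : ℝ) :
    y x = y 0 * F.c x + y' 0 * F.s x ∧ y' x = y 0 * F.c' x + y' 0 * F.s' x := by
  obtain ⟨a, b, hab⟩ := F.sol_c.eq_lin F.sol_s F.wronskian h
  obtain ⟨h1, h2⟩ := hab 0
  rw [F.c_zero, F.s_zero] at h1
  rw [F.c'_zero, F.s'_zero] at h2
  obtain rfl : y 0 = a := by linarith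
  obtain rfl : y' 0 = b := by linarith
  exact hab x

theorem shift_eq (F : FundamentalPair q) {p : ℝ} (hq : ∀ x, q (x + p) = q x) {y y' : ℝ → ℝ}
    (h : IsSol q 0 y y') (x : ℝ) :
    y (x + p) = y p * F.c x + y' p * F.s x ∧ y' (x + p) = y p * F.c' x + y' p * F.s' x := by
  have h1 := h.shift p
  simp only [hq] at h1
  simpa using F.eq_of_isSol h1 x

/-- The discriminant, that is, the trace of the monodromy matrix. -/
def trace (F : FundamentalPair q) (p : ℝ) : ℝ := F.c p + F.s' p

end FundamentalPair

/-- Once the factor e^{κx} is divided out, |y| is continuous and periodic, hence bounded. -/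
theorem exists_bound_of_quasiperiodic {p κ ν : ℝ} (hp : 0 < p) (hν : |ν| = Real.exp (κ * p))
    {y : ℝ → ℝ} (hy : Continuous y) (h : ∀ x, y (x + p) = ν * y x) :
    ∃ C, 0 ≤ C ∧ ∀ x, |y x| ≤ C * Real.exp (κ * x) := by
  have hper : Function.Periodic (fun x => Real.exp (-κ * x) * |y x|) p := fun x => by
    simp only
    rw [h, abs_mul, hν, mul_add, Real.exp_add]
    have : Real.exp (-κ * p) * Real.exp (κ * p) = 1 := by rw [← Real.exp_add]; simp
    linear_combination Real.exp (-κ * x) * |y x| * this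
  obtain ⟨C, hC⟩ := (hper.compact_of_continuous hp.ne' (by fun_prop)).isBounded.exists_norm_le
  have hC' : ∀ x, Real.exp (-κ * x) * |y x| ≤ C := fun x =>
    (le_abs_self _).trans (hC _ (mem_range_self x))
  refine ⟨C, (norm_nonneg _).trans (hC _ (mem_range_self 0)), fun x => ?_⟩
  calc |y x| = (Real.exp (-κ * x) * |y x|) * Real.exp (κ * x) := by
        rw [mul_right_comm, ← Real.exp_add]; simp
    _ ≤ _ := by gcongr; exact hC' x

namespace FundamentalPair

variable {q : ℝ → ℝ}

/-- The monodromy matrix has determinant 1, so a root of its characteristic polynomial has an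
eigenvector. Taken as initial data, this vector produces a solution that is multiplied by ν over
each period. -/
theorem exists_floquet (F : FundamentalPair q) {p ν : ℝ} (hq : ∀ x, q (x + p) = q x)
    (hν : ν ^ 2 - F.trace p * ν + 1 = 0) :
    ∃ a b : ℝ, (a ≠ 0 ∨ b ≠ 0) ∧ (F.c p - ν) * a + F.s p * b = 0 ∧
      F.c' p * a + (F.s' p - ν) * b = 0 ∧
      (∀ x, a * F.c (x + p) + b * F.s (x + p) = ν * (a * F.c x + b * F.s x)) ∧
      ∀ x, a * F.c' (x + p) + b * F.s' (x + p) = ν * (a * F.c' x + b * F.s' x) := by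
  have hW := F.wronskian p
  have hdet : (!![F.c p - ν, F.s p; F.c' p, F.s' p - ν] : Matrix (Fin 2) (Fin 2) ℝ).det = 0 := by
    rw [Matrix.det_fin_two_of]
    rw [trace] at hν
    linear_combination hν + hW
  obtain ⟨v, hv, hM⟩ := Matrix.exists_mulVec_eq_zero_iff.2 hdet
  have h1 := congrFun hM 0
  have h2 := congrFun hM 1
  simp [Matrix.mulVec, dotProduct, Fin.sum_univ_two] at h1 h2
  refine ⟨v 0, v 1, ?_, h1, h2, fun x => ?_, fun x => ?_⟩
  · by_contra! hcon
    refine hv (funext fun i => ?_)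
    fin_cases i
    exacts [hcon.1, hcon.2]
  · rw [(F.shift_eq hq F.sol_c x).1, (F.shift_eq hq F.sol_s x).1]
    linear_combination F.c x * h1 + F.s x * h2
  · rw [(F.shift_eq hq F.sol_c x).2, (F.shift_eq hq F.sol_s x).2]
    linear_combination F.c' x * h1 + F.s' x * h2

/-- The multipliers are σe^{θ} and σe^{-θ} with a common sign σ. The two Floquet solutions, the
second scaled to make the Wronskian 1, form the pair. -/
theorem nonempty_pair_of_hyperbolic (F : FundamentalPair q) {p θ : ℝ} (hp : 0 < p) (hθ : 0 < θ)
    (hq : ∀ x, q (x + p) = q x) (ht : |F.trace p| = 2 * Real.cosh θ) :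
    Nonempty (DichotomyPair q (θ / p)) := by
  obtain ⟨σ, hσ, hσt⟩ : ∃ σ : ℝ, |σ| = 1 ∧ F.trace p = σ * (2 * Real.cosh θ) := by
    rcases le_total 0 (F.trace p) with h | h
    · exact ⟨1, by simp, by rw [abs_of_nonneg h] at ht; linarith⟩
    · exact ⟨-1, by simp, by rw [abs_of_nonpos h] at ht; linarith⟩
  have hσ2 : σ * σ = 1 := by rw [← abs_mul_abs_self, hσ, one_mul]
  have hee : Real.exp θ * Real.exp (-θ) = 1 := by rw [← Real.exp_add]; simp
  rw [Real.cosh_eq] at hσt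
  obtain ⟨a, b, hab, e1, e2, e3, e4⟩ := F.exists_floquet (ν := σ * Real.exp (-θ)) hq (by
    rw [hσt]
    linear_combination (-1 : ℝ) * hee - Real.exp θ * Real.exp (-θ) * hσ2)
  obtain ⟨a', b', hab', e1', e2', e3', e4'⟩ := F.exists_floquet (ν := σ * Real.exp θ) hq (by
    rw [hσt]
    linear_combination (-1 : ℝ) * hee - Real.exp θ * Real.exp (-θ) * hσ2)
  have hne : σ * Real.exp θ - σ * Real.exp (-θ) ≠ 0 := by
    rw [← mul_sub]
    refine mul_ne_zero (fun h => by simp [h] at hσ) (sub_ne_zero.2 fun h => ?_)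
    have := Real.exp_injective h
    linarith
  set w := a * b' - b * a' with hw
  -- Eigenvectors to different eigenvalues are independent: if the determinant vanished, the
  -- eigenvector equations would annihilate all products of a coordinate of one with a coordinate of
  -- the other.
  have hw0 : w ≠ 0 := by
    intro h0
    have f1 : a * a' = 0 := by
      refine (mul_eq_zero.1 (?_ : (σ * Real.exp θ - σ * Real.exp (-θ)) * (a * a') = 0)).resolve_left hne
      linear_combination a' * e1 - a * e1' + F.s p * h0
    have f2 : a * b' = 0 := by
      refine (mul_eq_zero.1 (?_ : (σ * Real.exp θ - σ * Real.exp (-θ)) * (a * b') = 0)).resolve_left hne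
      linear_combination b' * e1 - b * e1' - (F.c p - σ * Real.exp θ) * h0
    have f3 : b * a' = 0 := by linarith
    have f4 : b * b' = 0 := by
      refine (mul_eq_zero.1 (?_ : (σ * Real.exp θ - σ * Real.exp (-θ)) * (b * b') = 0)).resolve_left hne
      linear_combination b' * e2 - b * e2' - F.c' p * h0
    simp only [mul_eq_zero] at f1 f2 f3 f4
    tauto
  have hsφ := F.sol_c.lin a b F.sol_s
  have hsψ := (F.sol_c.lin a' b' F.sol_s).const_mul w⁻¹
  simp only [Pi.zero_apply, mul_zero] at hsψ
  have hkν : |σ * Real.exp (-θ)| = Real.exp (-(θ / p) * p) := by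
    rw [abs_mul, hσ, Real.abs_exp, one_mul]; congr 1; field_simp
  have hkν' : |σ * Real.exp θ| = Real.exp ((θ / p) * p) := by
    rw [abs_mul, hσ, Real.abs_exp, one_mul]; congr 1; field_simp
  obtain ⟨C1, hC1, g1⟩ := exists_bound_of_quasiperiodic hp hkν hsφ.continuous e3
  obtain ⟨C2, hC2, g2⟩ := exists_bound_of_quasiperiodic hp hkν hsφ.continuous_deriv e4
  obtain ⟨C3, hC3, g3⟩ := exists_bound_of_quasiperiodic hp hkν' hsψ.continuous
    (fun x => by simp only [e3']; ring)
  obtain ⟨C4, hC4, g4⟩ := exists_bound_of_quasiperiodic hp hkν' hsψ.continuous_deriv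
    (fun x => by simp only [e4']; ring)
  refine ⟨⟨_, _, _, _, C1 + C2 + C3 + C4, hsφ, hsψ, fun x => ?_, fun x => ?_, fun x => ?_, fun x => ?_,
    fun x => ?_⟩⟩
  · have h1 : (a * F.c x + b * F.s x) * (a' * F.c' x + b' * F.s' x) -
        (a * F.c' x + b * F.s' x) * (a' * F.c x + b' * F.s x) = w := by
      linear_combination w * F.wronskian x
    have h2 := mul_inv_cancel₀ hw0
    linear_combination w⁻¹ * h1 + h2
  · refine (g1 x).trans ?_; gcongr; linarith
  · refine (g2 x).trans ?_; gcongr; linarith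
  · refine (g3 x).trans ?_; gcongr; linarith
  · refine (g4 x).trans ?_; gcongr; linarith

/-- A monodromy matrix ±I makes every solution periodic or antiperiodic, hence bounded. -/
theorem nonempty_pair_of_scalar (F : FundamentalPair q) {p σ : ℝ} (hp : 0 < p)
    (hq : ∀ x, q (x + p) = q x) (hσ : |σ| = 1) (hc : F.c p = σ) (hs : F.s p = 0) (hc' : F.c' p = 0)
    (hs' : F.s' p = σ) : Nonempty (DichotomyPair q 0) := by
  have hk : |σ| = Real.exp (-0 * p) := by simpa using hσ
  have hk' : |σ| = Real.exp (0 * p) := by simpa using hσ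
  obtain ⟨C1, hC1, g1⟩ := exists_bound_of_quasiperiodic hp hk F.sol_c.continuous
    (fun x => by rw [(F.shift_eq hq F.sol_c x).1, hc, hc']; ring)
  obtain ⟨C2, hC2, g2⟩ := exists_bound_of_quasiperiodic hp hk F.sol_c.continuous_deriv
    (fun x => by rw [(F.shift_eq hq F.sol_c x).2, hc, hc']; ring)
  obtain ⟨C3, hC3, g3⟩ := exists_bound_of_quasiperiodic hp hk' F.sol_s.continuous
    (fun x => by rw [(F.shift_eq hq F.sol_s x).1, hs, hs']; ring)
  obtain ⟨C4, hC4, g4⟩ := exists_bound_of_quasiperiodic hp hk' F.sol_s.continuous_deriv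
    (fun x => by rw [(F.shift_eq hq F.sol_s x).2, hs, hs']; ring)
  refine ⟨⟨_, _, _, _, C1 + C2 + C3 + C4, F.sol_c, F.sol_s, F.wronskian, fun x => ?_, fun x => ?_,
    fun x => ?_, fun x => ?_⟩⟩
  · refine (g1 x).trans ?_; gcongr; linarith
  · refine (g2 x).trans ?_; gcongr; linarith
  · refine (g3 x).trans ?_; gcongr; linarith
  · refine (g4 x).trans ?_; gcongr; linarith

/-- In the elliptic case an invariant definite quadratic form bounds every solution. -/
theorem exists_bound_of_elliptic (F : FundamentalPair q) {p : ℝ} (hp : 0 < p)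
    (hq : ∀ x, q (x + p) = q x) (ht : F.trace p ^ 2 < 4) {y y' : ℝ → ℝ} (hy : IsSol q 0 y y') :
    ∃ C, 0 ≤ C ∧ ∀ x, |y x| ≤ C ∧ |y' x| ≤ C := by
  set a := F.c p with ha
  set b := F.s p with hb
  set c := F.c' p with hc
  set d := F.s' p with hd
  have hdet : a * d - c * b = 1 := F.wronskian p
  have ht' : (a + d) ^ 2 < 4 := ht
  -- This form is invariant under the monodromy matrix. Its discriminant (d - a)² + 4bc equals the
  -- squared trace minus 4 and is negative, so the form is definite and controls the values at all
  -- multiples of p.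
  set E : ℝ → ℝ → ℝ := fun z z' => c * z ^ 2 + (d - a) * z * z' - b * z' ^ 2 with hE
  set D := 4 - (a + d) ^ 2 with hD
  have hD0 : 0 < D := by linarith
  have hys : ∀ k : ℤ, IsSol q 0 (fun x => y (x + k * p)) (fun x => y' (x + k * p)) := fun k => by
    have h := hy.shift (k * p)
    have h2 : ∀ x, q (x + k * p) = q x := fun x => (show Function.Periodic q p from hq).int_mul k x
    simp only [h2] at h
    simpa using! h
  have hk : ∀ k : ℤ, ∀ x, y (x + k * p) = y (k * p) * F.c x + y' (k * p) * F.s x ∧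
      y' (x + k * p) = y (k * p) * F.c' x + y' (k * p) * F.s' x := fun k x => by
    simpa using F.eq_of_isSol (hys k) x
  have hsucc : ∀ k : ℤ, E (y ((k + 1 : ℤ) * p)) (y' ((k + 1 : ℤ) * p)) =
      E (y (k * p)) (y' (k * p)) := fun k => by
    have e : ((k + 1 : ℤ) : ℝ) * p = p + k * p := by push_cast; ring
    rw [e, (hk k p).1, (hk k p).2]
    simp only [hE, ← ha, ← hb, ← hc, ← hd]
    linear_combination (c * y (k * p) ^ 2 + (d - a) * y (k * p) * y' (k * p) -
      b * y' (k * p) ^ 2) * hdet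
  have hconst : ∀ k : ℤ, E (y (k * p)) (y' (k * p)) = E (y 0) (y' 0) := fun k => by
    induction k using Int.induction_on with
    | zero => simp
    | succ i ih => rw [hsucc, ih]
    | pred i ih =>
      have := hsucc (-(i : ℤ) - 1)
      rw [sub_add_cancel] at this
      rw [← this, ih]
  set E₀ := E (y 0) (y' 0) with hE₀
  have hz : ∀ k : ℤ, |y (k * p)| ≤ √(-4 * b * E₀ / D) ∧ |y' (k * p)| ≤ √(4 * c * E₀ / D) := fun k => by
    have h0 := hconst k
    simp only [hE] at h0
    constructor
    · refine Real.abs_le_sqrt ?_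
      rw [le_div_iff₀ hD0]
      have : (y (k * p)) ^ 2 * D = -4 * b * E₀ - (2 * b * y' (k * p) - (d - a) * y (k * p)) ^ 2 := by
        linear_combination (-4) * b * h0 - 4 * y (k * p) ^ 2 * hdet
      rw [this]
      nlinarith [sq_nonneg (2 * b * y' (k * p) - (d - a) * y (k * p))]
    · refine Real.abs_le_sqrt ?_
      rw [le_div_iff₀ hD0]
      have : (y' (k * p)) ^ 2 * D = 4 * c * E₀ - (2 * c * y (k * p) + (d - a) * y' (k * p)) ^ 2 := by
        linear_combination 4 * c * h0 - 4 * y' (k * p) ^ 2 * hdet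
      rw [this]
      nlinarith [sq_nonneg (2 * c * y (k * p) + (d - a) * y' (k * p))]
  have hcc := F.sol_c.continuous
  have hcc' := F.sol_c.continuous_deriv
  have hsc := F.sol_s.continuous
  have hsc' := F.sol_s.continuous_deriv
  obtain ⟨K, hK⟩ := (isCompact_Icc (a := (0 : ℝ)) (b := p)).exists_bound_of_continuousOn
    (f := fun x => |F.c x| + |F.s x| + |F.c' x| + |F.s' x|) (by fun_prop)
  set R := √(-4 * b * E₀ / D) + √(4 * c * E₀ / D) with hR
  have hR1 : 0 ≤ √(-4 * b * E₀ / D) := Real.sqrt_nonneg _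
  have hR2 : 0 ≤ √(4 * c * E₀ / D) := Real.sqrt_nonneg _
  have hK0 : 0 ≤ K := (norm_nonneg _).trans (hK 0 ⟨le_rfl, hp.le⟩)
  refine ⟨R * K, by positivity, fun x => ?_⟩
  set k : ℤ := ⌊x / p⌋ with hkdef
  have hx0 : 0 ≤ x - k * p := by
    have := Int.floor_le (x / p)
    rw [le_div_iff₀ hp] at this
    linarith
  have hx1 : x - k * p ≤ p := by
    have := Int.lt_floor_add_one (x / p)
    rw [div_lt_iff₀ hp] at this
    linarith
  have hKx := (le_abs_self _).trans (hK (x - k * p) ⟨hx0, hx1⟩)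
  obtain ⟨h1, h2⟩ := hk k (x - k * p)
  rw [sub_add_cancel] at h1 h2
  obtain ⟨z1, z2⟩ := hz k
  have hz1 : |y (k * p)| ≤ R := by linarith
  have hz2 : |y' (k * p)| ≤ R := by linarith
  have n1 := abs_nonneg (F.c (x - k * p))
  have n2 := abs_nonneg (F.s (x - k * p))
  have n3 := abs_nonneg (F.c' (x - k * p))
  have n4 := abs_nonneg (F.s' (x - k * p))
  have hR0 : 0 ≤ R := by positivity
  constructor
  · rw [h1]
    calc _ ≤ |y (k * p)| * |F.c (x - k * p)| + |y' (k * p)| * |F.s (x - k * p)| := by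
          rw [← abs_mul, ← abs_mul]; exact abs_add_le _ _
      _ ≤ R * |F.c (x - k * p)| + R * |F.s (x - k * p)| := by gcongr
      _ ≤ R * K := by rw [← mul_add]; gcongr; linarith
  · rw [h2]
    calc _ ≤ |y (k * p)| * |F.c' (x - k * p)| + |y' (k * p)| * |F.s' (x - k * p)| := by
          rw [← abs_mul, ← abs_mul]; exact abs_add_le _ _
      _ ≤ R * |F.c' (x - k * p)| + R * |F.s' (x - k * p)| := by gcongr
      _ ≤ R * K := by rw [← mul_add]; gcongr; linarith

theorem nonempty_pair_of_elliptic (F : FundamentalPair q) {p : ℝ} (hp : 0 < p)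
    (hq : ∀ x, q (x + p) = q x) (ht : F.trace p ^ 2 < 4) : Nonempty (DichotomyPair q 0) := by
  obtain ⟨C1, hC1, g1⟩ := F.exists_bound_of_elliptic hp hq ht F.sol_c
  obtain ⟨C2, hC2, g2⟩ := F.exists_bound_of_elliptic hp hq ht F.sol_s
  refine ⟨⟨_, _, _, _, C1 + C2, F.sol_c, F.sol_s, F.wronskian, fun x => ?_, fun x => ?_, fun x => ?_,
    fun x => ?_⟩⟩ <;> simp only [neg_zero, zero_mul, Real.exp_zero, mul_one]
  · linarith [(g1 x).1]
  · linarith [(g1 x).2]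
  · linarith [(g2 x).1]
  · linarith [(g2 x).2]

/-- The strict Cauchy-Schwarz inequality for the two fundamental solutions. -/
theorem sq_integral_mul_lt (F : FundamentalPair q) {p : ℝ} (hp : 0 < p) :
    (∫ t in (0 : ℝ)..p, F.c t * F.s t) ^ 2 <
      (∫ t in (0 : ℝ)..p, F.s t * F.s t) * ∫ t in (0 : ℝ)..p, F.c t * F.c t := by
  have hcc := F.sol_c.continuous
  have hsc := F.sol_s.continuous
  have hii : ∀ {g : ℝ → ℝ}, Continuous g → IntervalIntegrable g volume 0 p := fun hg =>
    hg.intervalIntegrable _ _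
  have hSpos : 0 < ∫ t in (0 : ℝ)..p, F.s t * F.s t := by
    refine intervalIntegral.integral_pos hp (by fun_prop) (fun x _ => mul_self_nonneg _) ?_
    by_contra! hcon
    have hz : ∀ x ∈ Ioo 0 p, F.s x = 0 := fun x hx =>
      mul_self_eq_zero.1 (le_antisymm (hcon x ⟨hx.1.le, hx.2.le⟩) (mul_self_nonneg _))
    have hmem : p / 2 ∈ Ioo 0 p := ⟨by linarith, by linarith⟩
    have h1 : HasDerivAt F.s 0 (p / 2) := by
      refine (hasDerivAt_const (p / 2) (0 : ℝ)).congr_of_eventuallyEq ?_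
      filter_upwards [isOpen_Ioo.mem_nhds hmem] with x hx
      exact hz x hx
    have h2 := h1.unique (F.sol_s.deriv_fst (p / 2))
    have := F.wronskian (p / 2)
    rw [← h2, hz _ hmem] at this
    simp at this
  set S := ∫ t in (0 : ℝ)..p, F.s t * F.s t with hS
  set D := ∫ t in (0 : ℝ)..p, F.c t * F.s t with hD
  set C := ∫ t in (0 : ℝ)..p, F.c t * F.c t with hC
  -- The integrand is a square that does not vanish at t = 0, since c(0) = 1 and s(0) = 0. Its
  -- integral expands to S(SC - D²).
  have hpos : 0 < ∫ t in (0 : ℝ)..p, (S * F.c t - D * F.s t) * (S * F.c t - D * F.s t) := by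
    refine intervalIntegral.integral_pos hp (by fun_prop) (fun x _ => mul_self_nonneg _)
      ⟨0, ⟨le_rfl, hp.le⟩, ?_⟩
    rw [F.c_zero, F.s_zero]
    have : 0 < S * S := mul_pos hSpos hSpos
    simpa using hSpos.ne'
  have hexp : ∫ t in (0 : ℝ)..p, (S * F.c t - D * F.s t) * (S * F.c t - D * F.s t) =
      S ^ 2 * C - 2 * S * D * D + D ^ 2 * S := by
    have h1 : ∫ t in (0 : ℝ)..p, (S * F.c t - D * F.s t) * (S * F.c t - D * F.s t) =
        ∫ t in (0 : ℝ)..p, (S ^ 2 * (F.c t * F.c t) - 2 * S * D * (F.c t * F.s t) +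
          D ^ 2 * (F.s t * F.s t)) := by
      congr 1 with t
      ring
    rw [h1, intervalIntegral.integral_add (hii (by fun_prop)) (hii (by fun_prop)),
      intervalIntegral.integral_sub (hii (by fun_prop)) (hii (by fun_prop)),
      intervalIntegral.integral_const_mul, intervalIntegral.integral_const_mul,
      intervalIntegral.integral_const_mul]
  rw [hexp] at hpos
  have : 0 < S * (S * C - D ^ 2) := by linarith
  nlinarith [(mul_pos_iff_of_pos_left hSpos).1 this]

end FundamentalPair

/-- The relation between the values at `p` of solutions to two spectral parameters. -/
theorem IsSol.wronskian_spectral {q : ℝ → ℝ} {l₀ l : ℝ} {φ φ' u u' : ℝ → ℝ}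
    (hφ : IsSol (fun x => q x - l₀) 0 φ φ') (hu : IsSol (fun x => q x - l) 0 u u') (p : ℝ) :
    φ p * u' p - φ' p * u p =
      (φ 0 * u' 0 - φ' 0 * u 0) - (l - l₀) * ∫ t in (0 : ℝ)..p, u t * φ t := by
  have h1 : IsSol (fun x => q x - l₀) (fun x => -(l - l₀) * u x) u u' :=
    ⟨hu.deriv_fst, fun x => (hu.deriv_snd x).congr_deriv (by simp only [Pi.zero_apply]; ring)⟩
  have huc := hu.continuous
  have h2 : ∫ t in (0 : ℝ)..p, φ t * (-(l - l₀) * u t) =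
      -(l - l₀) * ∫ t in (0 : ℝ)..p, u t * φ t := by
    rw [← intervalIntegral.integral_const_mul]
    congr 1 with t
    ring
  rw [hφ.wronskian_sub h1 (by fun_prop) 0 p, h2]
  ring

/-- Uniform dichotomies for all spectral parameters near `l₀`. -/
theorem exists_dichotomyPair_near {q : ℝ → ℝ} (hqc : Continuous q) {M : ℝ} (hM : ∀ x, |q x| ≤ M)
    {p : ℝ} (hp : 0 < p) (hq : ∀ x, q (x + p) = q x) {l₀ : ℝ}
    (F : FundamentalPair fun x => q x - l₀)
    (hF : |F.trace p| ≠ 2 ∨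
      ∃ σ : ℝ, |σ| = 1 ∧ F.c p = σ ∧ F.s p = 0 ∧ F.c' p = 0 ∧ F.s' p = σ) :
    ∃ η > 0, ∃ ε > 0, ∀ l, |l - l₀| < ε →
      ∃ α, (α = 0 ∨ η ≤ α) ∧ Nonempty (DichotomyPair (fun x => q x - l) α) := by
  obtain ⟨c, c', hc, hcc, hcc', hci⟩ := exists_isSol_family q hqc M hM l₀ 1 0
  obtain ⟨s, s', hs, hsc, hsc', hsi⟩ := exists_isSol_family q hqc M hM l₀ 0 1
  let G : ∀ l, |l - l₀| < 1 → FundamentalPair (fun x => q x - l) := fun l hl =>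
    ⟨c l, c' l, s l, s' l, (hc l hl).1, (hs l hl).1, (hc l hl).2.1, (hc l hl).2.2, (hs l hl).2.1,
      (hs l hl).2.2⟩
  have h0 : |l₀ - l₀| < 1 := by simp
  have hFc : ∀ x, c l₀ x = F.c x ∧ c' l₀ x = F.c' x := fun x => by
    simpa [(hc l₀ h0).2.1, (hc l₀ h0).2.2] using F.eq_of_isSol (hc l₀ h0).1 x
  have hFs : ∀ x, s l₀ x = F.s x ∧ s' l₀ x = F.s' x := fun x => by
    simpa [(hs l₀ h0).2.1, (hs l₀ h0).2.2] using F.eq_of_isSol (hs l₀ h0).1 x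
  have hper : ∀ l x, q (x + p) - l = q x - l := fun l x => by rw [hq]
  have htc : ContinuousAt (fun l => c l p + s' l p) l₀ := (hcc p).add (hsc' p)
  have ht0 : c l₀ p + s' l₀ p = F.trace p := by rw [(hFc p).1, (hFs p).2]; rfl
  have hball : ∀ᶠ l in 𝓝 l₀, |l - l₀| < 1 := by
    filter_upwards [Metric.ball_mem_nhds l₀ one_pos] with l hl
    simpa [Real.dist_eq] using hl
  suffices h : ∃ η > 0, ∀ᶠ l in 𝓝 l₀,
      ∃ α, (α = 0 ∨ η ≤ α) ∧ Nonempty (DichotomyPair (fun x => q x - l) α) by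
    obtain ⟨η, hη, h⟩ := h
    obtain ⟨ε, hε, h⟩ := Metric.eventually_nhds_iff.1 h
    exact ⟨η, hη, ε, hε, fun l hl => h (by simpa [Real.dist_eq] using hl)⟩
  by_cases h2 : |F.trace p| = 2
  · obtain ⟨σ, hσ, k1, k2, k3, k4⟩ := hF.resolve_left (not_not.2 h2)
    refine ⟨1, one_pos, ?_⟩
    -- For monodromy ±I at l₀ the squared trace minus 4 is (l - l₀)² times this expression. At l₀
    -- the expression is negative by the strict Cauchy-Schwarz inequality, so the equation is
    -- elliptic on both sides of l₀.
    have hdisc : ContinuousAt (fun l =>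
        ((∫ t in (0 : ℝ)..p, s l t * F.c t) + ∫ t in (0 : ℝ)..p, c l t * F.s t) ^ 2 -
        4 * (∫ t in (0 : ℝ)..p, s l t * F.s t) * ∫ t in (0 : ℝ)..p, c l t * F.c t) l₀ :=
      (((hsi _ F.sol_c.continuous p).add (hci _ F.sol_s.continuous p)).pow 2).sub
        ((continuousAt_const.mul (hsi _ F.sol_s.continuous p)).mul (hci _ F.sol_c.continuous p))
    have hneg := hdisc.tendsto.eventually_lt_const (u := (0 : ℝ)) (by
      have e1 := F.sq_integral_mul_lt hp
      have e2 : ∫ t in (0 : ℝ)..p, s l₀ t * F.c t = ∫ t in (0 : ℝ)..p, F.c t * F.s t := by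
        congr 1 with t; rw [(hFs t).1, mul_comm]
      have e3 : ∫ t in (0 : ℝ)..p, c l₀ t * F.s t = ∫ t in (0 : ℝ)..p, F.c t * F.s t := by
        congr 1 with t; rw [(hFc t).1]
      have e4 : ∫ t in (0 : ℝ)..p, s l₀ t * F.s t = ∫ t in (0 : ℝ)..p, F.s t * F.s t := by
        congr 1 with t; rw [(hFs t).1]
      have e5 : ∫ t in (0 : ℝ)..p, c l₀ t * F.c t = ∫ t in (0 : ℝ)..p, F.c t * F.c t := by
        congr 1 with t; rw [(hFc t).1]
      rw [e2, e3, e4, e5]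
      linarith)
    filter_upwards [hneg, hball] with l hl hl1
    refine ⟨0, Or.inl rfl, ?_⟩
    by_cases hll : l = l₀
    · subst hll
      exact F.nonempty_pair_of_scalar hp (hper _) hσ k1 k2 k3 k4
    · refine (G l hl1).nonempty_pair_of_elliptic hp (hper l) ?_
      have hσ2 : σ * σ = 1 := by rw [← abs_mul_abs_self, hσ, one_mul]
      have w1 := F.sol_c.wronskian_spectral (hc l hl1).1 p
      have w2 := F.sol_c.wronskian_spectral (hs l hl1).1 p
      have w3 := F.sol_s.wronskian_spectral (hc l hl1).1 p
      have w4 := F.sol_s.wronskian_spectral (hs l hl1).1 p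
      simp only [k1, k2, k3, k4, F.c_zero, F.s_zero, F.c'_zero, F.s'_zero, (hc l hl1).2.1,
        (hc l hl1).2.2, (hs l hl1).2.1, (hs l hl1).2.2] at w1 w2 w3 w4
      have hdet : c l p * s' l p - c' l p * s l p = 1 := (G l hl1).wronskian p
      change (c l p + s' l p) ^ 2 < 4
      set Icc := ∫ t in (0 : ℝ)..p, c l t * F.c t
      set Isc := ∫ t in (0 : ℝ)..p, s l t * F.c t
      set Ics := ∫ t in (0 : ℝ)..p, c l t * F.s t
      set Iss := ∫ t in (0 : ℝ)..p, s l t * F.s t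
      have v1 : c' l p = σ * (-(l - l₀) * Icc) := by linear_combination σ * w1 - c' l p * hσ2
      have v2 : s' l p = σ * (1 - (l - l₀) * Isc) := by linear_combination σ * w2 - s' l p * hσ2
      have v3 : c l p = σ * (1 + (l - l₀) * Ics) := by linear_combination (-σ) * w3 - c l p * hσ2
      have v4 : s l p = σ * ((l - l₀) * Iss) := by linear_combination (-σ) * w4 - s l p * hσ2
      have hsq : 0 < (l - l₀) ^ 2 := by
        have := sub_ne_zero.2 hll
        positivity
      have hfin : (c l p + s' l p) ^ 2 - 4 =
          (l - l₀) ^ 2 * ((Isc + Ics) ^ 2 - 4 * Iss * Icc) := by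
        have : (c l p + s' l p) ^ 2 - 4 = (s' l p - c l p) ^ 2 + 4 * s l p * c' l p := by
          linear_combination 4 * hdet
        rw [this, v1, v2, v3, v4]
        linear_combination (l - l₀) ^ 2 * ((Isc + Ics) ^ 2 - 4 * Iss * Icc) * hσ2
      nlinarith
  · rcases lt_or_gt_of_ne h2 with h2 | h2
    · refine ⟨1, one_pos, ?_⟩
      have := htc.abs.tendsto.eventually_lt_const (u := 2) (by rwa [ht0])
      filter_upwards [this, hball] with l hl hl1
      refine ⟨0, Or.inl rfl, (G l hl1).nonempty_pair_of_elliptic hp (hper l) ?_⟩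
      change (c l p + s' l p) ^ 2 < 4
      rw [← sq_abs]
      nlinarith [abs_nonneg (c l p + s' l p)]
    · set θ := Real.arcosh (|F.trace p| / 2) with hθ
      have hθ0 : 0 < θ := Real.arcosh_pos (by linarith)
      -- Half of the exponent at l₀ is a lower bound for the exponents at all nearby l, by
      -- continuity of the trace.
      refine ⟨θ / 2 / p, by positivity, ?_⟩
      have hcosh : 2 * Real.cosh (θ / 2) < |F.trace p| := by
        have e1 : Real.cosh (θ / 2) < Real.cosh θ := by
          rw [Real.cosh_lt_cosh, abs_of_pos hθ0, abs_of_pos (by positivity)]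
          linarith
        rw [hθ, Real.cosh_arcosh (by linarith)] at e1
        rw [hθ]
        linarith
      have := htc.abs.tendsto.eventually_const_lt (u := 2 * Real.cosh (θ / 2)) (by rwa [ht0])
      filter_upwards [this, hball] with l hl hl1
      have h1 : 1 ≤ |c l p + s' l p| / 2 := by
        have := Real.one_le_cosh (θ / 2)
        linarith
      have h3 : θ / 2 < Real.arcosh (|c l p + s' l p| / 2) := by
        have h4 : Real.cosh (θ / 2) < Real.cosh (Real.arcosh (|c l p + s' l p| / 2)) := by
          rw [Real.cosh_arcosh h1]
          linarith
        rw [Real.cosh_lt_cosh, abs_of_pos (by positivity), abs_of_nonneg (Real.arcosh_nonneg h1)] at h4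
        exact h4
      refine ⟨Real.arcosh (|c l p + s' l p| / 2) / p, Or.inr (by gcongr),
        (G l hl1).nonempty_pair_of_hyperbolic hp (by linarith) (hper l) ?_⟩
      rw [Real.cosh_arcosh h1]
      change |c l p + s' l p| = _
      ring

/-! ### Regular level sets and the Lyapunov-Schmidt reduction. -/

/-- A regular level set, in a subspace `Y` of a Banach space `X` that need not be closed, is a
submanifold near `0`. -/
theorem exists_isSubmanifoldOfCodim_levelSet {X : Type*} [NormedAddCommGroup X] [NormedSpace ℝ X]
    [CompleteSpace X] {I : Type*} [Fintype I] {h : X → I → ℝ} {f : X →L[ℝ] (I → ℝ)}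
    (hh : ContDiffAt ℝ ω h 0) (hf : HasFDerivAt h f 0) (h0 : h 0 = 0) (Y : Submodule ℝ X)
    (hsurj : ∀ z, ∃ B ∈ Y, f B = z) {O : Set X} (hO : IsOpen O) (hO0 : 0 ∈ O) : ∃ U : Set Y, IsOpen U ∧ 0 ∈ U ∧
      (∀ y ∈ U, (y : X) ∈ O) ∧ ∀ S : Set Y, (∀ y ∈ U, (y ∈ S ↔ h y = 0)) →
        IsSubmanifoldOfCodim (Fintype.card I) (S ∩ U) := by
  have hsurj' : Function.Surjective (f ∘L Y.subtypeL) := fun z => by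
    obtain ⟨B, hB, h⟩ := hsurj z
    exact ⟨⟨B, hB⟩, h⟩
  -- The right inverse of `f` is chosen with values in `Y`, so that the straightening map below
  -- preserves `Y`.
  obtain ⟨R₀, hR₀⟩ := (f ∘L Y.subtypeL).toLinearMap.exists_rightInverse_of_surjective
    (LinearMap.range_eq_top.2 hsurj')
  set R : (I → ℝ) →L[ℝ] Y := LinearMap.toContinuousLinearMap R₀ with hRdef
  have hR : ∀ z, f (R z : X) = z := fun z => LinearMap.congr_fun hR₀ z
  set Rx : (I → ℝ) →L[ℝ] X := Y.subtypeL ∘L R with hRx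
  have hRxR : ∀ z, Rx z = (R z : X) := fun z => rfl
  -- This map has derivative 1 at 0 and satisfies f(e₀ B) = h B, so it carries the level set into
  -- the kernel of `f`.
  set e₀ : X → X := fun B => B + Rx (h B - f B) with he₀
  have he₀c : ContDiffAt ℝ ω e₀ 0 :=
    contDiffAt_id.add (Rx.contDiff.contDiffAt.comp 0 (hh.sub f.contDiff.contDiffAt))
  have he₀d : HasFDerivAt e₀ ((ContinuousLinearEquiv.refl ℝ X : X ≃L[ℝ] X) : X →L[ℝ] X) 0 := by
    refine ((hasFDerivAt_id (0 : X)).add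
      (Rx.hasFDerivAt.comp (0 : X) (hf.sub f.hasFDerivAt))).congr_fderiv ?_
    ext v
    simp
  have hne : (ω : WithTop ℕ∞) ≠ 0 := by simp
  set Θ := he₀c.toOpenPartialHomeomorph e₀ he₀d hne with hΘ
  have hΘe : ∀ x, Θ x = e₀ x := fun x => rfl
  have h0s : (0 : X) ∈ Θ.source := he₀c.mem_toOpenPartialHomeomorph_source he₀d hne
  have he0 : e₀ 0 = 0 := by simp [he₀, h0]
  have hsymm : ContDiffAt ℝ ω Θ.symm (e₀ 0) := he₀c.to_localInverse he₀d hne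
  have ev1 : ∀ᶠ B in 𝓝 (0 : X), ContDiffAt ℝ ω h B := hh.eventually (by simp)
  have ev2 : ∀ᶠ B in 𝓝 (0 : X), ContDiffAt ℝ ω Θ.symm (e₀ B) :=
    he₀c.continuousAt.eventually (hsymm.eventually (by simp))
  set O' := O ∩ interior {B | ContDiffAt ℝ ω h B ∧ ContDiffAt ℝ ω Θ.symm (e₀ B)} with hO'
  have hO'o : IsOpen O' := hO.inter isOpen_interior
  have hO'0 : (0 : X) ∈ O' := ⟨hO0, mem_interior_iff_mem_nhds.2 (ev1.and ev2)⟩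
  have hgood : ∀ B ∈ O', ContDiffAt ℝ ω h B ∧ ContDiffAt ℝ ω Θ.symm (e₀ B) := fun B hB =>
    interior_subset (s := {B | ContDiffAt ℝ ω h B ∧ ContDiffAt ℝ ω Θ.symm (e₀ B)}) hB.2
  set Ξ := Θ.restrOpen O' hO'o with hΞ
  have hΞs : Ξ.source = Θ.source ∩ O' := Θ.restrOpen_source O' hO'o
  have hΞe : ∀ x, Ξ x = e₀ x := fun x => rfl
  have hΞsymm : ∀ x, Ξ.symm x = Θ.symm x := fun x => rfl
  have hΞc : ∀ z ∈ Ξ.target, ContDiffAt ℝ ω Ξ.symm z := fun z hz => by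
    have h1 := Ξ.map_target hz
    rw [hΞs] at h1
    have h2 := (hgood _ h1.2).2
    have h3 : e₀ (Ξ.symm z) = z := Ξ.right_inv hz
    rw [h3] at h2
    exact h2
  -- The inverse function theorem was applied in the complete space `X`. Both the chart and its
  -- inverse differ from the identity by elements of the range of `R`, so they restrict to `Y`, for
  -- which completeness is not needed.
  let F : Y → Y := fun y => y + R (h y - f y)
  let G : Y → Y := fun z => z - R (h (Ξ.symm z) - f (Ξ.symm z))
  have hF : ∀ y : Y, (F y : X) = Ξ y := fun y => rfl
  have hG : ∀ z : Y, (z : X) ∈ Ξ.target → (G z : X) = Ξ.symm z := fun z hz => by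
    have h1 : Ξ.symm z + Rx (h (Ξ.symm z) - f (Ξ.symm z)) = z := Ξ.right_inv hz
    change (z : X) - Rx (h (Ξ.symm z) - f (Ξ.symm z)) = _
    nth_rw 1 [← h1]
    abel
  have hι : ContDiff ℝ ω (fun y : Y => (y : X)) := Y.subtypeL.contDiff
  have hFc : ∀ y : Y, (y : X) ∈ Ξ.source → ContDiffAt ℝ ω F y := fun y hy => by
    rw [hΞs] at hy
    have h1 : ContDiffAt ℝ ω (fun y : Y => h y) y :=
      (hgood _ hy.2).1.comp y hι.contDiffAt
    have h2 : ContDiffAt ℝ ω (fun y : Y => f y) y := (f.contDiff.comp hι).contDiffAt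
    exact contDiffAt_id.add (R.contDiff.contDiffAt.comp y (h1.sub h2))
  have hGc : ∀ z : Y, (z : X) ∈ Ξ.target → ContDiffAt ℝ ω G z := fun z hz => by
    have h0 : ContDiffAt ℝ ω (fun z : Y => Ξ.symm z) z := (hΞc _ hz).comp z hι.contDiffAt
    have h3 := Ξ.map_target hz
    rw [hΞs] at h3
    have h1 : ContDiffAt ℝ ω (fun z : Y => h (Ξ.symm z)) z := (hgood _ h3.2).1.comp z h0
    have h2 : ContDiffAt ℝ ω (fun z : Y => f (Ξ.symm z)) z := f.contDiff.contDiffAt.comp z h0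
    exact contDiffAt_id.sub (R.contDiff.contDiffAt.comp z (h1.sub h2))
  have hso : IsOpen {y : Y | (y : X) ∈ Ξ.source} := Ξ.open_source.preimage continuous_subtype_val
  have hto : IsOpen {y : Y | (y : X) ∈ Ξ.target} := Ξ.open_target.preimage continuous_subtype_val
  let e : OpenPartialHomeomorph Y Y :=
    { toFun := F
      invFun := G
      source := {y | (y : X) ∈ Ξ.source}
      target := {z | (z : X) ∈ Ξ.target}
      map_source' := fun y hy => by
        change (F y : X) ∈ Ξ.target
        rw [hF]; exact Ξ.map_source hy
      map_target' := fun z hz => by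
        change (G z : X) ∈ Ξ.source
        rw [hG z hz]; exact Ξ.map_target hz
      left_inv' := fun y hy => Subtype.ext (by
        rw [hG _ (by rw [hF]; exact Ξ.map_source hy), hF]; exact Ξ.left_inv hy)
      right_inv' := fun z hz => Subtype.ext (by
        rw [hF, hG z hz]; exact Ξ.right_inv hz)
      open_source := hso
      open_target := hto
      continuousOn_toFun := fun y hy => (hFc y hy).continuousAt.continuousWithinAt
      continuousOn_invFun := fun z hz => (hGc z hz).continuousAt.continuousWithinAt }
  let r : (I → ℝ) ≃L[ℝ] (Fin (Fintype.card I) → ℝ) :=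
    (LinearEquiv.funCongrLeft ℝ ℝ (Fintype.equivFin I).symm).toContinuousLinearEquiv
  refine ⟨{y : Y | (y : X) ∈ Ξ.source}, hso, ?_, fun y hy => ?_, fun S hS b hb =>
    ⟨e, (r : (I → ℝ) →L[ℝ] (Fin (Fintype.card I) → ℝ)) ∘L f ∘L Y.subtypeL, hb.2,
      fun y hy => ((hFc y hy).of_le le_top).contDiffWithinAt,
      fun z hz => ((hGc z hz).of_le le_top).contDiffWithinAt,
      r.surjective.comp hsurj', fun y hy => ?_⟩⟩
  · change (0 : X) ∈ Ξ.source
    rw [hΞs]; exact ⟨h0s, hO'0⟩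
  · have : (y : X) ∈ Ξ.source := hy
    rw [hΞs] at this
    exact this.2.1
  · have h1 : f (F y : X) = h y := by
      change f ((y : X) + (R (h y - f y) : X)) = _
      rw [map_add, hR]
      abel
    change y ∈ S ∩ {y : Y | (y : X) ∈ Ξ.source} ↔ r (f (F y : X)) = 0
    rw [h1, map_eq_zero_iff r r.injective, ← hS y hy]
    exact ⟨fun h => h.1, fun h => ⟨h, hy⟩⟩

/-- Lyapunov-Schmidt reduction: the parameters `B` for which a reduced eigenvalue problem is
solvable with `l` near `l₀` form a submanifold near `0`. -/
theorem exists_isSubmanifoldOfCodim_of_reduction {X V : Type*} [NormedAddCommGroup X]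
    [NormedSpace ℝ X] [CompleteSpace X] [NormedAddCommGroup V] [NormedSpace ℝ V] [CompleteSpace V]
    {I : Type*} [Fintype I] (𝔅 : X →L[ℝ] (V →L[ℝ] V)) (K : V →L[ℝ] V) (w₀ : V) (ℓ₀ : V →L[ℝ] ℝ)
    (ℓ : V →L[ℝ] (I → ℝ)) (l₀ : ℝ) (h0 : ℓ₀ w₀ ≠ 0) (h1 : ℓ w₀ = 0) (Y : Submodule ℝ X)
    (hsurj : ∀ z, ∃ B ∈ Y, ℓ (𝔅 B w₀) = z) (p : ℝ → X → Prop) (ε₀ : ℝ) (hε₀ : 0 < ε₀)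
    (hp : ∀ l B, |l - l₀| < ε₀ → (p l B ↔ ∃ w : V, w ≠ 0 ∧
      (∃ c : ℝ, w = c • w₀ + K (𝔅 B w - (l - l₀) • w)) ∧
      ℓ₀ (𝔅 B w - (l - l₀) • w) = 0 ∧ ℓ (𝔅 B w - (l - l₀) • w) = 0)) :
    ∃ ε > 0, ∃ U : Set Y, IsOpen U ∧ 0 ∈ U ∧ IsSubmanifoldOfCodim (Fintype.card I)
      ({B : Y | ∃ l ∈ Ioo (l₀ - ε) (l₀ + ε), p l B} ∩ U) := by
  have hne : (ω : WithTop ℕ∞) ≠ 0 := by simp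
  let N : X × ℝ → (V →L[ℝ] V) := fun z => 𝔅 z.1 - (z.2 - l₀) • ContinuousLinearMap.id ℝ V
  have hNap : ∀ B l w, N (B, l) w = 𝔅 B w - (l - l₀) • w := fun B l w => rfl
  let N' : X × ℝ →L[ℝ] (V →L[ℝ] V) := 𝔅 ∘L ContinuousLinearMap.fst ℝ X ℝ -
    (ContinuousLinearMap.snd ℝ X ℝ).smulRight (ContinuousLinearMap.id ℝ V)
  have hN0 : N (0, l₀) = 0 := by simp [N]
  have hNc : ContDiff ℝ ω N :=
    (𝔅.contDiff.comp contDiff_fst).sub ((contDiff_snd.sub contDiff_const).smul contDiff_const)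
  have hNd : HasFDerivAt N N' (0, l₀) := by
    have : N = fun z => N' z + l₀ • ContinuousLinearMap.id ℝ V := by
      funext z
      simp only [N, N', sub_smul]
      change _ = 𝔅 z.1 - z.2 • ContinuousLinearMap.id ℝ V + _
      abel
    rw [this]
    exact N'.hasFDerivAt.add_const _
  -- The equation w = c w₀ + K(N w) reads T w = c w₀, and T equals 1 at the base point. Hence w is c
  -- times the vector `W` defined next.
  let T : X × ℝ → (V →L[ℝ] V) := fun z => 1 - K ∘L N z
  have hT0 : T (0, l₀) = 1 := by simp [T, hN0]
  have hTc : ContDiff ℝ ω T := contDiff_const.sub (contDiff_const.clm_comp hNc)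
  let W : X × ℝ → V := fun z => Ring.inverse (T z) w₀
  have hW0 : W (0, l₀) = w₀ := by simp [W, hT0]
  have hWc : ContDiffAt ℝ ω W (0, l₀) := by
    have e1 : ContDiffAt ℝ ω (Ring.inverse : (V →L[ℝ] V) → _) (T (0, l₀)) := by
      rw [hT0]
      exact contDiffAt_ringInverse ℝ (1 : (V →L[ℝ] V)ˣ)
    exact (e1.comp (0, l₀) hTc.contDiffAt).clm_apply contDiffAt_const
  let Q : X × ℝ → V := fun z => N z (W z)
  have hQ0 : Q (0, l₀) = 0 := by simp [Q, hN0]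
  have hQc : ContDiffAt ℝ ω Q (0, l₀) := hNc.contDiffAt.clm_apply hWc
  have hQd : HasFDerivAt Q (N'.flip w₀) (0, l₀) := by
    have := hNd.clm_apply (hWc.differentiableAt hne).hasFDerivAt
    rw [hN0, hW0] at this
    simpa using this
  have hN'w : ∀ B t, N'.flip w₀ (B, t) = 𝔅 B w₀ - t • w₀ := fun B t => rfl
  have hgc : ContDiffAt ℝ ω (fun z => ℓ₀ (Q z)) (0, l₀) := ℓ₀.contDiff.contDiffAt.comp _ hQc
  have hgd : HasFDerivAt (fun z => ℓ₀ (Q z)) (ℓ₀ ∘L N'.flip w₀) (0, l₀) :=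
    ℓ₀.hasFDerivAt.comp _ hQd
  -- The partial derivative in l is multiplication by -ℓ₀ w₀, which is nonzero by assumption.
  have hinv : (fderiv ℝ (fun z => ℓ₀ (Q z)) (0, l₀) ∘L .inr ℝ X ℝ).IsInvertible := by
    rw [hgd.fderiv]
    refine ⟨ContinuousLinearEquiv.unitsEquivAut ℝ (Units.mk0 (-ℓ₀ w₀) (neg_ne_zero.2 h0)), ?_⟩
    ext
    simp [hN'w]
  set Λ := hgc.implicitFunction hne hinv with hΛ
  have hΛ0 : Λ 0 = l₀ := hgc.implicitFunction_apply_self hne hinv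
  have hΛc : ContDiffAt ℝ ω Λ 0 := hgc.contDiffAt_implicitFunction hne hinv
  have hΛiff : ∀ᶠ z in 𝓝 ((0, l₀) : X × ℝ), ℓ₀ (Q z) = 0 ↔ Λ z.1 = z.2 := by
    have := hgc.eventually_apply_eq_iff_implicitFunction hne hinv
    rw [hQ0, map_zero] at this
    exact this
  have hunit : ∀ᶠ z in 𝓝 ((0, l₀) : X × ℝ), IsUnit (T z) := by
    refine hTc.continuous.continuousAt.eventually (Units.isOpen.mem_nhds ?_)
    rw [hT0]; exact isUnit_one
  obtain ⟨δ, hδ, hbox⟩ := Metric.eventually_nhds_iff.1 (hΛiff.and hunit)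
  set ε := min ε₀ δ with hε
  have hεpos : 0 < ε := lt_min hε₀ hδ
  have hbox' : ∀ B l, ‖B‖ < ε → |l - l₀| < ε →
      (ℓ₀ (Q (B, l)) = 0 ↔ Λ B = l) ∧ IsUnit (T (B, l)) := fun B l hB hl => by
    refine hbox (y := (B, l)) ?_
    rw [Prod.dist_eq]
    refine max_lt ?_ ?_
    · simpa using hB.trans_le (min_le_right _ _)
    · rw [Real.dist_eq]; exact hl.trans_le (min_le_right _ _)
  have hZc : ContDiffAt ℝ ω (fun B => ℓ (Q (B, Λ B))) 0 := by
    have e1 : ContDiffAt ℝ ω (fun B => ((B, Λ B) : X × ℝ)) 0 := contDiffAt_id.prodMk hΛc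
    have e2 : ContDiffAt ℝ ω Q (0, Λ 0) := by rw [hΛ0]; exact hQc
    have e3 : ContDiffAt ℝ ω (fun B => Q (B, Λ B)) 0 := ContDiffAt.comp (f := fun B : X => ((B, Λ B) : X × ℝ)) (0 : X) e2 e1
    exact ℓ.contDiff.contDiffAt.comp 0 e3
  have hZd : HasFDerivAt (fun B => ℓ (Q (B, Λ B))) (ℓ ∘L 𝔅.flip w₀) 0 := by
    have e1 : HasFDerivAt (fun B => ((B, Λ B) : X × ℝ))
        ((ContinuousLinearMap.id ℝ X).prod (fderiv ℝ Λ 0)) 0 :=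
      (hasFDerivAt_id (0 : X)).prodMk (hΛc.differentiableAt hne).hasFDerivAt
    have e2 : HasFDerivAt Q (N'.flip w₀) (0, Λ 0) := by rw [hΛ0]; exact hQd
    refine (ℓ.hasFDerivAt.comp (0 : X) (e2.comp (0 : X) e1)).congr_fderiv ?_
    refine ContinuousLinearMap.ext fun B => ?_
    -- The unknown derivative of Λ enters only through a multiple of w₀, which `ℓ` annihilates.
    change ℓ (𝔅 B w₀ - (fderiv ℝ Λ 0 B) • w₀) = ℓ (𝔅 B w₀)
    rw [map_sub, map_smul, h1, smul_zero, sub_zero]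
  have hΛev : ∀ᶠ B in 𝓝 (0 : X), |Λ B - l₀| < ε := by
    have := hΛc.continuousAt.eventually (Metric.ball_mem_nhds (Λ 0) hεpos)
    rw [hΛ0] at this
    exact this
  obtain ⟨δ', hδ', hΛev⟩ := Metric.eventually_nhds_iff.1 hΛev
  have hδ₂ : 0 < min δ' ε := lt_min hδ' hεpos
  obtain ⟨U, hUo, hU0, hUO, hUS⟩ := exists_isSubmanifoldOfCodim_levelSet hZc hZd
    (by simp [hΛ0, hQ0]) Y hsurj Metric.isOpen_ball (Metric.mem_ball_self hδ₂)
  refine ⟨ε, hεpos, U, hUo, hU0, hUS _ fun B hB => ?_⟩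
  have hBn : ‖(B : X)‖ < min δ' ε := by simpa using hUO B hB
  have hBε : ‖(B : X)‖ < ε := hBn.trans_le (min_le_right _ _)
  have hBΛ : |Λ B - l₀| < ε :=
    hΛev (by simpa using hBn.trans_le (min_le_left _ _))
  have hTW : ∀ l, |l - l₀| < ε → W (B, l) - K (Q (B, l)) = w₀ := fun l hl => by
    have e1 : T (B, l) (W (B, l)) = w₀ := by
      change (T (B, l) * Ring.inverse (T (B, l))) w₀ = w₀
      rw [Ring.mul_inverse_cancel _ (hbox' B l hBε hl).2]
      rfl
    exact e1
  constructor
  · rintro ⟨l, hl, hpl⟩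
    have hl' : |l - l₀| < ε := by
      rw [abs_lt]; constructor <;> linarith [hl.1, hl.2]
    obtain ⟨w, hw0, ⟨c, hc⟩, hw1, hw2⟩ := (hp l B (hl'.trans_le (min_le_left _ _))).1 hpl
    rw [← hNap] at hc hw1 hw2
    have e1 : T (B, l) w = c • w₀ := by
      change w - K (N (B, l) w) = _
      rw [sub_eq_iff_eq_add]
      exact hc
    have e2 : w = c • W (B, l) := by
      have : (Ring.inverse (T (B, l)) * T (B, l)) w = Ring.inverse (T (B, l)) (c • w₀) := by
        rw [← e1]; rfl
      rw [Ring.inverse_mul_cancel _ (hbox' B l hBε hl').2, map_smul] at this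
      exact this
    have hc0 : c ≠ 0 := by
      rintro rfl
      exact hw0 (by rw [e2, zero_smul])
    have e3 : N (B, l) w = c • Q (B, l) := by
      nth_rw 1 [e2]
      rw [map_smul]
    rw [e3, map_smul, smul_eq_zero] at hw1 hw2
    have e4 := (hbox' B l hBε hl').1.1 (hw1.resolve_left hc0)
    rw [e4]
    exact hw2.resolve_left hc0
  · intro hz
    refine ⟨Λ B, ?_, (hp _ B (hBΛ.trans_le (min_le_left _ _))).2
      ⟨W (B, Λ B), fun hcon => ?_, ⟨1, ?_⟩, ?_, hz⟩⟩
    · rw [abs_lt] at hBΛ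
      constructor <;> linarith
    · have := hTW _ hBΛ
      simp only [Q, hcon, map_zero, sub_zero] at this
      rw [← this, map_zero] at h0
      exact h0 rfl
    · rw [one_smul]
      exact eq_add_of_sub_eq (hTW _ hBΛ)
    · exact (hbox' B _ hBε hBΛ).1.2 rfl

/-! ### Completeness of the perturbation space. -/

namespace PerturbationSpace

instance (n : ℕ) (β : ℝ) : CompleteSpace (PerturbationSpace n β) := by
  have hiso : Isometry (weighted n β) :=
    AddMonoidHomClass.isometry_of_norm _ fun _ => rfl
  rw [completeSpace_iff_isComplete_range hiso.isUniformInducing]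
  refine IsClosed.isComplete ?_
  -- The weight is positive and continuous, so symmetry of the values is the only constraint on the
  -- range; it is a closed condition.
  have : range (weighted n β) = {g | ∀ x, (g x)ᵀ = g x} := by
    ext g
    constructor
    · rintro ⟨B, rfl⟩ x
      rw [weighted_apply, Matrix.transpose_smul, B.2.2.1]
    · intro hg
      have hpos : ∀ x : ℝ, 0 < (1 + |x|) ^ β := fun x => Real.rpow_pos_of_pos (by positivity) _
      refine ⟨⟨fun x => ((1 + |x|) ^ β : ℝ)⁻¹ • g x, ?_, fun x => ?_, ‖g‖, ?_⟩, ?_⟩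
      · refine Continuous.smul (Continuous.inv₀ ?_ fun x => (hpos x).ne') g.continuous
        exact (continuous_const.add continuous_abs).rpow_const
          fun x => Or.inl (ne_of_gt (show (0 : ℝ) < 1 + |x| by positivity))
      · rw [Matrix.transpose_smul, hg x]
      · rintro _ ⟨x, rfl⟩
        simp only [norm_smul, norm_inv, Real.norm_of_nonneg (hpos x).le]
        rw [mul_right_comm, inv_mul_cancel₀ (hpos x).ne', one_mul]
        exact g.norm_coe_le_norm x
      · ext1 x
        exact smul_inv_smul₀ (hpos x).ne' (g x)
  rw [this, ofPred_forall]
  refine isClosed_iInter fun x => isClosed_eq ?_ ?_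
  · exact Continuous.matrix_transpose (BoundedContinuousFunction.evalCLM ℝ x).continuous
  · exact (BoundedContinuousFunction.evalCLM ℝ x).continuous

end PerturbationSpace

/-! ### Classical representatives of eigenfunctions and their decay. -/

theorem tendsto_integral_Icc_succ_zero {F : ℝ → ℝ} (hF : Integrable F) :
    Tendsto (fun x => ∫ t in x..(x + 1), F t) atTop (𝓝 0) := by
  have h := intervalIntegral_tendsto_integral_Ioi (f := F) 0 hF.integrableOn tendsto_id
  have h1 := (h.comp (tendsto_atTop_add_const_right atTop (1 : ℝ) tendsto_id)).sub h
  rw [sub_self] at h1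
  refine h1.congr fun x => ?_
  have := intervalIntegral.integral_add_adjacent_intervals
    (hF.intervalIntegrable (a := 0) (b := x)) (hF.intervalIntegrable (a := x) (b := x + 1))
  simp only [Function.comp, id]
  linarith

/-- A local estimate of a function and its derivative by the function and its second derivative. -/
theorem IsSol.abs_le_integral {h y y' : ℝ → ℝ} (hs : IsSol 0 h y y') (hc : Continuous h) (x : ℝ) :
    |y x| ≤ 6 * ∫ t in x..(x + 1), (|h t| + |y t|) ∧
    |y' x| ≤ 6 * ∫ t in x..(x + 1), (|h t| + |y t|) := by
  have hyc := hs.continuous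
  -- Integration by parts against a cubic in t - x that vanishes with its slope at the right end
  -- leaves only boundary terms at x. The cubic -τ(1 - τ)² then isolates y(x), and 1 - 3τ² + 2τ³
  -- isolates y'(x).
  have main : ∀ a₀ a₁ a₂ a₃ : ℝ, a₀ + a₁ + a₂ + a₃ = 0 → a₁ + 2 * a₂ + 3 * a₃ = 0 →
      (∀ τ ∈ Icc (0 : ℝ) 1, |a₀ + a₁ * τ + a₂ * τ ^ 2 + a₃ * τ ^ 3| ≤ 6 ∧ |2 * a₂ + 6 * a₃ * τ| ≤ 6) →
      |a₀ * y' x - a₁ * y x| ≤ 6 * ∫ t in x..(x + 1), (|h t| + |y t|) := by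
    intro a₀ a₁ a₂ a₃ e1 e2 hb
    have hd : ∀ t, HasDerivAt (fun t => (a₀ + a₁ * (t - x) + a₂ * (t - x) ^ 2 + a₃ * (t - x) ^ 3) * y' t
        - (a₁ + 2 * a₂ * (t - x) + 3 * a₃ * (t - x) ^ 2) * y t)
        ((a₀ + a₁ * (t - x) + a₂ * (t - x) ^ 2 + a₃ * (t - x) ^ 3) * h t -
          (2 * a₂ + 6 * a₃ * (t - x)) * y t) t := by
      intro t
      have d0 : HasDerivAt (fun t => t - x) 1 t := (hasDerivAt_id t).sub_const x
      have d1 := (((d0.const_mul a₁).const_add a₀).add ((d0.pow 2).const_mul a₂)).add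
        ((d0.pow 3).const_mul a₃)
      have d2 := ((d0.const_mul (2 * a₂)).const_add a₁).add ((d0.pow 2).const_mul (3 * a₃))
      refine ((d1.mul (hs.deriv_snd t)).sub (d2.mul (hs.deriv_fst t))).congr_deriv ?_
      simp
      ring
    have hI := intervalIntegral.integral_eq_sub_of_hasDerivAt (a := x) (b := x + 1)
      (fun t _ => hd t) (Continuous.intervalIntegrable (by fun_prop) _ _)
    have e3 : a₀ + a₁ * (x + 1 - x) + a₂ * (x + 1 - x) ^ 2 + a₃ * (x + 1 - x) ^ 3 = 0 := by
      linear_combination e1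
    have e4 : a₁ + 2 * a₂ * (x + 1 - x) + 3 * a₃ * (x + 1 - x) ^ 2 = 0 := by linear_combination e2
    simp only [e3, e4, sub_self, mul_zero, add_zero, zero_mul, ne_eq, OfNat.ofNat_ne_zero,
      not_false_eq_true, zero_pow, zero_sub] at hI
    rw [← abs_neg, ← hI, ← intervalIntegral.integral_const_mul, ← Real.norm_eq_abs]
    refine intervalIntegral.norm_integral_le_of_norm_le (by linarith) (.of_forall fun t ht => ?_)
      (Continuous.intervalIntegrable (by fun_prop) _ _)
    obtain ⟨b1, b2⟩ := hb (t - x) ⟨by linarith [ht.1], by linarith [ht.2]⟩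
    rw [Real.norm_eq_abs]
    refine (abs_sub _ _).trans ?_
    rw [abs_mul, abs_mul, mul_add]
    gcongr
  constructor
  · have := main 0 (-1) 2 (-1) (by norm_num) (by norm_num) fun τ hτ => by
      constructor <;> rw [abs_le] <;> constructor <;>
        nlinarith [hτ.1, hτ.2, mul_nonneg hτ.1 hτ.1, mul_nonneg hτ.1 (sub_nonneg.2 hτ.2),
          mul_nonneg (mul_nonneg hτ.1 hτ.1) (sub_nonneg.2 hτ.2), pow_nonneg hτ.1 3]
    simpa using this
  · have := main 1 0 (-3) 2 (by norm_num) (by norm_num) fun τ hτ => by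
      constructor <;> rw [abs_le] <;> constructor <;>
        nlinarith [hτ.1, hτ.2, mul_nonneg hτ.1 hτ.1, mul_nonneg hτ.1 (sub_nonneg.2 hτ.2),
          mul_nonneg (mul_nonneg hτ.1 hτ.1) (sub_nonneg.2 hτ.2), pow_nonneg hτ.1 3]
    simpa using this

/-- A function that is square integrable together with its second derivative tends to zero at
`+∞`, and so does its first derivative. -/
theorem IsSol.tendsto_atTop_zero {h y y' : ℝ → ℝ} (hs : IsSol 0 h y y') (hc : Continuous h)
    (hy : Integrable fun x => y x ^ 2) (hh : Integrable fun x => h x ^ 2) :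
    Tendsto y atTop (𝓝 0) ∧ Tendsto y' atTop (𝓝 0) := by
  have hyc := hs.continuous
  have hD := tendsto_integral_Icc_succ_zero (hh.add hy)
  have key : ∀ ε > 0, ∀ᶠ x in atTop, 6 * ∫ t in x..(x + 1), (|h t| + |y t|) < ε := by
    intro ε hε
    -- The integral of |h| + |y| will be at most 2e + e, and 6 · 3e = 18e is less than ε.
    set e := ε / 24 with he
    have he0 : 0 < e := by positivity
    filter_upwards [hD.eventually_lt_const (u := e ^ 2) (by positivity)] with x hx
    have h1 : ∫ t in x..(x + 1), (|h t| + |y t|) ≤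
        ∫ t in x..(x + 1), (2 * e + e⁻¹ * (h t ^ 2 + y t ^ 2)) := by
      refine intervalIntegral.integral_mono_on (by linarith)
        (Continuous.intervalIntegrable (by fun_prop) _ _)
        (Continuous.intervalIntegrable (by fun_prop) _ _) fun t _ => ?_
      have aux : ∀ z : ℝ, |z| ≤ e + e⁻¹ * z ^ 2 := fun z => by
        have : |z| * e ≤ e * e + z ^ 2 := by
          rw [← sq_abs z]
          nlinarith [sq_nonneg (|z| - e), abs_nonneg z]
        calc |z| = (|z| * e) * e⁻¹ := by field_simp
          _ ≤ (e * e + z ^ 2) * e⁻¹ := by gcongr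
          _ = _ := by field_simp
      linarith [aux (h t), aux (y t)]
    have h2 : ∫ t in x..(x + 1), (2 * e + e⁻¹ * (h t ^ 2 + y t ^ 2)) =
        2 * e + e⁻¹ * ∫ t in x..(x + 1), (h t ^ 2 + y t ^ 2) := by
      rw [intervalIntegral.integral_add (Continuous.intervalIntegrable (by fun_prop) _ _)
        (Continuous.intervalIntegrable (by fun_prop) _ _), intervalIntegral.integral_const_mul,
        intervalIntegral.integral_const]
      simp
    have h3 : e⁻¹ * ∫ t in x..(x + 1), (h t ^ 2 + y t ^ 2) ≤ e⁻¹ * e ^ 2 := by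
      gcongr
      exact hx.le
    have h4 : e⁻¹ * e ^ 2 = e := by field_simp
    linarith
  constructor <;> rw [Metric.tendsto_nhds] <;> intro ε hε <;> filter_upwards [key ε hε] with x hx <;>
    rw [Real.dist_0_eq_abs]
  · exact (hs.abs_le_integral hc x).1.trans_lt hx
  · exact (hs.abs_le_integral hc x).2.trans_lt hx

theorem IsSol.tendsto_atBot_zero {h y y' : ℝ → ℝ} (hs : IsSol 0 h y y') (hc : Continuous h)
    (hy : Integrable fun x => y x ^ 2) (hh : Integrable fun x => h x ^ 2) :
    Tendsto y atBot (𝓝 0) ∧ Tendsto y' atBot (𝓝 0) := by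
  obtain ⟨h1, h2⟩ := IsSol.tendsto_atTop_zero (h := fun x => h (-x)) (by simpa using! hs.reflect)
    (by fun_prop) hy.comp_neg hh.comp_neg
  have h3 := h1.comp tendsto_neg_atBot_atTop
  have h4 := h2.neg.comp tendsto_neg_atBot_atTop
  simp only [Function.comp_def, neg_neg, neg_zero] at h3 h4
  exact ⟨h3, h4⟩

/-- The components of a classical solution of `-u'' + A u = l u`. -/
def IsSystemSol {n : ℕ} (A : ℝ → Matrix (Fin n) (Fin n) ℝ) (l : ℝ) (u u' : Fin n → ℝ → ℝ) : Prop :=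
  ∀ i, IsSol 0 (fun x => ∑ k, A x i k * u k x - l * u i x) (u i) (u' i)

theorem IsSystemSol.continuous_rhs {n : ℕ} {A : ℝ → Matrix (Fin n) (Fin n) ℝ} (hA : Continuous A)
    {l : ℝ} {u u' : Fin n → ℝ → ℝ} (h : IsSystemSol A l u u') (i : Fin n) :
    Continuous fun x => ∑ k, A x i k * u k x - l * u i x := by
  have h1 := fun k => (h k).continuous
  have h2 := fun k => hA.matrix_elem i k
  fun_prop

/-- An eigenfunction in `L²` has a classical representative that decays with its derivative. -/
theorem IsEigenfunction.exists_isSystemSol {n : ℕ} {A : ℝ → Matrix (Fin n) (Fin n) ℝ}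
    (hA : Continuous A) {l : ℝ} {w : L2Space n} (hw : IsEigenfunction (schrodingerOp A) l w) :
    ∃ u u' : Fin n → ℝ → ℝ, IsSystemSol A l u u' ∧ (∀ᵐ x, ∀ i, w x i = u i x) ∧
      (∃ i x, u i x ≠ 0) ∧ ∀ i, (Tendsto (u i) atTop (𝓝 0) ∧ Tendsto (u' i) atTop (𝓝 0)) ∧
        (Tendsto (u i) atBot (𝓝 0) ∧ Tendsto (u' i) atBot (𝓝 0)) := by
  obtain ⟨hw0, hd, hT⟩ := hw
  have hg : (w, l • w) ∈ schrodingerGraph A := by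
    rw [← schrodingerOp_graph, LinearPMap.mem_graph_iff]
    exact ⟨⟨w, hd⟩, rfl, hT⟩
  obtain ⟨u, v, g, h1, h2, h3, h4⟩ := hg
  simp only at h1 h4
  have huc : Continuous u := continuous_iff_continuousAt.2 fun x => (h2 x).continuousAt
  set G : ℝ → EuclideanSpace ℝ (Fin n) := fun x => Matrix.toEuclideanLin (A x) (u x) - l • u x with hG
  have hGi : ∀ x i, G x i = ∑ k, A x i k * u x k - l * u x i := fun x i => by
    simp [hG, Matrix.mulVec, dotProduct]
  have hui : ∀ i, Continuous fun x => u x i := fun i => by fun_prop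
  have hGic : ∀ i, Continuous fun x => G x i := fun i => by
    simp only [hGi]
    have h2 := fun k => hA.matrix_elem i k
    fun_prop
  have hGc : Continuous G := by
    have : Continuous fun x => WithLp.toLp 2 fun i => G x i :=
      (PiLp.continuous_toLp 2 _).comp (continuous_pi hGic)
    exact this
  -- By the eigenvalue equation the weak second derivative agrees almost everywhere with a
  -- continuous function, which makes `u` twice continuously differentiable.
  have hgG : g =ᵐ[volume] G := by
    filter_upwards [h4, h1, Lp.coeFn_smul l w] with x e1 e2 e3
    rw [e3, Pi.smul_apply, e2] at e1
    rw [hG]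
    simp only [e1]
    abel
  have hv : ∀ x, HasDerivAt v (G x) x := fun x => by
    have e1 : v = fun x => v 0 + ∫ t in (0 : ℝ)..x, G t := by
      funext x
      rw [h3 x]
      congr 1
      refine intervalIntegral.integral_congr_ae ?_
      filter_upwards [hgG] with t ht _
      exact ht
    rw [e1]
    exact (intervalIntegral.integral_hasDerivAt_right (hGc.intervalIntegrable _ _)
      (hGc.stronglyMeasurableAtFilter _ _) hGc.continuousAt).const_add _
  have hproj : ∀ (i : Fin n) {f : ℝ → EuclideanSpace ℝ (Fin n)} {f' : EuclideanSpace ℝ (Fin n)}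
      {x : ℝ}, HasDerivAt f f' x → HasDerivAt (fun x => f x i) (f' i) x := fun i f f' x h =>
    (EuclideanSpace.proj (𝕜 := ℝ) i).hasFDerivAt.comp_hasDerivAt x h
  have hsol : IsSystemSol A l (fun i x => u x i) (fun i x => v x i) := fun i =>
    ⟨fun x => hproj i (h2 x), fun x => (hproj i (hv x)).congr_deriv (by rw [hGi]; simp)⟩
  have hsq : ∀ (f : L2Space n) (F : ℝ → EuclideanSpace ℝ (Fin n)), f =ᵐ[volume] F → Continuous F →
      ∀ i, Integrable fun x => F x i ^ 2 := fun f F hf hF i => by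
    have e1 : MemLp F 2 volume := (Lp.memLp f).ae_eq hf
    have e2 : MemLp (fun x => F x i) 2 volume :=
      e1.mono (Continuous.aestronglyMeasurable (by fun_prop))
        (.of_forall fun x => PiLp.norm_apply_le (F x) i)
    exact e2.integrable_sq
  refine ⟨fun i x => u x i, fun i x => v x i, hsol, ?_, ?_, fun i => ?_⟩
  · filter_upwards [h1] with x hx i
    rw [hx]
  · by_contra! hcon
    refine hw0 ((Lp.eq_zero_iff_ae_eq_zero).2 ?_)
    filter_upwards [h1] with x hx
    rw [hx]
    ext i
    exact hcon i x
  · have e1 := hsq w u h1 huc i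
    have e2 := hsq g G hgG hGc i
    simp only [hGi] at e2
    exact ⟨(hsol i).tendsto_atTop_zero (hsol.continuous_rhs hA i) e1 e2,
      (hsol i).tendsto_atBot_zero (hsol.continuous_rhs hA i) e1 e2⟩

theorem memLp_toLp_of_exp_decay {n : ℕ} {f : Fin n → ℝ → ℝ} (hf : ∀ i, Continuous (f i)) {C η : ℝ}
    (hη : 0 < η) (hC : 0 ≤ C) (hb : ∀ i x, |f i x| ≤ C * Real.exp (-η * |x|)) :
    MemLp (fun x => (WithLp.toLp 2 fun i => f i x : EuclideanSpace ℝ (Fin n))) 2 volume := by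
  have hc : Continuous fun x => (WithLp.toLp 2 fun i => f i x : EuclideanSpace ℝ (Fin n)) :=
    (PiLp.continuous_toLp 2 _).comp (continuous_pi hf)
  set e := (EuclideanSpace.equiv (Fin n) ℝ).symm with he
  have h1 : MemLp (fun x : ℝ => ‖(e : (Fin n → ℝ) →L[ℝ] EuclideanSpace ℝ (Fin n))‖ *
      (C * Real.exp (-η * |x|))) 2 volume := by
    refine (memLp_two_iff_integrable_sq (Continuous.aestronglyMeasurable (by fun_prop))).2 ?_
    have : (fun x : ℝ => (‖(e : (Fin n → ℝ) →L[ℝ] EuclideanSpace ℝ (Fin n))‖ *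
        (C * Real.exp (-η * |x|))) ^ 2) = fun x : ℝ =>
        (‖(e : (Fin n → ℝ) →L[ℝ] EuclideanSpace ℝ (Fin n))‖ * C) ^ 2 *
          Real.exp (-(2 * η) * |x|) := by
      funext x
      have : Real.exp (-(2 * η) * |x|) = Real.exp (-η * |x|) ^ 2 := by
        rw [← Real.exp_nat_mul]; congr 1; push_cast; ring
      rw [this]; ring
    rw [this]
    exact (integrable_exp_neg_mul_abs (by positivity)).const_mul _
  refine h1.mono hc.aestronglyMeasurable (.of_forall fun x => ?_)
  have h2 : ‖fun i => f i x‖ ≤ C * Real.exp (-η * |x|) :=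
    (pi_norm_le_iff_of_nonneg (by positivity)).2 fun i => hb i x
  rw [Real.norm_of_nonneg (by positivity)]
  exact ((e : (Fin n → ℝ) →L[ℝ] EuclideanSpace ℝ (Fin n)).le_opNorm _).trans (by gcongr)

/-- An exponentially decaying classical solution is an eigenfunction. -/
theorem IsSystemSol.exists_isEigenfunction {n : ℕ} {A : ℝ → Matrix (Fin n) (Fin n) ℝ}
    (hA : Continuous A) {M : ℝ} (hM : ∀ x i k, |A x i k| ≤ M) {l : ℝ} {u u' : Fin n → ℝ → ℝ}
    (hu : IsSystemSol A l u u') {C η : ℝ} (hη : 0 < η)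
    (hb : ∀ i x, |u i x| ≤ C * Real.exp (-η * |x|)) (h0 : ∃ i x, u i x ≠ 0) :
    ∃ w, IsEigenfunction (schrodingerOp A) l w ∧ ∀ᵐ x, ∀ i, w x i = u i x := by
  obtain ⟨i₀, x₀, hne⟩ := h0
  have hC : 0 ≤ C := by
    have := (abs_nonneg _).trans (hb i₀ 0)
    simpa using this
  have hM0 : 0 ≤ M := (abs_nonneg _).trans (hM 0 i₀ i₀)
  have huc := fun i => (hu i).continuous
  have hgc := hu.continuous_rhs hA
  have m1 := memLp_toLp_of_exp_decay huc hη hC hb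
  have m2 := memLp_toLp_of_exp_decay (C := (n * M + |l|) * C) hgc hη (by positivity) fun i x => by
    calc |∑ k, A x i k * u k x - l * u i x| ≤ |∑ k, A x i k * u k x| + |l * u i x| := abs_sub _ _
      _ ≤ (∑ k : Fin n, M * (C * Real.exp (-η * |x|))) + |l| * (C * Real.exp (-η * |x|)) := by
          rw [abs_mul]
          gcongr
          · refine (Finset.abs_sum_le_sum_abs _ _).trans (Finset.sum_le_sum fun k _ => ?_)
            rw [abs_mul]
            exact mul_le_mul (hM x i k) (hb k x) (abs_nonneg _) hM0
          · exact hb i x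
      _ = _ := by simp; ring
  set U : ℝ → EuclideanSpace ℝ (Fin n) := fun x => WithLp.toLp 2 fun i => u i x with hU
  set V : ℝ → EuclideanSpace ℝ (Fin n) := fun x => WithLp.toLp 2 fun i => u' i x with hV
  set G : ℝ → EuclideanSpace ℝ (Fin n) := fun x =>
    WithLp.toLp 2 fun i => ∑ k, A x i k * u k x - l * u i x with hG
  have hlift : ∀ {f : Fin n → ℝ → ℝ} {f' : Fin n → ℝ} {x : ℝ}, (∀ i, HasDerivAt (f i) (f' i) x) →
      HasDerivAt (fun x => (WithLp.toLp 2 fun i => f i x : EuclideanSpace ℝ (Fin n)))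
        (WithLp.toLp 2 f') x := fun {f f' x} h =>
    ((EuclideanSpace.equiv (Fin n) ℝ).symm :
      (Fin n → ℝ) →L[ℝ] EuclideanSpace ℝ (Fin n)).hasFDerivAt.comp_hasDerivAt x (hasDerivAt_pi.2 h)
  have hUd : ∀ x, HasDerivAt U (V x) x := fun x => hlift fun i => (hu i).deriv_fst x
  have hVd : ∀ x, HasDerivAt V (G x) x := fun x => hlift fun i =>
    ((hu i).deriv_snd x).congr_deriv (by simp)
  have hGc : Continuous G := (PiLp.continuous_toLp 2 _).comp (continuous_pi hgc)
  have hUc : Continuous U := (PiLp.continuous_toLp 2 _).comp (continuous_pi huc)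
  have hw := m1.coeFn_toLp
  have hg := m2.coeFn_toLp
  have hgraph : (m1.toLp U, l • m1.toLp U) ∈ schrodingerGraph A := by
    refine ⟨U, V, m2.toLp G, hw, hUd, fun x => ?_, ?_⟩
    · have e1 : ∫ t in (0 : ℝ)..x, m2.toLp G t = ∫ t in (0 : ℝ)..x, G t := by
        refine intervalIntegral.integral_congr_ae ?_
        filter_upwards [hg] with t ht _
        exact ht
      rw [e1, intervalIntegral.integral_eq_sub_of_hasDerivAt (fun t _ => hVd t)
        (hGc.intervalIntegrable _ _)]
      abel
    · filter_upwards [hw, hg, Lp.coeFn_smul l (m1.toLp U)] with x e1 e2 e3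
      change (l • m1.toLp U : L2Space n) x = _
      rw [e3, Pi.smul_apply, e1, e2]
      ext i
      simp [hU, hG, Matrix.mulVec, dotProduct]
  rw [← schrodingerOp_graph, LinearPMap.mem_graph_iff] at hgraph
  obtain ⟨y, hy1, hy2⟩ := hgraph
  simp only at hy1 hy2
  refine ⟨m1.toLp U, ⟨fun hz => ?_, hy1 ▸ y.2, ?_⟩, ?_⟩
  · have e1 : U =ᵐ[volume] 0 := hw.symm.trans (by rw [hz]; exact Lp.coeFn_zero _ _ _)
    have e2 : U = 0 := (Continuous.ae_eq_iff_eq volume hUc continuous_const).1 e1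
    refine hne ?_
    have := congrFun e2 x₀
    have := congrArg (fun z : EuclideanSpace ℝ (Fin n) => z i₀) this
    simpa [hU] using this
  · rw [← hy2]
    congr 1
    exact Subtype.ext hy1.symm
  · filter_upwards [hw] with x hx i
    rw [hx]

/-! ### Exponentially weighted functions, pairings and primitives. -/

/-- The exponentially decaying function `e^{-η|x|} g(x)`. -/
noncomputable def damp (η : ℝ) (g : ℝ →ᵇ ℝ) (x : ℝ) : ℝ := Real.exp (-η * |x|) * g x

theorem continuous_damp (η : ℝ) (g : ℝ →ᵇ ℝ) : Continuous (damp η g) := by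
  have := g.continuous
  unfold damp
  fun_prop

theorem abs_damp_le (η : ℝ) (g : ℝ →ᵇ ℝ) (x : ℝ) : |damp η g x| ≤ ‖g‖ * Real.exp (-η * |x|) := by
  rw [damp, abs_mul, Real.abs_exp, mul_comm]
  gcongr
  exact g.norm_coe_le_norm x

theorem exp_mul_damp (η : ℝ) (g : ℝ →ᵇ ℝ) (x : ℝ) : Real.exp (η * |x|) * damp η g x = g x := by
  rw [damp, ← mul_assoc, ← Real.exp_add]
  simp

theorem eq_of_damp_eq {η : ℝ} {g g' : ℝ →ᵇ ℝ} (h : ∀ x, damp η g x = damp η g' x) : g = g' := by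
  ext x
  rw [← exp_mul_damp η, h, exp_mul_damp]

theorem damp_add (η : ℝ) (g g' : ℝ →ᵇ ℝ) (x : ℝ) : damp η (g + g') x = damp η g x + damp η g' x := by
  simp [damp, mul_add]

theorem damp_smul (η c : ℝ) (g : ℝ →ᵇ ℝ) (x : ℝ) : damp η (c • g) x = c * damp η g x := by
  simp [damp]; ring

theorem tendsto_exp_neg_mul_abs {η : ℝ} (hη : 0 < η) :
    Tendsto (fun x : ℝ => Real.exp (-η * |x|)) atTop (𝓝 0) ∧
    Tendsto (fun x : ℝ => Real.exp (-η * |x|)) atBot (𝓝 0) :=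
  ⟨Real.tendsto_exp_atBot.comp (tendsto_abs_atTop_atTop.const_mul_atTop_of_neg (neg_lt_zero.2 hη)),
    Real.tendsto_exp_atBot.comp (tendsto_abs_atBot_atTop.const_mul_atTop_of_neg (neg_lt_zero.2 hη))⟩

theorem tendsto_damp {η : ℝ} (hη : 0 < η) (g : ℝ →ᵇ ℝ) :
    Tendsto (damp η g) atTop (𝓝 0) ∧ Tendsto (damp η g) atBot (𝓝 0) := by
  obtain ⟨h1, h2⟩ := tendsto_exp_neg_mul_abs hη
  constructor
  · refine squeeze_zero_norm (abs_damp_le η g) ?_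
    simpa using h1.const_mul ‖g‖
  · refine squeeze_zero_norm (abs_damp_le η g) ?_
    simpa using h2.const_mul ‖g‖

theorem integrable_mul_damp {η : ℝ} (hη : 0 < η) {φ : ℝ → ℝ} (hφ : Continuous φ) {C : ℝ}
    (hb : ∀ x, |φ x| ≤ C) (g : ℝ →ᵇ ℝ) : Integrable fun s => φ s * damp η g s := by
  refine Integrable.mono' (((integrable_exp_neg_mul_abs hη).const_mul ‖g‖).const_mul C)
    (hφ.mul (continuous_damp η g)).aestronglyMeasurable (.of_forall fun s => ?_)
  rw [norm_mul]
  exact mul_le_mul (hb s) (abs_damp_le η g s) (norm_nonneg _) ((abs_nonneg _).trans (hb s))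

/-- The pairing with a bounded continuous function as a bounded functional. -/
theorem exists_pairing {η : ℝ} (hη : 0 < η) {φ : ℝ → ℝ} (hφ : Continuous φ) {C : ℝ}
    (hb : ∀ x, |φ x| ≤ C) : ∃ ℓ : (ℝ →ᵇ ℝ) →L[ℝ] ℝ, ∀ g, ℓ g = ∫ s, φ s * damp η g s := by
  have hi := integrable_mul_damp hη hφ hb
  let ℓ₀ : (ℝ →ᵇ ℝ) →ₗ[ℝ] ℝ :=
    { toFun := fun g => ∫ s, φ s * damp η g s
      map_add' := fun g g' => by
        rw [← integral_add (hi g) (hi g')]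
        simp only [damp_add, mul_add]
      map_smul' := fun c g => by
        rw [RingHom.id_apply, smul_eq_mul, ← integral_const_mul]
        congr 1 with s
        rw [damp_smul]
        ring }
  refine ⟨ℓ₀.mkContinuous (C * ∫ s : ℝ, Real.exp (-η * |s|)) fun g => ?_, fun g => rfl⟩
  calc ‖∫ s, φ s * damp η g s‖ ≤ ∫ s : ℝ, C * (‖g‖ * Real.exp (-η * |s|)) := by
        refine norm_integral_le_of_norm_le
          (((integrable_exp_neg_mul_abs hη).const_mul ‖g‖).const_mul C) (.of_forall fun s => ?_)
        rw [norm_mul]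
        exact mul_le_mul (hb s) (abs_damp_le η g s) (norm_nonneg _) ((abs_nonneg _).trans (hb s))
    _ = _ := by rw [integral_const_mul, integral_const_mul]; ring

theorem integral_leStep_mul (F : ℝ → ℝ) (x : ℝ) : ∫ s, leStep x s * F s = ∫ s in Iic x, F s := by
  rw [← integral_indicator measurableSet_Iic]
  congr 1 with s
  by_cases h : s ≤ x
  · rw [leStep_of_le h, indicator_of_mem (mem_Iic.2 h), one_mul]
  · rw [leStep_of_lt (not_le.1 h), indicator_of_notMem (by simpa using h), zero_mul]

theorem integrable_leStep_mul_iff (F : ℝ → ℝ) (x : ℝ) :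
    Integrable (fun s => leStep x s * F s) ↔ IntegrableOn F (Iic x) := by
  rw [← integrable_indicator_iff measurableSet_Iic]
  refine iff_of_eq (congrArg (fun f => Integrable f volume) ?_)
  funext s
  by_cases h : s ≤ x
  · rw [leStep_of_le h, indicator_of_mem (mem_Iic.2 h), one_mul]
  · rw [leStep_of_lt (not_le.1 h), indicator_of_notMem (by simpa using h), zero_mul]

theorem integral_leStep_sub_one_mul (F : ℝ → ℝ) (x : ℝ) :
    ∫ s, (leStep x s - 1) * F s = -∫ s in Ioi x, F s := by
  rw [← integral_indicator measurableSet_Ioi, ← integral_neg]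
  congr 1 with s
  by_cases h : s ≤ x
  · rw [leStep_of_le h, indicator_of_notMem (by simpa using h)]; simp
  · rw [leStep_of_lt (not_le.1 h), indicator_of_mem (mem_Ioi.2 (not_le.1 h))]; simp

theorem integrable_leStep_sub_one_mul_iff (F : ℝ → ℝ) (x : ℝ) :
    Integrable (fun s => (leStep x s - 1) * F s) ↔ IntegrableOn F (Ioi x) := by
  rw [← integrable_indicator_iff measurableSet_Ioi, ← integrable_neg_iff]
  refine iff_of_eq (congrArg (fun f => Integrable f volume) ?_)
  funext s
  by_cases h : s ≤ x
  · rw [indicator_of_notMem (by simpa using h)]; simp [leStep_of_le h]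
  · rw [indicator_of_mem (mem_Ioi.2 (not_le.1 h))]; simp [leStep_of_lt (not_le.1 h)]

theorem eq_integral_leStep_mul {F W : ℝ → ℝ} {x : ℝ} (hW : ∀ a b, W b = W a + ∫ t in a..b, F t)
    (hF : Integrable fun s => leStep x s * F s) (h0 : Tendsto W atBot (𝓝 0)) :
    W x = ∫ s, leStep x s * F s := by
  rw [integral_leStep_mul]
  rw [integrable_leStep_mul_iff] at hF
  have h1 := intervalIntegral_tendsto_integral_Iic x hF tendsto_id
  have h2 := h0.add h1
  rw [zero_add] at h2
  refine tendsto_nhds_unique (tendsto_const_nhds.congr fun a => ?_) h2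
  exact hW a x

theorem eq_integral_leStep_sub_one_mul {F W : ℝ → ℝ} {x : ℝ}
    (hW : ∀ a b, W b = W a + ∫ t in a..b, F t)
    (hF : Integrable fun s => (leStep x s - 1) * F s) (h0 : Tendsto W atTop (𝓝 0)) :
    W x = ∫ s, (leStep x s - 1) * F s := by
  rw [integral_leStep_sub_one_mul]
  rw [integrable_leStep_sub_one_mul_iff] at hF
  have h1 := intervalIntegral_tendsto_integral_Ioi x hF tendsto_id
  have h2 := h0.sub h1
  rw [zero_sub] at h2
  refine tendsto_nhds_unique (tendsto_const_nhds.congr fun a => ?_) h2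
  have := hW x a
  simp only [id]
  linarith

/-- A primitive that vanishes at both ends can be computed from either end, and comparing the two
forces total integral zero. Applied to Wronskians, this is the source of the solvability conditions.
-/
theorem eq_integral_and_integral_eq_zero {F W : ℝ → ℝ} (hF : Integrable F)
    (hW : ∀ a b, W b = W a + ∫ t in a..b, F t) (h0 : Tendsto W atBot (𝓝 0))
    (h1 : Tendsto W atTop (𝓝 0)) : ∫ s, F s = 0 ∧ ∀ x, W x = ∫ s, leStep x s * F s := by
  have h2 : ∀ x, W x = ∫ s, leStep x s * F s := fun x =>
    eq_integral_leStep_mul hW ((integrable_leStep_mul_iff F x).2 hF.integrableOn) h0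
  refine ⟨?_, h2⟩
  have h3 := eq_integral_leStep_sub_one_mul (x := 0) hW
    ((integrable_leStep_sub_one_mul_iff F 0).2 hF.integrableOn) h1
  have h4 := integral_sub ((integrable_leStep_mul_iff F 0).2 hF.integrableOn) hF
  simp only [sub_mul, one_mul] at h3
  rw [h4, ← h2] at h3
  linarith

/-- Replacing the reference `τ` changes the integral by a constant in x only. Every Green formula is
therefore an instance of variation of constants. -/
theorem integral_leStep_mul_eq_add {F : ℝ → ℝ} {τ : ℝ → ℝ}
    (hF : ∀ x, Integrable fun s => (leStep x s - τ s) * F s) (x : ℝ) :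
    ∫ s, (leStep x s - τ s) * F s = (∫ s, (leStep 0 s - τ s) * F s) + ∫ t in (0 : ℝ)..x, F t := by
  rw [← integral_leStep_sub_mul, ← integral_add (hF 0)]
  · congr 1 with s; ring
  · have := (hF x).sub (hF 0)
    refine this.congr (.of_forall fun s => ?_)
    simp only [Pi.sub_apply]
    ring

/-- A continuous function increasing from `0` on `(-∞, 0]` to `1` on `[1, ∞)`. -/
def ramp (x : ℝ) : ℝ := max 0 (min 1 x)

theorem continuous_ramp : Continuous ramp := by unfold ramp; fun_prop

theorem abs_leStep_sub_ramp_le {x : ℝ} (s : ℝ) : |leStep x s - ramp x| ≤ 1 := by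
  have h1 : 0 ≤ ramp x := le_max_left _ _
  have h2 : ramp x ≤ 1 := max_le zero_le_one (min_le_left _ _)
  rw [abs_le]
  rcases le_or_gt s x with h | h
  · rw [leStep_of_le h]; constructor <;> linarith
  · rw [leStep_of_lt h]; constructor <;> linarith

/-- For x ≥ 1 only s > x contributes and for x ≤ 0 only s ≤ x, and there |x| - |s| = -|x - s|. In
the transition zone 0 ≤ x ≤ 1 one has |x| - |s| ≤ 2 - |x - s|, which costs the factor e^{2δ}. -/
theorem abs_leStep_sub_ramp_mul_exp_le {δ : ℝ} (hδ : 0 ≤ δ) (x s : ℝ) :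
    |leStep x s - ramp x| * Real.exp (δ * (|x| - |s|)) ≤
      Real.exp (2 * δ) * Real.exp (-δ * |x - s|) := by
  rw [← Real.exp_add]
  have hle : ∀ {a : ℝ}, δ * (|x| - |s|) ≤ a →
      |leStep x s - ramp x| * Real.exp (δ * (|x| - |s|)) ≤ Real.exp a := fun ha =>
    (mul_le_of_le_one_left (Real.exp_nonneg _) (abs_leStep_sub_ramp_le s)).trans
      (Real.exp_le_exp.2 ha)
  rcases le_total 1 x with h1 | h1
  · have hr : ramp x = 1 := by simp [ramp, h1]
    rcases le_or_gt s x with h | h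
    · rw [hr, leStep_of_le h]; simp [Real.exp_nonneg]
    · refine hle ?_
      rw [abs_of_neg (by linarith : x - s < 0), abs_of_nonneg (by linarith : (0 : ℝ) ≤ x),
        abs_of_nonneg (by linarith : (0 : ℝ) ≤ s)]
      nlinarith
  · rcases le_total x 0 with h0 | h0
    · have hr : ramp x = 0 := by simp [ramp, h0]
      rcases le_or_gt s x with h | h
      · refine hle ?_
        rw [abs_of_nonneg (by linarith : 0 ≤ x - s), abs_of_nonpos h0,
          abs_of_nonpos (by linarith : s ≤ 0)]
        nlinarith
      · rw [hr, leStep_of_lt h]; simp [Real.exp_nonneg]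
    · refine hle ?_
      have := abs_sub x s
      rw [abs_of_nonneg h0] at *
      nlinarith

/-- Coefficients of bounded size paired with decaying functions tend to zero. -/
theorem tendsto_wronskian_zero {l : Filter ℝ} {φ φ' u u' : ℝ → ℝ} {C : ℝ}
    (hφ : ∀ᶠ x in l, |φ x| ≤ C) (hφ' : ∀ᶠ x in l, |φ' x| ≤ C) (hu : Tendsto u l (𝓝 0))
    (hu' : Tendsto u' l (𝓝 0)) : Tendsto (fun x => φ x * u' x - φ' x * u x) l (𝓝 0) := by
  have h1 : Tendsto (fun x => C * |u' x| + C * |u x|) l (𝓝 0) := by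
    simpa using (hu'.abs.const_mul C).add (hu.abs.const_mul C)
  refine squeeze_zero_norm' ?_ h1
  filter_upwards [hφ, hφ'] with x e1 e2
  rw [Real.norm_eq_abs]
  refine (abs_sub _ _).trans ?_
  rw [abs_mul, abs_mul]
  gcongr

/-! ### Green operators in the weighted space. -/

section Green

variable {q φ φ' ψ ψ' : ℝ → ℝ} {η : ℝ}

/-- The Green kernel of the weighted equation built from the two functions `τ₁`, `τ₂`. -/
theorem exists_greenOperator (hφ : Continuous φ) (hψ : Continuous ψ) {τ₁ τ₂ : ℝ → ℝ → ℝ}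
    (hm₁ : ∀ x, Measurable (τ₁ x)) (hm₂ : ∀ x, Measurable (τ₂ x))
    (hc₁ : ∀ s, Continuous fun x => τ₁ x s) (hc₂ : ∀ s, Continuous fun x => τ₂ x s) {C δ : ℝ}
    (hδ : 0 < δ)
    (hb : ∀ x s, |φ x * ((leStep x s - τ₁ x s) * ψ s)| * Real.exp (η * (|x| - |s|)) ≤
      C * Real.exp (-δ * |x - s|))
    (hb' : ∀ x s, |ψ x * ((leStep x s - τ₂ x s) * φ s)| * Real.exp (η * (|x| - |s|)) ≤
      C * Real.exp (-δ * |x - s|)) :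
    ∃ K : (ℝ →ᵇ ℝ) →L[ℝ] (ℝ →ᵇ ℝ), ∀ g x, damp η (K g) x =
      ∫ s, (ψ x * ((leStep x s - τ₂ x s) * (φ s * damp η g s)) -
        φ x * ((leStep x s - τ₁ x s) * (ψ s * damp η g s))) := by
  obtain ⟨K, hK, -⟩ := exists_kernelOperator
    (fun x s => (ψ x * ((leStep x s - τ₂ x s) * φ s) - φ x * ((leStep x s - τ₁ x s) * ψ s)) *
      Real.exp (η * (|x| - |s|))) (2 * C) δ hδ
    (fun x => by
      have := measurable_leStep x
      have := hm₁ x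
      have := hm₂ x
      have := hφ.measurable
      have := hψ.measurable
      exact Measurable.aestronglyMeasurable (by fun_prop))
    (fun x s => by
      rw [abs_mul, Real.abs_exp]
      have h1 := mul_le_mul_of_nonneg_right
        (abs_sub (ψ x * ((leStep x s - τ₂ x s) * φ s)) (φ x * ((leStep x s - τ₁ x s) * ψ s)))
        (Real.exp_nonneg (η * (|x| - |s|)))
      have h2 := hb x s
      have h3 := hb' x s
      linarith)
    (fun x₀ => by
      filter_upwards [ae_continuousAt_leStep x₀] with s hs
      have := hc₁ s
      have := hc₂ s
      fun_prop)
  refine ⟨K, fun g x => ?_⟩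
  rw [damp, hK, ← integral_const_mul]
  congr 1 with s
  have : Real.exp (-η * |s|) = Real.exp (-η * |x|) * Real.exp (η * (|x| - |s|)) := by
    rw [← Real.exp_add]; congr 1; ring
  rw [damp, this]
  ring

theorem exp_weight_le (hη : 0 ≤ η) (x s : ℝ) :
    Real.exp (η * (|x| - |s|)) ≤ Real.exp (η * |x - s|) := by
  refine Real.exp_le_exp.2 (mul_le_mul_of_nonneg_left ?_ hη)
  linarith [abs_sub_abs_le_abs_sub x s]

/-- The references `τ₁`, `τ₂` do not depend on x here, so they only fix the constants in
`IsSol.varConst`. -/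
theorem exists_isSol_of_eq_green (hφ : IsSol q 0 φ φ') (hψ : IsSol q 0 ψ ψ')
    (hW : ∀ x, φ x * ψ' x - φ' x * ψ x = 1) {f y τ₁ τ₂ : ℝ → ℝ} (hf : Continuous f)
    (h₁ : ∀ x, Integrable fun s => (leStep x s - τ₁ s) * (ψ s * f s))
    (h₂ : ∀ x, Integrable fun s => (leStep x s - τ₂ s) * (φ s * f s))
    (hy : ∀ x, y x = ψ x * (∫ s, (leStep x s - τ₂ s) * (φ s * f s)) -
      φ x * ∫ s, (leStep x s - τ₁ s) * (ψ s * f s)) : ∃ y', IsSol q f y y' := by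
  have h := hφ.varConst hψ hW hf (-∫ s, (leStep 0 s - τ₁ s) * (ψ s * f s))
    (∫ s, (leStep 0 s - τ₂ s) * (φ s * f s))
  refine ⟨_, (?_ : (fun x => _) = y) ▸ h⟩
  funext x
  rw [hy, integral_leStep_mul_eq_add h₁ x, integral_leStep_mul_eq_add h₂ x]
  ring

theorem eq_wronskian_combination (hW : ∀ x, φ x * ψ' x - φ' x * ψ x = 1) (u u' : ℝ → ℝ) (x : ℝ) :
    u x = ψ x * (φ x * u' x - φ' x * u x) - φ x * (ψ x * u' x - ψ' x * u x) := by
  linear_combination (-u x) * hW x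

/-- Hyperbolic equations are uniquely solvable in the weighted space. -/
theorem DichotomyPair.exists_inverse {α : ℝ} (P : DichotomyPair q α) (hη : 0 < η) (hα : η < α) :
    ∃ K : (ℝ →ᵇ ℝ) →L[ℝ] (ℝ →ᵇ ℝ),
      (∀ g w y', IsSol q (damp η g) (damp η w) y' → Tendsto y' atTop (𝓝 0) →
        Tendsto y' atBot (𝓝 0) → w = K g) ∧
      ∀ g, ∃ y', IsSol q (damp η g) (damp η (K g)) y' := by
  have hC := P.C_nonneg
  have hφc := P.sol_φ.continuous
  have hψc := P.sol_ψ.continuous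
  have hle : ∀ {x s : ℝ}, s ≤ x → |P.φ x| * |P.ψ s| ≤ P.C ^ 2 * Real.exp (-α * |x - s|) := by
    intro x s h
    have e1 : Real.exp (-α * |x - s|) = Real.exp (-α * x) * Real.exp (α * s) := by
      rw [← Real.exp_add, abs_of_nonneg (by linarith)]; congr 1; ring
    calc |P.φ x| * |P.ψ s| ≤ (P.C * Real.exp (-α * x)) * (P.C * Real.exp (α * s)) :=
          mul_le_mul (P.φ_le x) (P.ψ_le s) (abs_nonneg _) (by positivity)
      _ = _ := by rw [e1]; ring
  have hcomb : ∀ x s : ℝ, Real.exp (-α * |x - s|) * Real.exp (η * (|x| - |s|)) ≤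
      Real.exp (-(α - η) * |x - s|) := fun x s => by
    have e1 : Real.exp (-(α - η) * |x - s|) = Real.exp (-α * |x - s|) * Real.exp (η * |x - s|) := by
      rw [← Real.exp_add]; congr 1; ring
    rw [e1]
    exact mul_le_mul_of_nonneg_left (exp_weight_le hη.le x s) (Real.exp_nonneg _)
  -- The coefficient of the decaying solution is integrated from -∞ and that of the growing one from
  -- +∞. The rate α of the kernel exceeds the weight η, leaving the decay α - η.
  obtain ⟨K, hK⟩ := exists_greenOperator (η := η) hφc hψc (τ₁ := fun _ _ => 0) (τ₂ := fun _ _ => 1)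
    (fun _ => measurable_const) (fun _ => measurable_const) (fun _ => continuous_const)
    (fun _ => continuous_const) (C := P.C ^ 2) (δ := α - η) (by linarith)
    (fun x s => by
      rcases le_or_gt s x with h | h
      · rw [leStep_of_le h, sub_zero, one_mul, abs_mul]
        calc _ ≤ P.C ^ 2 * Real.exp (-α * |x - s|) * Real.exp (η * (|x| - |s|)) := by
              exact mul_le_mul_of_nonneg_right (hle h) (Real.exp_nonneg _)
          _ ≤ _ := by rw [mul_assoc]; gcongr; exact hcomb x s
      · rw [leStep_of_lt h]; simp; positivity)
    (fun x s => by
      rcases le_or_gt s x with h | h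
      · rw [leStep_of_le h]; simp; positivity
      · rw [leStep_of_lt h, zero_sub, neg_one_mul, mul_neg, abs_neg, abs_mul, mul_comm |P.ψ x|]
        calc _ ≤ P.C ^ 2 * Real.exp (-α * |x - s|) * Real.exp (η * (|x| - |s|)) := by
              refine mul_le_mul_of_nonneg_right ?_ (Real.exp_nonneg _)
              rw [abs_sub_comm]
              exact hle h.le
          _ ≤ _ := by rw [mul_assoc]; gcongr; exact hcomb x s)
  have hi₁ : ∀ g x, Integrable fun s => (leStep x s - 0) * (P.ψ s * damp η g s) := fun g x => by
    have hd := continuous_damp η g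
    have hmeas := measurable_leStep x
    refine Integrable.mono' (((integrable_exp_neg_mul_abs (δ := α) (by linarith)).comp_sub_left
      x).const_mul (P.C * Real.exp (α * x) * ‖g‖)) (Measurable.aestronglyMeasurable (by fun_prop))
      (.of_forall fun s => ?_)
    rcases le_or_gt s x with h | h
    · rw [leStep_of_le h, sub_zero, one_mul, norm_mul, Real.norm_eq_abs, Real.norm_eq_abs]
      have e1 : Real.exp (α * x) * Real.exp (-α * |x - s|) = Real.exp (α * s) := by
        rw [← Real.exp_add, abs_of_nonneg (by linarith)]; congr 1; ring
      have e2 : |damp η g s| ≤ ‖g‖ := (abs_damp_le η g s).trans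
        (mul_le_of_le_one_right (norm_nonneg _) (Real.exp_le_one_iff.2 (by nlinarith [abs_nonneg s])))
      calc |P.ψ s| * |damp η g s| ≤ (P.C * Real.exp (α * s)) * ‖g‖ :=
            mul_le_mul (P.ψ_le s) e2 (abs_nonneg _) (by positivity)
        _ = _ := by rw [← e1]; ring
    · rw [leStep_of_lt h]; simp; positivity
  have hi₂ : ∀ g x, Integrable fun s => (leStep x s - 1) * (P.φ s * damp η g s) := fun g x => by
    have hd := continuous_damp η g
    have hmeas := measurable_leStep x
    refine Integrable.mono' (((integrable_exp_neg_mul_abs (δ := α) (by linarith)).comp_sub_left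
      x).const_mul (P.C * Real.exp (-α * x) * ‖g‖)) (Measurable.aestronglyMeasurable (by fun_prop))
      (.of_forall fun s => ?_)
    rcases le_or_gt s x with h | h
    · rw [leStep_of_le h]; simp; positivity
    · rw [leStep_of_lt h, zero_sub, neg_one_mul, norm_neg, norm_mul, Real.norm_eq_abs,
        Real.norm_eq_abs]
      have e1 : Real.exp (-α * x) * Real.exp (-α * |x - s|) = Real.exp (-α * s) := by
        rw [← Real.exp_add, abs_of_neg (by linarith)]; congr 1; ring
      have e2 : |damp η g s| ≤ ‖g‖ := (abs_damp_le η g s).trans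
        (mul_le_of_le_one_right (norm_nonneg _) (Real.exp_le_one_iff.2 (by nlinarith [abs_nonneg s])))
      calc |P.φ s| * |damp η g s| ≤ (P.C * Real.exp (-α * s)) * ‖g‖ :=
            mul_le_mul (P.φ_le s) e2 (abs_nonneg _) (by positivity)
        _ = _ := by rw [← e1]; ring
  have hKs : ∀ g x, damp η (K g) x = P.ψ x * (∫ s, (leStep x s - 1) * (P.φ s * damp η g s)) -
      P.φ x * ∫ s, (leStep x s - 0) * (P.ψ s * damp η g s) := fun g x => by
    rw [hK, integral_sub ((hi₂ g x).const_mul _) ((hi₁ g x).const_mul _), integral_const_mul,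
      integral_const_mul]
  refine ⟨K, fun g w y' hy h0 h1 => eq_of_damp_eq (η := η) fun x => ?_, fun g => ?_⟩
  · have hd := continuous_damp η g
    obtain ⟨hw0, hw1⟩ := tendsto_damp hη w
    rw [hKs, eq_wronskian_combination P.wronskian (damp η w) y' x]
    congr 2
    · refine eq_integral_leStep_sub_one_mul (W := fun x => P.φ x * y' x - P.φ' x * damp η w x)
        (fun a b => P.sol_φ.wronskian_sub hy hd a b) (hi₂ g x)
        (tendsto_wronskian_zero (C := P.C) ?_ ?_ hw0 h0)
      · filter_upwards [eventually_ge_atTop 0] with x hx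
        exact (P.φ_le x).trans (mul_le_of_le_one_right hC (Real.exp_le_one_iff.2 (by nlinarith)))
      · filter_upwards [eventually_ge_atTop 0] with x hx
        exact (P.φ'_le x).trans (mul_le_of_le_one_right hC (Real.exp_le_one_iff.2 (by nlinarith)))
    · have := hi₁ g x
      simp only [sub_zero] at this ⊢
      refine eq_integral_leStep_mul (W := fun x => P.ψ x * y' x - P.ψ' x * damp η w x)
        (fun a b => P.sol_ψ.wronskian_sub hy hd a b) this
        (tendsto_wronskian_zero (C := P.C) ?_ ?_ hw1 h1)
      · filter_upwards [eventually_le_atBot 0] with x hx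
        exact (P.ψ_le x).trans (mul_le_of_le_one_right hC (Real.exp_le_one_iff.2 (by nlinarith)))
      · filter_upwards [eventually_le_atBot 0] with x hx
        exact (P.ψ'_le x).trans (mul_le_of_le_one_right hC (Real.exp_le_one_iff.2 (by nlinarith)))
  · exact exists_isSol_of_eq_green P.sol_φ P.sol_ψ P.wronskian (τ₁ := fun _ => 0)
      (τ₂ := fun _ => 1) (continuous_damp η g) (hi₁ g) (hi₂ g) (hKs g)

/-- Elliptic equations are solvable in the weighted space under two orthogonality conditions. -/
theorem DichotomyPair.exists_partial_inverse (P : DichotomyPair q 0) (hη : 0 < η) :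
    ∃ K : (ℝ →ᵇ ℝ) →L[ℝ] (ℝ →ᵇ ℝ),
      (∀ g w y', IsSol q (damp η g) (damp η w) y' → Tendsto y' atTop (𝓝 0) →
        Tendsto y' atBot (𝓝 0) → w = K g ∧ ∫ s, P.φ s * damp η g s = 0 ∧
          ∫ s, P.ψ s * damp η g s = 0) ∧
      ∀ g, ∫ s, P.φ s * damp η g s = 0 → ∫ s, P.ψ s * damp η g s = 0 →
        ∃ y', IsSol q (damp η g) (damp η (K g)) y' := by
  have hC := P.C_nonneg
  have hφc := P.sol_φ.continuous
  have hψc := P.sol_ψ.continuous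
  have b1 : ∀ x, |P.φ x| ≤ P.C := fun x => by simpa using P.φ_le x
  have b2 : ∀ x, |P.φ' x| ≤ P.C := fun x => by simpa using P.φ'_le x
  have b3 : ∀ x, |P.ψ x| ≤ P.C := fun x => by simpa using P.ψ_le x
  have b4 : ∀ x, |P.ψ' x| ≤ P.C := fun x => by simpa using P.ψ'_le x
  have hk : ∀ {y z : ℝ → ℝ}, (∀ x, |y x| ≤ P.C) → (∀ x, |z x| ≤ P.C) → ∀ x s,
      |y x * ((leStep x s - ramp x) * z s)| * Real.exp (η * (|x| - |s|)) ≤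
      P.C ^ 2 * Real.exp (2 * η) * Real.exp (-η * |x - s|) := by
    intro y z hy hz x s
    rw [abs_mul, abs_mul]
    calc _ = (|y x| * |z s|) * (|leStep x s - ramp x| * Real.exp (η * (|x| - |s|))) := by ring
      _ ≤ (P.C * P.C) * (Real.exp (2 * η) * Real.exp (-η * |x - s|)) :=
        mul_le_mul (mul_le_mul (hy x) (hz s) (abs_nonneg _) hC)
          (abs_leStep_sub_ramp_mul_exp_le hη.le x s) (by positivity) (by positivity)
      _ = _ := by ring
  -- Decay of the result requires integrating from the nearer end: from -∞ for x ≤ 0 and from +∞ for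
  -- x ≥ 1. The ramp interpolates continuously, so the operator is bounded for every g; when the
  -- moments vanish the ramp has no effect.
  obtain ⟨K, hK⟩ := exists_greenOperator (η := η) hφc hψc (τ₁ := fun x _ => ramp x)
    (τ₂ := fun x _ => ramp x) (fun _ => measurable_const) (fun _ => measurable_const)
    (fun _ => continuous_ramp) (fun _ => continuous_ramp) hη (hk b1 b3) (hk b3 b1)
  have hi : ∀ {z : ℝ → ℝ}, Continuous z → (∀ x, |z x| ≤ P.C) → ∀ g x,
      Integrable fun s => leStep x s * (z s * damp η g s) := fun hz hb g x =>
    (integrable_leStep_mul_iff _ x).2 (integrable_mul_damp hη hz hb g).integrableOn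
  have hir : ∀ {z : ℝ → ℝ}, Continuous z → (∀ x, |z x| ≤ P.C) → ∀ g x,
      Integrable fun s => (leStep x s - ramp x) * (z s * damp η g s) := fun hz hb g x => by
    simpa only [sub_mul] using! (hi hz hb g x).sub ((integrable_mul_damp hη hz hb g).const_mul _)
  have hz0 : ∀ {z : ℝ → ℝ}, Continuous z → (∀ x, |z x| ≤ P.C) → ∀ g x,
      ∫ s, z s * damp η g s = 0 → ∫ s, (leStep x s - ramp x) * (z s * damp η g s) =
        ∫ s, leStep x s * (z s * damp η g s) := fun hz hb g x h0 => by
    simp only [sub_mul]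
    rw [integral_sub (hi hz hb g x) ((integrable_mul_damp hη hz hb g).const_mul _),
      integral_const_mul, h0, mul_zero, sub_zero]
  have hKs : ∀ g, ∫ s, P.φ s * damp η g s = 0 → ∫ s, P.ψ s * damp η g s = 0 → ∀ x,
      damp η (K g) x = P.ψ x * (∫ s, leStep x s * (P.φ s * damp η g s)) -
      P.φ x * ∫ s, leStep x s * (P.ψ s * damp η g s) := fun g h1 h2 x => by
    rw [hK, integral_sub ((hir hφc b1 g x).const_mul _) ((hir hψc b3 g x).const_mul _),
      integral_const_mul, integral_const_mul, hz0 hφc b1 g x h1, hz0 hψc b3 g x h2]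
  refine ⟨K, fun g w y' hy h0 h1 => ?_, fun g h1 h2 => ?_⟩
  · have hd := continuous_damp η g
    obtain ⟨hw0, hw1⟩ := tendsto_damp hη w
    obtain ⟨e1, e2⟩ := eq_integral_and_integral_eq_zero (integrable_mul_damp hη hφc b1 g)
      (W := fun x => P.φ x * y' x - P.φ' x * damp η w x)
      (fun a b => P.sol_φ.wronskian_sub hy hd a b)
      (tendsto_wronskian_zero (.of_forall b1) (.of_forall b2) hw1 h1)
      (tendsto_wronskian_zero (.of_forall b1) (.of_forall b2) hw0 h0)
    obtain ⟨e3, e4⟩ := eq_integral_and_integral_eq_zero (integrable_mul_damp hη hψc b3 g)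
      (W := fun x => P.ψ x * y' x - P.ψ' x * damp η w x)
      (fun a b => P.sol_ψ.wronskian_sub hy hd a b)
      (tendsto_wronskian_zero (.of_forall b3) (.of_forall b4) hw1 h1)
      (tendsto_wronskian_zero (.of_forall b3) (.of_forall b4) hw0 h0)
    refine ⟨eq_of_damp_eq (η := η) fun x => ?_, e1, e3⟩
    rw [hKs g e1 e3, ← e2, ← e4]
    exact eq_wronskian_combination P.wronskian (damp η w) y' x
  · exact exists_isSol_of_eq_green P.sol_φ P.sol_ψ P.wronskian (τ₁ := fun _ => 0)
      (τ₂ := fun _ => 0) (continuous_damp η g) (by simpa using hi hψc b3 g)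
      (by simpa using hi hφc b1 g) (by simpa using hKs g h1 h2)

/-- An equation with a decaying homogeneous solution is solvable in the weighted space under one
orthogonality condition, uniquely up to multiples of that solution. -/
theorem exists_resonant_inverse {φ' ψ' : ℝ → ℝ} (hφ : IsSol q 0 φ φ') (hψ : IsSol q 0 ψ ψ')
    (hW : ∀ x, φ x * ψ' x - φ' x * ψ x = 1) {α C : ℝ} (hη : 0 < η) (hα : η < α)
    (b1 : ∀ x, |φ x| ≤ C * Real.exp (-α * |x|)) (b2 : ∀ x, |φ' x| ≤ C * Real.exp (-α * |x|))
    (b3 : ∀ x, |ψ x| ≤ C * Real.exp (α * |x|)) (w₀ : ℝ →ᵇ ℝ) (hw₀ : ∀ x, damp η w₀ x = φ x) :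
    ∃ K : (ℝ →ᵇ ℝ) →L[ℝ] (ℝ →ᵇ ℝ),
      (∀ g w y', IsSol q (damp η g) (damp η w) y' → Tendsto y' atTop (𝓝 0) →
        Tendsto y' atBot (𝓝 0) → (∃ c : ℝ, w = c • w₀ + K g) ∧ ∫ s, φ s * damp η g s = 0) ∧
      ∀ g, ∫ s, φ s * damp η g s = 0 → ∀ c : ℝ,
        ∃ y', IsSol q (damp η g) (damp η (c • w₀ + K g)) y' := by
  have hC : 0 ≤ C := by simpa using (abs_nonneg _).trans (b1 0)
  have hφc := hφ.continuous
  have hψc := hψ.continuous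
  have hle1 : ∀ x, C * Real.exp (-α * |x|) ≤ C := fun x =>
    mul_le_of_le_one_right hC (Real.exp_le_one_iff.2 (by nlinarith [abs_nonneg x]))
  have c1 : ∀ x, |φ x| ≤ C := fun x => (b1 x).trans (hle1 x)
  have c2 : ∀ x, |φ' x| ≤ C := fun x => (b2 x).trans (hle1 x)
  have hexp : ∀ x s : ℝ, Real.exp (-α * |x|) * Real.exp (α * |s|) = Real.exp (-α * (|x| - |s|)) :=
    fun x s => by rw [← Real.exp_add]; congr 1; ring
  -- The coefficient of the decaying φ is integrated from 0, which is harmless because it is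
  -- multiplied by φ. The coefficient of ψ, which may grow at both ends, must vanish at both, hence
  -- the ramp and the single condition on the moment with φ.
  obtain ⟨K, hK⟩ := exists_greenOperator (η := η) hφc hψc (τ₁ := fun _ s => leStep 0 s)
    (τ₂ := fun x _ => ramp x) (C := C ^ 2 * Real.exp (2 * (α + η))) (δ := α - η)
    (fun _ => measurable_leStep 0) (fun _ => measurable_const)
    (fun _ => continuous_const) (fun _ => continuous_ramp) (by linarith)
    (fun x s => by
      rw [abs_mul, abs_mul]
      calc _ = (|φ x| * |ψ s|) * (|leStep x s - leStep 0 s| * Real.exp (η * (|x| - |s|))) := by ring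
        _ ≤ ((C * Real.exp (-α * |x|)) * (C * Real.exp (α * |s|))) *
            (|leStep x s - leStep 0 s| * Real.exp (η * (|x| - |s|))) :=
          mul_le_mul_of_nonneg_right (mul_le_mul (b1 x) (b3 s) (abs_nonneg _) (by positivity))
            (by positivity)
        _ = C ^ 2 * (|leStep x s - leStep 0 s| * Real.exp (-(α - η) * (|x| - |s|))) := by
          have : Real.exp (-(α - η) * (|x| - |s|)) =
            Real.exp (-α * |x|) * Real.exp (α * |s|) * Real.exp (η * (|x| - |s|)) := by
            rw [hexp, ← Real.exp_add]; congr 1; ring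
          rw [this]; ring
        _ ≤ C ^ 2 * Real.exp (-(α - η) * |x - s|) :=
          mul_le_mul_of_nonneg_left (abs_leStep_sub_mul_exp_le _ x s) (by positivity)
        _ ≤ _ := by
          gcongr
          exact le_mul_of_one_le_right (by positivity) (Real.one_le_exp (by linarith)))
    (fun x s => by
      rw [abs_mul, abs_mul]
      calc _ = (|ψ x| * |φ s|) * (|leStep x s - ramp x| * Real.exp (η * (|x| - |s|))) := by ring
        _ ≤ ((C * Real.exp (α * |x|)) * (C * Real.exp (-α * |s|))) *
            (|leStep x s - ramp x| * Real.exp (η * (|x| - |s|))) :=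
          mul_le_mul_of_nonneg_right (mul_le_mul (b3 x) (b1 s) (abs_nonneg _) (by positivity))
            (by positivity)
        _ = C ^ 2 * (|leStep x s - ramp x| * Real.exp ((α + η) * (|x| - |s|))) := by
          have : Real.exp ((α + η) * (|x| - |s|)) =
            Real.exp (α * |x|) * Real.exp (-α * |s|) * Real.exp (η * (|x| - |s|)) := by
            rw [← Real.exp_add, ← Real.exp_add]; congr 1; ring
          rw [this]; ring
        _ ≤ C ^ 2 * (Real.exp (2 * (α + η)) * Real.exp (-(α + η) * |x - s|)) :=
          mul_le_mul_of_nonneg_left (abs_leStep_sub_ramp_mul_exp_le (by linarith) x s)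
            (by positivity)
        _ ≤ _ := by
          rw [mul_assoc]
          gcongr
          linarith)
  have hi₁ : ∀ g x, Integrable fun s => (leStep x s - leStep 0 s) * (ψ s * damp η g s) :=
      fun g x => by
    have hd := continuous_damp η g
    have hmeas := measurable_leStep x
    have hmeas0 := measurable_leStep 0
    refine Integrable.mono' (((integrable_exp_neg_mul_abs (δ := α) (by linarith)).comp_sub_left
      x).const_mul (C * Real.exp (α * |x|) * ‖g‖)) (Measurable.aestronglyMeasurable (by fun_prop))
      (.of_forall fun s => ?_)
    rw [norm_mul, norm_mul]
    simp only [Real.norm_eq_abs]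
    have e2 : |damp η g s| ≤ ‖g‖ := (abs_damp_le η g s).trans
      (mul_le_of_le_one_right (norm_nonneg _) (Real.exp_le_one_iff.2 (by nlinarith [abs_nonneg s])))
    have e3 := abs_leStep_sub_mul_exp_le α x s
    calc _ ≤ |leStep x s - leStep 0 s| * ((C * Real.exp (α * |s|)) * ‖g‖) :=
          mul_le_mul_of_nonneg_left (mul_le_mul (b3 s) e2 (abs_nonneg _) (by positivity))
            (abs_nonneg _)
      _ = C * Real.exp (α * |x|) * ‖g‖ *
          (|leStep x s - leStep 0 s| * Real.exp (-α * (|x| - |s|))) := by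
        have : Real.exp (α * |s|) = Real.exp (α * |x|) * Real.exp (-α * (|x| - |s|)) := by
          rw [← Real.exp_add]; congr 1; ring
        rw [this]; ring
      _ ≤ _ := mul_le_mul_of_nonneg_left e3 (by positivity)
  have hi := integrable_mul_damp hη hφc c1
  have hi₂ : ∀ g x, Integrable fun s => leStep x s * (φ s * damp η g s) := fun g x =>
    (integrable_leStep_mul_iff _ x).2 (hi g).integrableOn
  have hKs : ∀ g, ∫ s, φ s * damp η g s = 0 → ∀ x,
      damp η (K g) x = ψ x * (∫ s, leStep x s * (φ s * damp η g s)) -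
      φ x * ∫ s, (leStep x s - leStep 0 s) * (ψ s * damp η g s) := fun g h0 x => by
    have h1 : Integrable fun s => (leStep x s - ramp x) * (φ s * damp η g s) := by
      simpa only [sub_mul] using! (hi₂ g x).sub ((hi g).const_mul _)
    rw [hK, integral_sub (h1.const_mul _) ((hi₁ g x).const_mul _),
      integral_const_mul, integral_const_mul]
    congr 2
    simp only [sub_mul]
    rw [integral_sub (hi₂ g x) ((hi g).const_mul _), integral_const_mul, h0, mul_zero, sub_zero]
  refine ⟨K, fun g w y' hy h0 h1 => ?_, fun g h1 c => ?_⟩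
  · have hd := continuous_damp η g
    obtain ⟨hw0, hw1⟩ := tendsto_damp hη w
    obtain ⟨e1, e2⟩ := eq_integral_and_integral_eq_zero (hi g)
      (W := fun x => φ x * y' x - φ' x * damp η w x)
      (fun a b => hφ.wronskian_sub hy hd a b)
      (tendsto_wronskian_zero (.of_forall c1) (.of_forall c2) hw1 h1)
      (tendsto_wronskian_zero (.of_forall c1) (.of_forall c2) hw0 h0)
    -- The free constant is the coordinate of the solution along φ at 0, the point where the
    -- normalization starts its integral.
    refine ⟨⟨-(ψ 0 * y' 0 - ψ' 0 * damp η w 0), eq_of_damp_eq (η := η) fun x => ?_⟩, e1⟩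
    rw [damp_add, damp_smul, hw₀, hKs g e1, ← e2, integral_leStep_sub_mul]
    have e3 := hψ.wronskian_sub hy hd 0 x
    have e4 := eq_wronskian_combination hW (damp η w) y' x
    linear_combination e4 - φ x * e3
  · obtain ⟨y', hy'⟩ := exists_isSol_of_eq_green hφ hψ hW (τ₁ := leStep 0)
      (τ₂ := fun _ => 0) (continuous_damp η g) (hi₁ g)
      (by simpa using hi₂ g) (by simpa using hKs g h1)
    have h := (hφ.const_mul c).add hy'
    refine ⟨fun x => c * φ' x + y' x, ?_⟩
    convert h using 1
    · funext x; simp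
    · funext x; rw [damp_add, damp_smul, hw₀]

end Green

/-! ### Properties that a periodic limit inherits. -/

section PeriodicLimit

variable {a b : ℝ → ℝ} {p : ℝ}

theorem tendsto_add_natCast_mul (hp : 0 < p) (x : ℝ) :
    Tendsto (fun m : ℕ => x + m * p) atTop atTop :=
  tendsto_atTop_add_const_left _ _ (tendsto_natCast_atTop_atTop.atTop_mul_const hp)

theorem periodic_eq_zero (hp : 0 < p) (hb : ∀ x, b (x + p) = b x) (h0 : Tendsto b atTop (𝓝 0))
    (x : ℝ) : b x = 0 := by
  have h1 : ∀ m : ℕ, b (x + m * p) = b x := fun m => (show Function.Periodic b p from hb).nat_mul m x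
  refine tendsto_nhds_unique tendsto_const_nhds
    ((h0.comp (tendsto_add_natCast_mul hp x)).congr fun m => h1 m)

/-- A periodic function that is asymptotic to a continuous function is continuous. -/
theorem continuous_of_periodic (hp : 0 < p) (ha : Continuous a) (hb : ∀ x, b (x + p) = b x)
    (h0 : Tendsto (fun x => a x - b x) atTop (𝓝 0)) : Continuous b := by
  have h1 : ∀ (m : ℕ) x, b (x + m * p) = b x := fun m => (show Function.Periodic b p from hb).nat_mul m
  -- Near x, b is approximated uniformly by the translates of the continuous function a by large
  -- multiples of the period.
  refine continuous_of_locally_uniform_approx_of_continuousAt fun x u hu => ?_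
  obtain ⟨ε, hε, hεu⟩ := Metric.mem_uniformity_dist.1 hu
  obtain ⟨N, hN⟩ := (Metric.tendsto_atTop.1 h0) ε hε
  obtain ⟨m, hm⟩ := ((tendsto_add_natCast_mul hp (x - 1)).eventually_ge_atTop N).exists
  refine ⟨Metric.ball x 1, Metric.ball_mem_nhds x one_pos, fun y => a (y + m * p),
    (ha.comp (by fun_prop)).continuousAt, fun y hy => hεu ?_⟩
  rw [Metric.mem_ball, Real.dist_eq] at hy
  have h2 := hN (y + m * p) (by linarith [(abs_lt.1 hy).1])
  rw [Real.dist_eq, sub_zero, h1] at h2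
  rwa [Real.dist_eq, abs_sub_comm]

theorem exists_bound_of_periodic (hp : 0 < p) (hbc : Continuous b) (hb : ∀ x, b (x + p) = b x) :
    ∃ M, ∀ x, |b x| ≤ M := by
  obtain ⟨M, hM⟩ := (Function.Periodic.compact_of_continuous (show Function.Periodic b p from hb)
    hp.ne' hbc).isBounded.exists_norm_le
  exact ⟨M, fun x => hM _ ⟨x, rfl⟩⟩

end PeriodicLimit

/-! ### Unimodular eigenvalues of the monodromy matrix. -/

section UnimodularRoots

open Polynomial

/-- The number of unimodular roots of `X² - t X + 1` for real `t`. -/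
theorem card_unimodular_roots_quadratic (t : ℝ) :
    Multiset.card ((X ^ 2 - C (t : ℂ) * X + 1 : ℂ[X]).roots.filter fun z => ‖z‖ = 1) =
      if |t| ≤ 2 then 2 else 0 := by
  have key : ∀ z w : ℂ, z + w = t → z * w = 1 →
      (X ^ 2 - C (t : ℂ) * X + 1 : ℂ[X]).roots = {z, w} := by
    intro z w h1 h2
    have h3 : (X ^ 2 - C (t : ℂ) * X + 1 : ℂ[X]) = (X - C z) * (X - C w) := by
      have e1 : C (t : ℂ) = C z + C w := by rw [← h1, C_add]
      have e2 : (1 : ℂ[X]) = C z * C w := by rw [← C_mul, h2, C_1]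
      rw [e1]
      linear_combination e2
    rw [h3, roots_mul (mul_ne_zero (X_sub_C_ne_zero z) (X_sub_C_ne_zero w)), roots_X_sub_C,
      roots_X_sub_C]
    rfl
  split_ifs with h
  · have h4 : 0 ≤ 1 - t ^ 2 / 4 := by
      have := sq_le_sq' (abs_le.1 h).1 (abs_le.1 h).2
      linarith
    let z : ℂ := ⟨t / 2, √(1 - t ^ 2 / 4)⟩
    have hz : Complex.normSq z = 1 := by
      rw [Complex.normSq_apply]
      change t / 2 * (t / 2) + √(1 - t ^ 2 / 4) * √(1 - t ^ 2 / 4) = 1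
      rw [Real.mul_self_sqrt h4]
      ring
    have hz1 : ‖z‖ = 1 := by rw [Complex.norm_def, hz, Real.sqrt_one]
    have hw1 : ‖(starRingEnd ℂ) z‖ = 1 := by rw [RCLike.norm_conj, hz1]
    rw [key z ((starRingEnd ℂ) z) (by rw [Complex.add_conj]; push_cast [z]; ring)
      (by rw [Complex.mul_conj, hz, Complex.ofReal_one])]
    rw [Multiset.filter_eq_self.2]
    · rfl
    · intro y hy
      simp only [Multiset.insert_eq_cons, Multiset.mem_cons, Multiset.mem_singleton] at hy
      rcases hy with rfl | rfl
      · exact hz1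
      · exact hw1
  · obtain ⟨z, hz⟩ := IsAlgClosed.exists_root (X ^ 2 - C (t : ℂ) * X + 1 : ℂ[X]) (by
      have : (X ^ 2 - C (t : ℂ) * X + 1 : ℂ[X]).degree = 2 := by compute_degree!
      rw [this]; norm_num)
    have hz' : z ^ 2 - t * z + 1 = 0 := by simpa [IsRoot] using hz
    have hzw : z * (t - z) = 1 := by linear_combination -hz'
    have hn := congrArg norm hzw
    rw [norm_mul, norm_one] at hn
    -- The roots have product 1, so if one were unimodular then both would be, and their sum t would
    -- satisfy |t| ≤ 2.
    have hne : ‖z‖ ≠ 1 ∧ ‖(t : ℂ) - z‖ ≠ 1 := by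
      have h5 : ¬ (‖z‖ = 1 ∧ ‖(t : ℂ) - z‖ = 1) := fun ⟨h1, h2⟩ => h (by
        have := norm_add_le z (t - z)
        rw [h1, h2, add_sub_cancel, Complex.norm_real, Real.norm_eq_abs] at this
        linarith)
      constructor
      · intro h1
        exact h5 ⟨h1, by simpa [h1] using hn⟩
      · intro h1
        exact h5 ⟨by simpa [h1] using hn, h1⟩
    rw [key z (t - z) (by ring) hzw, Multiset.filter_eq_nil.2]
    · rfl
    · intro y hy
      simp only [Multiset.insert_eq_cons, Multiset.mem_cons, Multiset.mem_singleton] at hy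
      rcases hy with rfl | rfl
      · exact hne.1
      · exact hne.2

variable {κ : Type*} [Fintype κ] [DecidableEq κ]

/-- Grouping the two basis vectors with the same index k makes the matrix block diagonal with 2 × 2
blocks. -/
theorem charpoly_fromBlocks_diagonal {R : Type*} [CommRing R] (a b c d : κ → R) :
    (Matrix.fromBlocks (Matrix.diagonal a) (Matrix.diagonal b) (Matrix.diagonal c)
      (Matrix.diagonal d)).charpoly =
      ∏ k, (X ^ 2 - C (a k + d k) * X + C (a k * d k - c k * b k)) := by
  let e : Fin 2 × κ ≃ κ ⊕ κ :=
    { toFun := fun q => if q.1 = 0 then Sum.inl q.2 else Sum.inr q.2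
      invFun := Sum.elim (fun k => (0, k)) (fun k => (1, k))
      left_inv := by rintro ⟨i, k⟩; fin_cases i <;> simp
      right_inv := by rintro (k | k) <;> simp }
  rw [Matrix.charpoly, ← Matrix.det_submatrix_equiv_self e]
  have h : (Matrix.charmatrix (Matrix.fromBlocks (Matrix.diagonal a) (Matrix.diagonal b)
      (Matrix.diagonal c) (Matrix.diagonal d))).submatrix e e =
      Matrix.blockDiagonal fun k => !![X - C (a k), -C (b k); -C (c k), X - C (d k)] := by
    ext ⟨i, k⟩ ⟨i', k'⟩ : 2
    rw [Matrix.submatrix_apply, Matrix.charmatrix_apply, Matrix.blockDiagonal_apply]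
    by_cases hk : k = k'
    · subst hk
      fin_cases i <;> fin_cases i' <;> simp [e]
    · fin_cases i <;> fin_cases i' <;> simp [e, hk]
  rw [h, Matrix.det_blockDiagonal]
  refine Finset.prod_congr rfl fun k _ => ?_
  rw [Matrix.det_fin_two_of]
  simp only [C_add, C_sub, C_mul]
  ring

/-- Each 2 × 2 block has determinant 1 and contributes two roots or none, according to the size of
its trace. This is why the count is even. -/
theorem unimodularCount_fromBlocks_diagonal (a b c d : κ → ℝ)
    (h : ∀ k, a k * d k - c k * b k = 1) :
    unimodularCount (Matrix.fromBlocks (Matrix.diagonal a) (Matrix.diagonal b) (Matrix.diagonal c)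
      (Matrix.diagonal d)) = 2 * Fintype.card {k // |a k + d k| ≤ 2} := by
  classical
  rw [unimodularCount]
  have h1 : (Matrix.fromBlocks (Matrix.diagonal a) (Matrix.diagonal b) (Matrix.diagonal c)
      (Matrix.diagonal d)).map (fun r : ℝ => (r : ℂ)) =
      Matrix.fromBlocks (Matrix.diagonal fun k => (a k : ℂ)) (Matrix.diagonal fun k => (b k : ℂ))
        (Matrix.diagonal fun k => (c k : ℂ)) (Matrix.diagonal fun k => (d k : ℂ)) := by
    rw [Matrix.fromBlocks_map]
    simp only [Matrix.diagonal_map Complex.ofReal_zero]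
  have h2 : ∀ k, (X ^ 2 - C ((a k : ℂ) + d k) * X + C ((a k : ℂ) * d k - c k * b k) : ℂ[X]) =
      X ^ 2 - C ((a k + d k : ℝ) : ℂ) * X + 1 := fun k => by
    have : (a k : ℂ) * d k - c k * b k = 1 := by exact_mod_cast congrArg (fun r : ℝ => (r : ℂ)) (h k)
    rw [this, C_1]
    push_cast
    rfl
  have h3 : ∀ t : ℂ, (X ^ 2 - C t * X + 1 : ℂ[X]) ≠ 0 := fun t h0 => by
    have : (X ^ 2 - C t * X + 1 : ℂ[X]).degree = 2 := by compute_degree!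
    rw [h0] at this
    simp at this
  rw [h1, charpoly_fromBlocks_diagonal]
  simp only [h2]
  rw [roots_prod _ _ (Finset.prod_ne_zero_iff.2 fun k _ => h3 _), Multiset.filter_bind,
    Multiset.card_bind]
  simp only [Function.comp_def, card_unimodular_roots_quadratic]
  rw [Fintype.card_subtype, Finset.card_filter, Finset.mul_sum]
  change ∑ k, _ = _
  refine Finset.sum_congr rfl fun k _ => ?_
  split_ifs <;> rfl

/-- A semisimple unimodular double eigenvalue of one of the `2 × 2` blocks forces this block to be
scalar. -/
theorem UnimodularSemisimple.eq_scalar {a b c d : κ → ℝ}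
    (hss : UnimodularSemisimple (Matrix.fromBlocks (Matrix.diagonal a) (Matrix.diagonal b)
      (Matrix.diagonal c) (Matrix.diagonal d)))
    {k : κ} (h : a k * d k - c k * b k = 1) {σ : ℝ} (hσ : |σ| = 1) (ht : a k + d k = 2 * σ) :
    a k = σ ∧ b k = 0 ∧ c k = 0 ∧ d k = σ := by
  have hσ2 : σ ^ 2 = 1 := by rw [← sq_abs, hσ, one_pow]
  have hs := hss (σ : ℂ) (by rw [Complex.norm_real, Real.norm_eq_abs, hσ])
  set T := Matrix.toLin' ((Matrix.fromBlocks (Matrix.diagonal a) (Matrix.diagonal b)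
    (Matrix.diagonal c) (Matrix.diagonal d)).map (fun r : ℝ => (r : ℂ))) with hT
  let e : κ ⊕ κ → ℂ := Pi.single (Sum.inl k) 1
  let f : κ ⊕ κ → ℂ := Pi.single (Sum.inr k) 1
  have he : T e = (a k : ℂ) • e + (c k : ℂ) • f := by
    rw [hT, Matrix.toLin'_apply, Matrix.mulVec_single_one]
    ext (i | i) <;>
    · by_cases hi : i = k
      · subst hi; simp [e, f]
      · simp [e, f, hi]
  have hf : T f = (b k : ℂ) • e + (d k : ℂ) • f := by
    rw [hT, Matrix.toLin'_apply, Matrix.mulVec_single_one]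
    ext (i | i) <;>
    · by_cases hi : i = k
      · subst hi; simp [e, f]
      · simp [e, f, hi]
  have hd : (d k : ℂ) = 2 * σ - a k := by
    rw [eq_sub_iff_add_eq, add_comm]; exact_mod_cast ht
  have hdet : (a k : ℂ) * d k - c k * b k = 1 := by exact_mod_cast h
  have hσc : (σ : ℂ) ^ 2 = 1 := by exact_mod_cast hσ2
  -- Trace 2σ and determinant 1 give (T - σ)² = 0 on the plane of `e` and `f`, by Cayley-Hamilton.
  -- Semisimplicity then makes T equal to σ there.
  have hgen : ∀ v : κ ⊕ κ → ℂ, (T - algebraMap ℂ _ (σ : ℂ)) ((T - algebraMap ℂ _ (σ : ℂ)) v) = 0 →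
      T v = (σ : ℂ) • v := by
    intro v hv
    have h1 : v ∈ Module.End.maxGenEigenspace T (σ : ℂ) := by
      rw [Module.End.mem_maxGenEigenspace]
      exact ⟨2, by rw [pow_two]; simpa [Algebra.algebraMap_eq_smul_one] using hv⟩
    rw [hs] at h1
    exact Module.End.mem_eigenspace_iff.1 h1
  have e1 := hgen e (by
    simp only [LinearMap.sub_apply, Module.algebraMap_end_apply, he, map_sub, map_add, map_smul, hf]
    rw [hd] at hdet ⊢
    have : (a k : ℂ) * (2 * σ - a k) - c k * b k - 1 = 0 := by linear_combination hdet
    ext i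
    simp only [Pi.sub_apply, Pi.add_apply, Pi.smul_apply, smul_eq_mul, Pi.zero_apply]
    linear_combination (-this + hσc) * e i)
  have e2 := hgen f (by
    simp only [LinearMap.sub_apply, Module.algebraMap_end_apply, he, map_sub, map_add, map_smul, hf]
    rw [hd] at hdet ⊢
    have : (a k : ℂ) * (2 * σ - a k) - c k * b k - 1 = 0 := by linear_combination hdet
    ext i
    simp only [Pi.sub_apply, Pi.add_apply, Pi.smul_apply, smul_eq_mul, Pi.zero_apply]
    linear_combination (-this + hσc) * f i)
  rw [he] at e1
  rw [hf] at e2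
  have e11 := congrFun e1 (Sum.inl k)
  have e12 := congrFun e1 (Sum.inr k)
  have e21 := congrFun e2 (Sum.inl k)
  have e22 := congrFun e2 (Sum.inr k)
  simp [e, f] at e11 e12 e21 e22
  exact ⟨e11, e21, e12, e22⟩

end UnimodularRoots

/-! ### The fundamental matrix of a diagonal system. -/

section Fundamental

variable {n : ℕ} {Ap : ℝ → Matrix (Fin n) (Fin n) ℝ} {l : ℝ}
  {Φ : ℝ → Matrix (Fin n ⊕ Fin n) (Fin n ⊕ Fin n) ℝ}

theorem IsFundamentalMatrix.isSol (hΦ : IsFundamentalMatrix Ap l Φ) (hd : ∀ x, (Ap x).IsDiag)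
    (i : Fin n) (r : Fin n ⊕ Fin n) :
    IsSol (fun x => Ap x i i - l) 0 (fun x => Φ x (.inl i) r) (fun x => Φ x (.inr i) r) := by
  have h : ∀ x q, HasDerivAt (fun x => Φ x q r)
      ((Matrix.fromBlocks 0 1 (Ap x - l • 1) 0 * Φ x : Matrix (Fin n ⊕ Fin n) (Fin n ⊕ Fin n) ℝ) q r) x := fun x q =>
    hasDerivAt_pi.1 (hasDerivAt_pi.1 (hΦ.2 x) q) r
  refine ⟨fun x => (h x _).congr_deriv ?_, fun x => (h x _).congr_deriv ?_⟩
  · rw [Matrix.mul_apply, Fintype.sum_sum_type]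
    simp [Matrix.one_apply]
  · rw [Matrix.mul_apply, Fintype.sum_sum_type, Finset.sum_eq_single i]
    · simp
    · intro k _ hk
      simp [(hd x) hk.symm, Matrix.one_apply_ne hk.symm]
    · simp

/-- Entries that couple different components solve a scalar equation with zero initial data, hence
vanish. -/
theorem IsFundamentalMatrix.exists_fundamentalPair (hΦ : IsFundamentalMatrix Ap l Φ)
    (hd : ∀ x, (Ap x).IsDiag) : ∃ F : ∀ k, FundamentalPair (fun x => Ap x k k - l),
      ∀ x, Φ x = Matrix.fromBlocks (Matrix.diagonal fun k => (F k).c x)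
        (Matrix.diagonal fun k => (F k).s x) (Matrix.diagonal fun k => (F k).c' x)
        (Matrix.diagonal fun k => (F k).s' x) := by
  refine ⟨fun k => ⟨_, _, _, _, hΦ.isSol hd k (.inl k), hΦ.isSol hd k (.inr k), ?_, ?_, ?_, ?_⟩,
    fun x => ?_⟩
  iterate 4 simp [hΦ.1]
  have h0 : ∀ (i : Fin n) (r : Fin n ⊕ Fin n), r ≠ .inl i → r ≠ .inr i →
      Φ x (.inl i) r = 0 ∧ Φ x (.inr i) r = 0 := by
    intro i r h1 h2
    have hW : ∀ x, Φ x (.inl i) (.inl i) * Φ x (.inr i) (.inr i) -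
        Φ x (.inr i) (.inl i) * Φ x (.inl i) (.inr i) = 1 := fun x => by
      rw [(hΦ.isSol hd i (.inl i)).wronskian_eq (hΦ.isSol hd i (.inr i)) x 0]
      simp [hΦ.1]
    exact (hΦ.isSol hd i (.inl i)).eq_zero_of_initial (hΦ.isSol hd i (.inr i)) hW
      (hΦ.isSol hd i r) 0 (by rw [hΦ.1, Matrix.one_apply_ne h1.symm])
      (by rw [hΦ.1, Matrix.one_apply_ne h2.symm]) x
  ext (i | i) (k | k)
  all_goals
    by_cases hi : i = k
    · subst hi; simp
    · first
      | rw [(h0 i _ (by simp [Ne.symm hi]) (by simp [Ne.symm hi])).1]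
      | rw [(h0 i _ (by simp [Ne.symm hi]) (by simp [Ne.symm hi])).2]
      simp [Matrix.diagonal_apply_ne _ hi]

end Fundamental

/-! ### Perturbed scalar equations on the whole line. -/

namespace DichotomyPair

variable {q r ρ y y' : ℝ → ℝ} {α : ℝ}

theorem exists_growth_abs_le (P : DichotomyPair q α) (hα : 0 ≤ α) (hr : Continuous r)
    (hρc : Continuous ρ) (hρi : Integrable ρ) (hrρ : ∀ x, |r x| ≤ ρ x)
    (hy : IsSol (fun x => q x + r x) 0 y y') :
    ∃ C, 0 ≤ C ∧ ∀ x, |y x| ≤ C * Real.exp (α * |x|) ∧ |y' x| ≤ C * Real.exp (α * |x|) := by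
  obtain ⟨C, hC⟩ := P.exists_growth_le hα hr hρc hρi hrρ hy
  obtain ⟨D, hD⟩ := P.reflect.exists_growth_le hα (r := fun x => r (-x)) (by fun_prop)
    (ρ := fun x => ρ (-x)) (by fun_prop) hρi.comp_neg (fun x => hrρ (-x))
    (y := fun x => y (-x)) (y' := fun x => -y' (-x)) (by simpa using! hy.reflect)
  refine ⟨max (max C D) 0, le_max_right _ _, fun x => ?_⟩
  have hle : ∀ {a b : ℝ}, a ≤ b * Real.exp (α * |x|) → b ≤ max C D →
      a ≤ max (max C D) 0 * Real.exp (α * |x|) := fun h1 h2 =>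
    h1.trans (mul_le_mul_of_nonneg_right (h2.trans (le_max_left _ _)) (Real.exp_nonneg _))
  rcases le_total 0 x with hx | hx
  · have := hC x hx
    rw [abs_of_nonneg hx] at hle ⊢
    exact ⟨hle this.1 (le_max_left _ _), hle this.2 (le_max_left _ _)⟩
  · have := hD (-x) (by linarith)
    rw [neg_neg, abs_neg] at this
    rw [abs_of_nonpos hx] at hle ⊢
    exact ⟨hle this.1 (le_max_right _ _), hle this.2 (le_max_right _ _)⟩

theorem exists_decaying_isSol (P : DichotomyPair q α) (hα : 0 ≤ α) (hr : Continuous r)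
    (hρc : Continuous ρ) (hρi : Integrable ρ) (hrρ : ∀ x, |r x| ≤ ρ x)
    (F : FundamentalPair fun x => q x + r x) :
    ∃ y y', IsSol (fun x => q x + r x) 0 y y' ∧ (y 0 ≠ 0 ∨ y' 0 ≠ 0) ∧ ∃ C, ∀ x, 0 ≤ x →
      |y x| ≤ C * Real.exp (-α * x) ∧ |y' x| ≤ C * Real.exp (-α * x) := by
  obtain ⟨a, b, hab, hC⟩ := P.exists_decaying hα hr hρc hρi hrρ F.sol_c F.sol_s
  refine ⟨_, _, F.sol_c.lin a b F.sol_s, ?_, hC⟩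
  simpa [F.c_zero, F.c'_zero, F.s_zero, F.s'_zero] using hab

end DichotomyPair

theorem nonempty_fundamentalPair {q : ℝ → ℝ} (hq : Continuous q) {M : ℝ} (hM : ∀ x, |q x| ≤ M) :
    Nonempty (FundamentalPair q) := by
  obtain ⟨c, c', hc, h1, h2⟩ := exists_isSol q hq M hM 1 0
  obtain ⟨s, s', hs, h3, h4⟩ := exists_isSol q hq M hM 0 1
  exact ⟨⟨c, c', s, s', hc, hs, h1, h2, h3, h4⟩⟩

namespace FundamentalPair

variable {q : ℝ → ℝ}

/-- The solution with given initial values. -/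
theorem exists_isSol_initial (F : FundamentalPair q) (a b : ℝ) :
    ∃ y y', IsSol q 0 y y' ∧ y 0 = a ∧ y' 0 = b :=
  ⟨_, _, F.sol_c.lin a b F.sol_s, by simp [F.c_zero, F.s_zero], by simp [F.c'_zero, F.s'_zero]⟩

/-- The reflected fundamental pair. -/
def reflect (F : FundamentalPair q) : FundamentalPair fun x => q (-x) where
  c x := F.c (-x)
  c' x := -F.c' (-x)
  s x := -F.s (-x)
  s' x := F.s' (-x)
  sol_c := by simpa using! F.sol_c.reflect
  sol_s := by simpa using! F.sol_s.reflect.const_mul (-1)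
  c_zero := by simp [F.c_zero]
  c'_zero := by simp [F.c'_zero]
  s_zero := by simp [F.s_zero]
  s'_zero := by simp [F.s'_zero]

theorem eq_zero_of_initial (F : FundamentalPair q) {y y' : ℝ → ℝ} (h : IsSol q 0 y y')
    (h0 : y 0 = 0) (h1 : y' 0 = 0) (x : ℝ) : y x = 0 := by
  rw [(F.eq_of_isSol h x).1, h0, h1]
  ring

end FundamentalPair

section Perturbation

variable {q r ρ : ℝ → ℝ} {α : ℝ}

/-- At α = 0 the growth bound is boundedness, so the fundamental solutions themselves form the pair.
-/
theorem nonempty_pair_of_perturbed_elliptic (P : DichotomyPair q 0) (hr : Continuous r)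
    (hρc : Continuous ρ) (hρi : Integrable ρ) (hrρ : ∀ x, |r x| ≤ ρ x)
    (F : FundamentalPair fun x => q x + r x) :
    Nonempty (DichotomyPair (fun x => q x + r x) 0) := by
  obtain ⟨C, hC, h1⟩ := P.exists_growth_abs_le le_rfl hr hρc hρi hrρ F.sol_c
  obtain ⟨D, hD, h2⟩ := P.exists_growth_abs_le le_rfl hr hρc hρi hrρ F.sol_s
  simp only [zero_mul, Real.exp_zero, mul_one] at h1 h2
  refine ⟨⟨_, _, _, _, C + D, F.sol_c, F.sol_s, F.wronskian, fun x => ?_, fun x => ?_, fun x => ?_,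
    fun x => ?_⟩⟩ <;> simp only [neg_zero, zero_mul, Real.exp_zero, mul_one]
  · linarith [(h1 x).1]
  · linarith [(h1 x).2]
  · linarith [(h2 x).1]
  · linarith [(h2 x).2]

/-- A decaying perturbation of a hyperbolic equation without nontrivial decaying solution is
hyperbolic. -/
theorem nonempty_pair_of_perturbed_hyperbolic (P : DichotomyPair q α) (hα : 0 ≤ α)
    (hr : Continuous r) (hρc : Continuous ρ) (hρi : Integrable ρ) (hrρ : ∀ x, |r x| ≤ ρ x)
    (F : FundamentalPair fun x => q x + r x)
    (hno : ∀ y y', IsSol (fun x => q x + r x) 0 y y' → ∀ C,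
      (∀ x, |y x| ≤ C * Real.exp (-α * |x|) ∧ |y' x| ≤ C * Real.exp (-α * |x|)) → ∀ x, y x = 0) :
    Nonempty (DichotomyPair (fun x => q x + r x) α) := by
  obtain ⟨φ, φ', hφ, hφ0, C, hC⟩ := P.exists_decaying_isSol hα hr hρc hρi hrρ F
  obtain ⟨z, z', hz, hz0, D, hD⟩ := P.reflect.exists_decaying_isSol hα (r := fun x => r (-x))
    (by fun_prop) (ρ := fun x => ρ (-x)) (by fun_prop) hρi.comp_neg (fun x => hrρ (-x)) F.reflect
  set ψ : ℝ → ℝ := fun x => z (-x) with hψd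
  set ψ' : ℝ → ℝ := fun x => -z' (-x) with hψd'
  have hψ : IsSol (fun x => q x + r x) 0 ψ ψ' := by simpa using! hz.reflect
  have hψ0 : ψ 0 ≠ 0 ∨ ψ' 0 ≠ 0 := by simpa [hψd, hψd'] using hz0
  have hDψ : ∀ x ≤ 0, |ψ x| ≤ D * Real.exp (α * x) ∧ |ψ' x| ≤ D * Real.exp (α * x) := fun x hx => by
    have := hD (-x) (by linarith)
    simpa [hψd, hψd'] using this
  obtain ⟨C₁, hC₁, g1⟩ := P.exists_growth_abs_le hα hr hρc hρi hrρ hφ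
  obtain ⟨D₁, hD₁, g2⟩ := P.exists_growth_abs_le hα hr hρc hρi hrρ hψ
  have hC0 : 0 ≤ C := by simpa using (abs_nonneg _).trans (hC 0 le_rfl).1
  have hD0 : 0 ≤ D := by simpa using (abs_nonneg _).trans (hDψ 0 le_rfl).1
  set W : ℝ := φ 0 * ψ' 0 - φ' 0 * ψ 0 with hW
  have hWx : ∀ x, φ x * ψ' x - φ' x * ψ x = W := fun x => hφ.wronskian_eq hψ x 0
  -- If the solution decaying at +∞ were dependent on the one decaying at -∞, it would decay at both
  -- ends and vanish by `hno`.
  have hW0 : W ≠ 0 := by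
    intro h0
    obtain ⟨m, hm⟩ : ∃ m : ℝ, φ 0 = m * ψ 0 ∧ φ' 0 = m * ψ' 0 := by
      rcases hψ0 with h | h
      · refine ⟨φ 0 / ψ 0, by field_simp, ?_⟩
        field_simp
        linarith
      · refine ⟨φ' 0 / ψ' 0, ?_, by field_simp⟩
        field_simp
        linarith
    have hφψ : ∀ x, φ x = m * ψ x ∧ φ' x = m * ψ' x := fun x => by
      rw [(F.eq_of_isSol hφ x).1, (F.eq_of_isSol hφ x).2, (F.eq_of_isSol hψ x).1,
        (F.eq_of_isSol hψ x).2, hm.1, hm.2]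
      constructor <;> ring
    have hle : ∀ {x a b c : ℝ}, a ≤ b * Real.exp (-α * |x|) → b ≤ c →
        a ≤ c * Real.exp (-α * |x|) := fun h1 h2 =>
      h1.trans (mul_le_mul_of_nonneg_right h2 (Real.exp_nonneg _))
    have hz := hno φ φ' hφ (C + |m| * D) (fun x => by
      rcases le_total 0 x with hx | hx
      · have h1 := hC x hx
        nth_rewrite 2 [← abs_of_nonneg hx] at h1
        nth_rewrite 4 [← abs_of_nonneg hx] at h1
        exact ⟨hle h1.1 (le_add_of_nonneg_right (by positivity)),
          hle h1.2 (le_add_of_nonneg_right (by positivity))⟩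
      · have h1 := hDψ x hx
        have e : Real.exp (-α * |x|) = Real.exp (α * x) := by rw [abs_of_nonpos hx]; congr 1; ring
        rw [← e] at h1
        rw [(hφψ x).1, (hφψ x).2, abs_mul, abs_mul]
        have h2 : ∀ {a : ℝ}, a ≤ D * Real.exp (-α * |x|) →
            |m| * a ≤ (|m| * D) * Real.exp (-α * |x|) := fun h => by
          rw [mul_assoc]; exact mul_le_mul_of_nonneg_left h (abs_nonneg m)
        exact ⟨hle (h2 h1.1) (le_add_of_nonneg_left hC0),
          hle (h2 h1.2) (le_add_of_nonneg_left hC0)⟩)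
    have hφz : φ 0 = 0 := hz 0
    have hφz' : φ' 0 = 0 := by
      have h1 := hφ.deriv_fst 0
      rw [show φ = fun _ => 0 from funext hz] at h1
      exact h1.unique (hasDerivAt_const _ _)
    tauto
  have aux : ∀ {v : ℝ → ℝ} {c c₁ : ℝ}, 0 ≤ c → 0 ≤ c₁ → ∀ x,
      (0 ≤ x → |v x| ≤ c * Real.exp (-α * x)) → |v x| ≤ c₁ * Real.exp (α * |x|) →
      |v x| ≤ (c + c₁) * Real.exp (-α * x) := by
    intro v c c₁ h1 h2 x h3 h4
    rw [add_mul]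
    rcases le_total 0 x with hx | hx
    · exact (h3 hx).trans (le_add_of_nonneg_right (by positivity))
    · rw [abs_of_nonpos hx, mul_neg, ← neg_mul] at h4
      exact h4.trans (le_add_of_nonneg_left (by positivity))
  have aux' : ∀ {v : ℝ → ℝ} {c c₁ : ℝ}, 0 ≤ c → 0 ≤ c₁ → ∀ x,
      (x ≤ 0 → |v x| ≤ c * Real.exp (α * x)) → |v x| ≤ c₁ * Real.exp (α * |x|) →
      |v x| ≤ (c + c₁) * Real.exp (α * x) := by
    intro v c c₁ h1 h2 x h3 h4
    rw [add_mul]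
    rcases le_total 0 x with hx | hx
    · rw [abs_of_nonneg hx] at h4
      exact h4.trans (le_add_of_nonneg_left (by positivity))
    · exact (h3 hx).trans (le_add_of_nonneg_right (by positivity))
  have hscale : ∀ {v : ℝ} {c e : ℝ}, 0 ≤ e → |v| ≤ c * e →
      |W⁻¹ * v| ≤ ((C + C₁) + |W⁻¹| * c) * e := by
    intro v c e he h
    rw [abs_mul, add_mul, mul_assoc |W⁻¹|]
    exact (mul_le_mul_of_nonneg_left h (abs_nonneg _)).trans
      (le_add_of_nonneg_left (by positivity))
  have hmono : ∀ {v : ℝ} {e : ℝ}, 0 ≤ e → |v| ≤ (C + C₁) * e →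
      |v| ≤ ((C + C₁) + |W⁻¹| * (D + D₁)) * e := fun he h =>
    h.trans (mul_le_mul_of_nonneg_right (le_add_of_nonneg_right (by positivity)) he)
  refine ⟨⟨φ, φ', fun x => W⁻¹ * ψ x, fun x => W⁻¹ * ψ' x, (C + C₁) + |W⁻¹| * (D + D₁), hφ,
    by simpa using! hψ.const_mul W⁻¹, fun x => ?_, fun x => ?_, fun x => ?_, fun x => ?_,
    fun x => ?_⟩⟩
  · have := hWx x
    field_simp
    linarith
  · exact hmono (Real.exp_nonneg _) (aux hC0 hC₁ x (fun h => (hC x h).1) (g1 x).1)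
  · exact hmono (Real.exp_nonneg _) (aux (v := φ') hC0 hC₁ x (fun h => (hC x h).2) (g1 x).2)
  · exact hscale (Real.exp_nonneg _) (aux' hD0 hD₁ x (fun h => (hDψ x h).1) (g2 x).1)
  · exact hscale (Real.exp_nonneg _) (aux' (v := ψ') hD0 hD₁ x (fun h => (hDψ x h).2) (g2 x).2)

/-- The Wronskians with the two bounded solutions are constant and tend to zero. -/
theorem DichotomyPair.eq_zero_of_tendsto (P : DichotomyPair q 0) {y y' : ℝ → ℝ}
    (hy : IsSol q 0 y y') (h0 : Tendsto y atTop (𝓝 0)) (h1 : Tendsto y' atTop (𝓝 0)) (x : ℝ) :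
    y x = 0 := by
  have b1 : ∀ x, |P.φ x| ≤ P.C := fun x => by simpa using P.φ_le x
  have b2 : ∀ x, |P.φ' x| ≤ P.C := fun x => by simpa using P.φ'_le x
  have b3 : ∀ x, |P.ψ x| ≤ P.C := fun x => by simpa using P.ψ_le x
  have b4 : ∀ x, |P.ψ' x| ≤ P.C := fun x => by simpa using P.ψ'_le x
  have e1 : P.φ x * y' x - P.φ' x * y x = 0 := by
    refine tendsto_nhds_unique (tendsto_const_nhds.congr fun t => ?_)
      (tendsto_wronskian_zero (.of_forall b1) (.of_forall b2) h0 h1)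
    exact P.sol_φ.wronskian_eq hy x t
  have e2 : P.ψ x * y' x - P.ψ' x * y x = 0 := by
    refine tendsto_nhds_unique (tendsto_const_nhds.congr fun t => ?_)
      (tendsto_wronskian_zero (.of_forall b3) (.of_forall b4) h0 h1)
    exact P.sol_ψ.wronskian_eq hy x t
  rw [eq_wronskian_combination P.wronskian y y' x, e1, e2]
  ring

/-- A single component may be taken with the full rate η = α in `exists_exp_decay`. -/
theorem DichotomyPair.abs_le_exp_of_tendsto_atTop (P : DichotomyPair q α) (hα : 0 ≤ α)
    (hr : Continuous r) (hρc : Continuous ρ) (hρi : Integrable ρ) (hrρ : ∀ x, |r x| ≤ ρ x)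
    {y y' : ℝ → ℝ} (hy : IsSol (fun x => q x + r x) 0 y y') (h0 : Tendsto y atTop (𝓝 0))
    (h1 : Tendsto y' atTop (𝓝 0)) : ∃ C, 0 ≤ C ∧ ∀ x, 0 ≤ x →
      |y x| ≤ C * Real.exp (-α * x) ∧ |y' x| ≤ C * Real.exp (-α * x) := by
  have hsol := hy.congr_potential
  simp only [Pi.zero_apply, add_zero] at hsol
  obtain ⟨C, hC, h⟩ := exists_exp_decay (ι := Unit) (fun _ => P) hα (fun _ => .inr le_rfl)
    (fun _ => hsol) (fun _ => hr.mul hy.continuous) hρc hρi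
    (fun x => (abs_nonneg _).trans (hrρ x)) (fun _ x => by
      rw [abs_mul]
      exact mul_le_mul (hrρ x) (norm_le_pi_norm (fun _ : Unit => y x) ()) (abs_nonneg _)
        ((abs_nonneg _).trans (hrρ x))) (fun _ => h0) (fun _ => h1)
  exact ⟨C, hC, h ()⟩

/-- A decaying solution of a perturbed hyperbolic equation and a second solution. -/
theorem DichotomyPair.exists_resonant_pair (P : DichotomyPair q α) (hα : 0 ≤ α)
    (hr : Continuous r) (hρc : Continuous ρ) (hρi : Integrable ρ) (hrρ : ∀ x, |r x| ≤ ρ x)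
    (F : FundamentalPair fun x => q x + r x) {y y' : ℝ → ℝ}
    (hy : IsSol (fun x => q x + r x) 0 y y') {x₀ : ℝ} (hx₀ : y x₀ ≠ 0)
    (h0 : Tendsto y atTop (𝓝 0)) (h1 : Tendsto y' atTop (𝓝 0)) (h2 : Tendsto y atBot (𝓝 0))
    (h3 : Tendsto y' atBot (𝓝 0)) : ∃ (C : ℝ) (ψ ψ' : ℝ → ℝ),
      (∀ x, |y x| ≤ C * Real.exp (-α * |x|)) ∧ (∀ x, |y' x| ≤ C * Real.exp (-α * |x|)) ∧
      IsSol (fun x => q x + r x) 0 ψ ψ' ∧ (∀ x, y x * ψ' x - y' x * ψ x = 1) ∧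
      ∀ x, |ψ x| ≤ C * Real.exp (α * |x|) := by
  obtain ⟨C₁, hC₁, b1⟩ := P.abs_le_exp_of_tendsto_atTop hα hr hρc hρi hrρ hy h0 h1
  obtain ⟨C₂, hC₂, b2⟩ := P.reflect.abs_le_exp_of_tendsto_atTop hα (r := fun x => r (-x))
    (by fun_prop) (ρ := fun x => ρ (-x)) (by fun_prop) hρi.comp_neg (fun x => hrρ (-x))
    (y := fun x => y (-x)) (y' := fun x => -y' (-x)) (by simpa using! hy.reflect)
    (h2.comp tendsto_neg_atTop_atBot) (by simpa using! (h3.comp tendsto_neg_atTop_atBot).neg)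
  have hpos : y 0 ^ 2 + y' 0 ^ 2 ≠ 0 := by
    intro h
    have e1 : y 0 = 0 := by nlinarith [sq_nonneg (y 0), sq_nonneg (y' 0)]
    have e2 : y' 0 = 0 := by nlinarith [sq_nonneg (y 0), sq_nonneg (y' 0)]
    exact hx₀ (F.eq_zero_of_initial hy e1 e2 x₀)
  -- The initial vector is that of `y` turned by a right angle and divided by its squared length,
  -- which makes the Wronskian 1.
  obtain ⟨ψ, ψ', hψ, e1, e2⟩ := F.exists_isSol_initial (-y' 0 / (y 0 ^ 2 + y' 0 ^ 2))
    (y 0 / (y 0 ^ 2 + y' 0 ^ 2))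
  obtain ⟨C₃, hC₃, b3⟩ := P.exists_growth_abs_le hα hr hρc hρi hrρ hψ
  have hb : ∀ x, |y x| ≤ (C₁ + C₂ + C₃) * Real.exp (-α * |x|) ∧
      |y' x| ≤ (C₁ + C₂ + C₃) * Real.exp (-α * |x|) := fun x => by
    have hle : ∀ {a b : ℝ}, a ≤ b * Real.exp (-α * |x|) → b ≤ C₁ + C₂ + C₃ →
        a ≤ (C₁ + C₂ + C₃) * Real.exp (-α * |x|) := fun h1 h2 =>
      h1.trans (mul_le_mul_of_nonneg_right h2 (Real.exp_nonneg _))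
    rcases le_total 0 x with hx | hx
    · have := b1 x hx
      rw [abs_of_nonneg hx] at hle ⊢
      exact ⟨hle this.1 (by linarith), hle this.2 (by linarith)⟩
    · have := b2 (-x) (by linarith)
      rw [neg_neg, abs_neg] at this
      rw [abs_of_nonpos hx] at hle ⊢
      exact ⟨hle this.1 (by linarith), hle this.2 (by linarith)⟩
  refine ⟨C₁ + C₂ + C₃, ψ, ψ', fun x => (hb x).1, fun x => (hb x).2, hψ, fun x => ?_, fun x => ?_⟩
  · rw [hy.wronskian_eq hψ x 0, e1, e2]
    field_simp
    ring
  · exact (b3 x).1.trans (mul_le_mul_of_nonneg_right (by linarith) (Real.exp_nonneg _))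

end Perturbation

/-! ### Prescribing moments. -/

/-- Two independent solutions have arbitrary moments against multiples of a fixed nonzero function. -/
theorem exists_moments {q φ φ' ψ ψ' u κ : ℝ → ℝ} (hφ : IsSol q 0 φ φ') (hψ : IsSol q 0 ψ ψ')
    (hW : ∀ x, φ x * ψ' x - φ' x * ψ x = 1) {C : ℝ} (b1 : ∀ x, |φ x| ≤ C) (b2 : ∀ x, |ψ x| ≤ C)
    (hu : Continuous u) (b3 : ∀ x, |u x| ≤ C) {x₀ : ℝ} (hx₀ : u x₀ ≠ 0) (hκ : Continuous κ)
    (hκ0 : ∀ x, 0 < κ x) (hκi : Integrable κ) (z₁ z₂ : ℝ) :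
    ∃ h : ℝ → ℝ, Continuous h ∧ (∃ D, ∀ x, |h x| ≤ D * κ x) ∧
      ∫ x, φ x * (h x * u x) = z₁ ∧ ∫ x, ψ x * (h x * u x) = z₂ := by
  have hφc := hφ.continuous
  have hψc := hψ.continuous
  have hC : 0 ≤ C := (abs_nonneg _).trans (b1 0)
  have hint : ∀ {v w : ℝ → ℝ}, Continuous v → Continuous w → (∀ x, |v x| ≤ C) → (∀ x, |w x| ≤ C) →
      Integrable fun x => v x * ((w x * (u x * κ x)) * u x) := by
    intro v w hv hw h1 h2
    refine Integrable.mono' (hκi.const_mul (C * C * C * C))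
      (Continuous.aestronglyMeasurable (by fun_prop)) (.of_forall fun x => ?_)
    rw [Real.norm_eq_abs, abs_mul, abs_mul, abs_mul, abs_mul, abs_of_pos (hκ0 x)]
    calc _ = (|v x| * |w x| * |u x| * |u x|) * κ x := by ring
      _ ≤ _ := by
        refine mul_le_mul_of_nonneg_right ?_ (hκ0 x).le
        have h3 := b3 x
        have h4 := h1 x
        have h5 := h2 x
        gcongr
  have i11 := hint hφc hφc b1 b1
  have i12 := hint hφc hψc b1 b2
  have i21 := hint hψc hφc b2 b1
  have i22 := hint hψc hψc b2 b2
  -- With h sought in the form (c₁φ + c₂ψ)uκ, the moments are given by the Gram matrix of φ and ψ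
  -- for the weight u²κ. A kernel vector gives a combination vanishing where u ≠ 0, so its value and
  -- slope at x₀ are zero and the Wronskian forces c = 0.
  let G : (ℝ × ℝ) →ₗ[ℝ] (ℝ × ℝ) :=
    { toFun := fun c => (∫ x, φ x * (((c.1 * φ x + c.2 * ψ x) * (u x * κ x)) * u x),
        ∫ x, ψ x * (((c.1 * φ x + c.2 * ψ x) * (u x * κ x)) * u x))
      map_add' := fun c d => by
        refine Prod.ext ?_ ?_
        · change _ = (∫ x, _) + ∫ x, _
          rw [← integral_add]
          · refine integral_congr_ae (.of_forall fun x => ?_)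
            simp only [Prod.fst_add, Prod.snd_add]; ring
          · refine ((i11.const_mul c.1).add (i12.const_mul c.2)).congr (.of_forall fun x => ?_)
            simp only [Pi.add_apply]; ring
          · refine ((i11.const_mul d.1).add (i12.const_mul d.2)).congr (.of_forall fun x => ?_)
            simp only [Pi.add_apply]; ring
        · change _ = (∫ x, _) + ∫ x, _
          rw [← integral_add]
          · refine integral_congr_ae (.of_forall fun x => ?_)
            simp only [Prod.fst_add, Prod.snd_add]; ring
          · refine ((i21.const_mul c.1).add (i22.const_mul c.2)).congr (.of_forall fun x => ?_)
            simp only [Pi.add_apply]; ring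
          · refine ((i21.const_mul d.1).add (i22.const_mul d.2)).congr (.of_forall fun x => ?_)
            simp only [Pi.add_apply]; ring
      map_smul' := fun m c => by
        refine Prod.ext ?_ ?_
        · change _ = m * ∫ x, _
          rw [← integral_const_mul]
          refine integral_congr_ae (.of_forall fun x => ?_)
          simp only [Prod.smul_fst, Prod.smul_snd, smul_eq_mul]; ring
        · change _ = m * ∫ x, _
          rw [← integral_const_mul]
          refine integral_congr_ae (.of_forall fun x => ?_)
          simp only [Prod.smul_fst, Prod.smul_snd, smul_eq_mul]; ring }
  have hinj : Function.Injective G := by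
    rw [← LinearMap.ker_eq_bot, LinearMap.ker_eq_bot']
    intro c hc
    have e1 : ∫ x, φ x * (((c.1 * φ x + c.2 * ψ x) * (u x * κ x)) * u x) = 0 := congrArg Prod.fst hc
    have e2 : ∫ x, ψ x * (((c.1 * φ x + c.2 * ψ x) * (u x * κ x)) * u x) = 0 := congrArg Prod.snd hc
    have j1 : Integrable fun x => φ x * (((c.1 * φ x + c.2 * ψ x) * (u x * κ x)) * u x) := by
      refine ((i11.const_mul c.1).add (i12.const_mul c.2)).congr (.of_forall fun x => ?_)
      simp only [Pi.add_apply]; ring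
    have j2 : Integrable fun x => ψ x * (((c.1 * φ x + c.2 * ψ x) * (u x * κ x)) * u x) := by
      refine ((i21.const_mul c.1).add (i22.const_mul c.2)).congr (.of_forall fun x => ?_)
      simp only [Pi.add_apply]; ring
    have heq : (fun x => ((c.1 * φ x + c.2 * ψ x) * u x) ^ 2 * κ x) = fun x =>
        c.1 * (φ x * (((c.1 * φ x + c.2 * ψ x) * (u x * κ x)) * u x)) +
        c.2 * (ψ x * (((c.1 * φ x + c.2 * ψ x) * (u x * κ x)) * u x)) := by
      funext x; ring
    have e3 : ∫ x, ((c.1 * φ x + c.2 * ψ x) * u x) ^ 2 * κ x = 0 := by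
      rw [heq, integral_add (j1.const_mul _) (j2.const_mul _), integral_const_mul,
        integral_const_mul, e1, e2]
      ring
    have j3 : Integrable fun x => ((c.1 * φ x + c.2 * ψ x) * u x) ^ 2 * κ x := by
      rw [heq]; exact (j1.const_mul _).add (j2.const_mul _)
    have e4 : (fun x => ((c.1 * φ x + c.2 * ψ x) * u x) ^ 2 * κ x) = fun _ => 0 :=
      (Continuous.ae_eq_iff_eq volume (by fun_prop) continuous_const).1
        ((integral_eq_zero_iff_of_nonneg (fun x => mul_nonneg (sq_nonneg _) (hκ0 x).le) j3).1 e3)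
    have e5 : ∀ x, (c.1 * φ x + c.2 * ψ x) * u x = 0 := fun x => by
      have := congrFun e4 x
      simpa [(hκ0 x).ne'] using this
    have e6 : (fun x => c.1 * φ x + c.2 * ψ x) =ᶠ[𝓝 x₀] fun _ => 0 := by
      filter_upwards [hu.continuousAt.eventually_ne hx₀] with x hx
      exact (mul_eq_zero.1 (e5 x)).resolve_right hx
    have hlin := hφ.lin c.1 c.2 hψ
    have e7 : c.1 * φ x₀ + c.2 * ψ x₀ = 0 := e6.eq_of_nhds
    have e8 : c.1 * φ' x₀ + c.2 * ψ' x₀ = 0 :=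
      (hlin.deriv_fst x₀).unique ((hasDerivAt_const x₀ (0 : ℝ)).congr_of_eventuallyEq e6)
    have e9 := hW x₀
    refine Prod.ext ?_ ?_
    · change c.1 = 0
      linear_combination (-c.1) * e9 + ψ' x₀ * e7 - ψ x₀ * e8
    · change c.2 = 0
      linear_combination (-c.2) * e9 - φ' x₀ * e7 + φ x₀ * e8
  obtain ⟨c, hc⟩ := LinearMap.injective_iff_surjective.1 hinj (z₁, z₂)
  refine ⟨fun x => (c.1 * φ x + c.2 * ψ x) * (u x * κ x), by fun_prop,
    ⟨(|c.1| * C + |c.2| * C) * C, fun x => ?_⟩, congrArg Prod.fst hc, congrArg Prod.snd hc⟩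
  rw [abs_mul, abs_mul, abs_of_pos (hκ0 x), ← mul_assoc]
  refine mul_le_mul_of_nonneg_right ?_ (hκ0 x).le
  refine mul_le_mul ?_ (b3 x) (abs_nonneg _) (by positivity)
  refine (abs_add_le _ _).trans ?_
  rw [abs_mul, abs_mul]
  have h1 := b1 x
  have h2 := b2 x
  gcongr

/-! ### The polynomial weight, and perturbations as multiplication operators. -/

section Weight

variable {β : ℝ}

theorem continuous_weight (β : ℝ) : Continuous fun x : ℝ => (1 + |x|) ^ (-β) :=
  (continuous_const.add continuous_abs).rpow_const fun x =>
    Or.inl (ne_of_gt (show (0 : ℝ) < 1 + |x| by positivity))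

theorem weight_pos (β x : ℝ) : 0 < (1 + |x|) ^ (-β) := Real.rpow_pos_of_pos (by positivity) _

theorem integrable_weight (hβ : 1 < β) : Integrable fun x : ℝ => (1 + |x|) ^ (-β) := by
  have := integrable_one_add_norm (E := ℝ) (μ := volume) (r := β) (by simpa using hβ)
  simpa [Real.norm_eq_abs] using this

theorem tendsto_weight (hβ : 0 < β) : Tendsto (fun x : ℝ => (1 + |x|) ^ (-β)) atTop (𝓝 0) :=
  (tendsto_rpow_neg_atTop hβ).comp (tendsto_atTop_add_const_left _ _ tendsto_abs_atTop_atTop)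

theorem le_mul_weight_iff (a C x : ℝ) : a ≤ C * (1 + |x|) ^ (-β) ↔ a * (1 + |x|) ^ β ≤ C := by
  have h : (0 : ℝ) < 1 + |x| := by positivity
  rw [Real.rpow_neg h.le, ← div_eq_mul_inv, le_div_iff₀ (Real.rpow_pos_of_pos h _)]

end Weight

namespace PerturbationSpace

variable {n : ℕ} {β : ℝ}

theorem abs_apply_le (B : PerturbationSpace n β) (x : ℝ) (i k : Fin n) :
    |B x i k| ≤ ‖B‖ * (1 + |x|) ^ (-β) := by
  rw [le_mul_weight_iff]
  have h1 : ‖weighted n β B x‖ ≤ ‖B‖ := (weighted n β B).norm_coe_le_norm x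
  rw [weighted_apply, norm_smul, Real.norm_of_nonneg (by positivity), mul_comm] at h1
  exact (mul_le_mul_of_nonneg_right (Matrix.norm_entry_le_entrywise_sup_norm (B x))
    (by positivity)).trans h1

theorem abs_apply_le_norm (hβ : 0 ≤ β) (B : PerturbationSpace n β) (x : ℝ) (i k : Fin n) :
    |B x i k| ≤ ‖B‖ :=
  (B.abs_apply_le x i k).trans (mul_le_of_le_one_right (norm_nonneg _)
    (Real.rpow_le_one_of_one_le_of_nonpos (by linarith [abs_nonneg x]) (by linarith)))

theorem continuous_apply (B : PerturbationSpace n β) (i k : Fin n) : Continuous fun x => B x i k :=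
  B.2.1.matrix_elem i k

/-- An entry of a perturbation as a bounded continuous function. -/
noncomputable def entry (hβ : 0 ≤ β) (i k : Fin n) (B : PerturbationSpace n β) : ℝ →ᵇ ℝ :=
  BoundedContinuousFunction.ofNormedAddCommGroup (fun x => B x i k) (B.continuous_apply i k) ‖B‖
    fun x => B.abs_apply_le_norm hβ x i k

/-- The multiplication of vector functions by a perturbation. -/
theorem exists_multiplication (n : ℕ) (hβ : 0 ≤ β) :
    ∃ 𝔅 : PerturbationSpace n β →L[ℝ] ((Fin n → (ℝ →ᵇ ℝ)) →L[ℝ] (Fin n → (ℝ →ᵇ ℝ))),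
      ∀ B w i x, 𝔅 B w i x = ∑ k, B x i k * w k x := by
  let f : PerturbationSpace n β →ₗ[ℝ] ((Fin n → (ℝ →ᵇ ℝ)) →ₗ[ℝ] (Fin n → (ℝ →ᵇ ℝ))) :=
    LinearMap.mk₂ ℝ (fun B w i => ∑ k, entry hβ i k B * w k)
      (fun B B' w => by
        ext i x
        simp only [Pi.add_apply, BoundedContinuousFunction.coe_add,
          BoundedContinuousFunction.coe_sum, BoundedContinuousFunction.coe_mul, Finset.sum_apply,
          Pi.mul_apply]
        rw [← Finset.sum_add_distrib]
        exact Finset.sum_congr rfl fun k _ => add_mul (B x i k) (B' x i k) _)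
      (fun c B w => by
        ext i x
        simp only [Pi.smul_apply, BoundedContinuousFunction.coe_smul,
          BoundedContinuousFunction.coe_sum, BoundedContinuousFunction.coe_mul, Finset.sum_apply,
          Pi.mul_apply, smul_eq_mul]
        rw [Finset.mul_sum]
        exact Finset.sum_congr rfl fun k _ => mul_assoc c (B x i k) _)
      (fun B w w' => by
        funext i
        simp [mul_add, Finset.sum_add_distrib])
      (fun c B w => by
        ext i x
        simp only [Pi.smul_apply, BoundedContinuousFunction.coe_smul,
          BoundedContinuousFunction.coe_sum, BoundedContinuousFunction.coe_mul, Finset.sum_apply,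
          Pi.mul_apply, smul_eq_mul]
        rw [Finset.mul_sum]
        exact Finset.sum_congr rfl fun k _ => mul_left_comm _ c _)
  refine ⟨f.mkContinuous₂ n fun B w => ?_, fun B w i x => ?_⟩
  · refine (pi_norm_le_iff_of_nonneg (by positivity)).2 fun i => ?_
    change ‖∑ k, entry hβ i k B * w k‖ ≤ _
    have h : ∀ k ∈ Finset.univ, ‖entry hβ i k B * w k‖ ≤ ‖B‖ * ‖w‖ := fun k _ =>
      (norm_mul_le _ _).trans (mul_le_mul
        ((BoundedContinuousFunction.norm_le (norm_nonneg _)).2 fun x =>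
          B.abs_apply_le_norm hβ x i k) (norm_le_pi_norm w k) (norm_nonneg _) (norm_nonneg _))
    refine (norm_sum_le_of_le _ h).trans ?_
    simp [mul_assoc]
  · change (∑ k, entry hβ i k B * w k) x = _
    simp only [BoundedContinuousFunction.coe_sum, BoundedContinuousFunction.coe_mul,
      Finset.sum_apply, Pi.mul_apply]
    rfl

/-- The perturbation with the given entries in row and column `j`. -/
theorem exists_cross (j : Fin n) (h : Fin n → ℝ → ℝ) (hc : ∀ k, Continuous (h k)) {D : ℝ}
    (hD : ∀ k x, |h k x| ≤ D * (1 + |x|) ^ (-β)) :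
    ∃ B ∈ minimalSubspace n β j, ∀ k, k ≠ j → ∀ x, B.1 x k j = h k x := by
  let b : ℝ → Matrix (Fin n) (Fin n) ℝ := fun x => Matrix.of fun i k =>
    if i = k then 0 else if k = j then h i x else if i = j then h k x else 0
  have hb : ∀ x i k, b x i k =
    if i = k then 0 else if k = j then h i x else if i = j then h k x else 0 := fun _ _ _ => rfl
  have hD0 : 0 ≤ D := by
    have := (abs_nonneg _).trans (hD j 0)
    exact nonneg_of_mul_nonneg_left this (weight_pos β 0)
  refine ⟨⟨b, ?_, fun x => ?_, D, ?_⟩, ?_, fun k hk x => ?_⟩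
  · refine continuous_matrix fun i k => ?_
    simp only [hb]
    split_ifs
    exacts [continuous_const, hc i, hc k, continuous_const]
  · ext i k
    rw [Matrix.transpose_apply, hb, hb]
    rcases eq_or_ne i k with h1 | h1
    · subst h1; rfl
    · rw [if_neg h1, if_neg h1.symm]
      split_ifs with h2 h3 h3
      · exact absurd (h2.trans h3.symm) h1
      all_goals rfl
  · rintro _ ⟨x, rfl⟩
    simp only
    rw [← le_mul_weight_iff]
    have h0 : 0 ≤ D * (1 + |x|) ^ (-β) := mul_nonneg hD0 (weight_pos β x).le
    refine (Matrix.norm_le_iff h0).2 fun i k => ?_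
    rw [hb]
    split_ifs
    exacts [by simpa using h0, hD i x, hD k x, by simpa using h0]
  · rintro x i k (h1 | ⟨h1, h2⟩)
    · change b x i k = 0
      rw [hb, if_pos h1]
    · change b x i k = 0
      rw [hb, if_neg h2, if_neg h1, ite_self]
  · change b x k j = _
    rw [hb, if_neg hk, if_pos rfl]

end PerturbationSpace

/-! ### The full system: decay, reduction and transversality. -/

theorem exists_damp_eq {η C : ℝ} {f : ℝ → ℝ} (hf : Continuous f)
    (hb : ∀ x, |f x| ≤ C * Real.exp (-η * |x|)) : ∃ g : ℝ →ᵇ ℝ, ∀ x, damp η g x = f x := by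
  refine ⟨BoundedContinuousFunction.ofNormedAddCommGroup (fun x => Real.exp (η * |x|) * f x)
    (by fun_prop) C fun x => ?_, fun x => ?_⟩
  · rw [norm_mul, Real.norm_eq_abs, Real.abs_exp, Real.norm_eq_abs]
    calc _ ≤ Real.exp (η * |x|) * (C * Real.exp (-η * |x|)) :=
          mul_le_mul_of_nonneg_left (hb x) (Real.exp_nonneg _)
      _ = C * (Real.exp (η * |x|) * Real.exp (-η * |x|)) := by ring
      _ = C := by rw [← Real.exp_add]; simp
  · change Real.exp (-η * |x|) * (Real.exp (η * |x|) * f x) = f x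
    rw [← mul_assoc, ← Real.exp_add]
    simp

/-- Decaying solutions of a perturbed system decay exponentially. -/
theorem IsSystemSol.exists_exp_decay {n : ℕ} {A Ap : ℝ → Matrix (Fin n) (Fin n) ℝ} {β C l η : ℝ}
    (hβ : 1 < β) (hA : Continuous A) (hAp : Continuous Ap) (hdiag : ∀ x, (Ap x).IsDiag)
    (hC : ∀ x i k, |A x i k - Ap x i k| ≤ C * (1 + |x|) ^ (-β)) {α : Fin n → ℝ} (hη : 0 ≤ η)
    (hα : ∀ i, α i = 0 ∨ η ≤ α i) (P : ∀ i, DichotomyPair (fun x => Ap x i i - l) (α i))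
    {u u' : Fin n → ℝ → ℝ} (hu : IsSystemSol A l u u')
    (h0 : ∀ i, (Tendsto (u i) atTop (𝓝 0) ∧ Tendsto (u' i) atTop (𝓝 0)) ∧
      (Tendsto (u i) atBot (𝓝 0) ∧ Tendsto (u' i) atBot (𝓝 0))) :
    ∃ D, ∀ i x, |u i x| ≤ D * Real.exp (-η * |x|) := by
  -- Everything that differs from the diagonal periodic system is treated as forcing; its size is an
  -- integrable weight times the solution.
  set f : Fin n → ℝ → ℝ := fun i x => ∑ k, (A x i k - Ap x i k) * u k x with hf
  have hsol : ∀ i, IsSol (fun x => Ap x i i - l) (f i) (u i) (u' i) := fun i => by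
    refine ⟨(hu i).deriv_fst, fun x => ((hu i).deriv_snd x).congr_deriv ?_⟩
    have h1 : ∑ k, Ap x i k * u k x = Ap x i i * u i x :=
      Finset.sum_eq_single i (fun k _ hk => by rw [hdiag x hk.symm, zero_mul]) (by simp)
    simp only [hf, sub_mul, Finset.sum_sub_distrib, h1, Pi.zero_apply]
    ring
  have huc := fun i => (hu i).continuous
  have hfc : ∀ i, Continuous (f i) := fun i => by
    have h1 := fun k => hA.matrix_elem i k
    have h2 := fun k => hAp.matrix_elem i k
    fun_prop
  have hC0 : ∀ x i k, 0 ≤ C * (1 + |x|) ^ (-β) := fun x i k => (abs_nonneg _).trans (hC x i k)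
  rcases isEmpty_or_nonempty (Fin n) with hn | ⟨⟨i₀⟩⟩
  · exact ⟨0, fun i => isEmptyElim i⟩
  have hfρ : ∀ i x, |f i x| ≤ (n * C * (1 + |x|) ^ (-β)) * ‖fun i => u i x‖ := fun i x => by
    refine (Finset.abs_sum_le_sum_abs _ _).trans ?_
    have h : ∀ k ∈ Finset.univ, |(A x i k - Ap x i k) * u k x| ≤
        C * (1 + |x|) ^ (-β) * ‖fun i => u i x‖ := fun k _ => by
      rw [abs_mul]
      exact mul_le_mul (hC x i k) (norm_le_pi_norm (fun i => u i x) k) (abs_nonneg _)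
        (hC0 x i k)
    refine (Finset.sum_le_sum h).trans (le_of_eq ?_)
    simp
    ring
  have hρ0 : ∀ x : ℝ, 0 ≤ n * C * (1 + |x|) ^ (-β) := fun x => by
    rw [mul_assoc]; exact mul_nonneg (by positivity) (hC0 x i₀ i₀)
  have hρc : Continuous fun x : ℝ => n * C * (1 + |x|) ^ (-β) :=
    continuous_const.mul (continuous_weight β)
  have hρi : Integrable fun x : ℝ => n * C * (1 + |x|) ^ (-β) := (integrable_weight hβ).const_mul _
  obtain ⟨D₁, hD₁, b1⟩ := _root_.exists_exp_decay P hη hα hsol hfc hρc hρi hρ0 hfρ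
    (fun i => (h0 i).1.1) (fun i => (h0 i).1.2)
  obtain ⟨D₂, hD₂, b2⟩ := _root_.exists_exp_decay (fun i => (P i).reflect) hη hα
    (fun i => (hsol i).reflect) (fun i => by have := hfc i; fun_prop) hρc hρi hρ0
    (fun i x => by simpa using hfρ i (-x)) (fun i => (h0 i).2.1.comp tendsto_neg_atTop_atBot)
    (fun i => by simpa using! ((h0 i).2.2.comp tendsto_neg_atTop_atBot).neg)
  refine ⟨D₁ + D₂, fun i x => ?_⟩
  rw [add_mul]
  rcases le_total 0 x with hx | hx
  · rw [abs_of_nonneg hx]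
    exact (b1 i x hx).1.trans (le_add_of_nonneg_right (by positivity))
  · have := (b2 i (-x) (by linarith)).1
    rw [neg_neg] at this
    rw [abs_of_nonpos hx]
    exact this.trans (le_add_of_nonneg_left (by positivity))

theorem exists_pos_lt {ι : Type*} [Finite ι] [Nonempty ι] (f : ι → ℝ) (hf : ∀ i, 0 < f i) :
    ∃ η > 0, ∀ i, η < f i := by
  obtain ⟨i, hi⟩ := Finite.exists_min f
  exact ⟨f i / 2, half_pos (hf i), fun k => (half_lt_self (hf i)).trans_le (hi k)⟩

/-- Solutions decaying at the rate `η` are eigenfunctions, and conversely. -/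
theorem isEigenvalue_iff_exists {n : ℕ} {β η ε₀ l₀ M : ℝ} (hβ : 0 ≤ β) (hη : 0 < η)
    {A : ℝ → Matrix (Fin n) (Fin n) ℝ} (hA : Continuous A) (hM : ∀ x i k, |A x i k| ≤ M)
    (hdiag : ∀ x, (A x).IsDiag) {j : Fin n} {w₀ : ℝ →ᵇ ℝ} {K : Fin n → (ℝ →ᵇ ℝ) →L[ℝ] (ℝ →ᵇ ℝ)}
    {E : Fin n → Prop} {L₀ : (ℝ →ᵇ ℝ) →L[ℝ] ℝ} {L : Fin n → Bool → (ℝ →ᵇ ℝ) →L[ℝ] ℝ}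
    (hEj : ¬ E j)
    (hj : ∀ g w y', IsSol (fun x => A x j j - l₀) (damp η g) (damp η w) y' →
      Tendsto y' atTop (𝓝 0) → Tendsto y' atBot (𝓝 0) → (∃ c : ℝ, w = c • w₀ + K j g) ∧ L₀ g = 0)
    (hj' : ∀ g, L₀ g = 0 → ∀ c : ℝ,
      ∃ y', IsSol (fun x => A x j j - l₀) (damp η g) (damp η (c • w₀ + K j g)) y')
    (hk : ∀ k, k ≠ j → ∀ g w y', IsSol (fun x => A x k k - l₀) (damp η g) (damp η w) y' →
      Tendsto y' atTop (𝓝 0) → Tendsto y' atBot (𝓝 0) → w = K k g ∧ (E k → ∀ b, L k b g = 0))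
    (hk' : ∀ k, k ≠ j → ∀ g, (E k → ∀ b, L k b g = 0) →
      ∃ y', IsSol (fun x => A x k k - l₀) (damp η g) (damp η (K k g)) y')
    (hdec : ∀ l, |l - l₀| < ε₀ → ∀ (B : PerturbationSpace n β) u u',
      IsSystemSol (fun x => A x + B x) l u u' →
      (∀ i, (Tendsto (u i) atTop (𝓝 0) ∧ Tendsto (u' i) atTop (𝓝 0)) ∧
        (Tendsto (u i) atBot (𝓝 0) ∧ Tendsto (u' i) atBot (𝓝 0))) →
      ∃ D, ∀ i x, |u i x| ≤ D * Real.exp (-η * |x|))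
    {𝔅 : PerturbationSpace n β →L[ℝ] ((Fin n → (ℝ →ᵇ ℝ)) →L[ℝ] (Fin n → (ℝ →ᵇ ℝ)))}
    (h𝔅 : ∀ B w i x, 𝔅 B w i x = ∑ k, B x i k * w k x) (l : ℝ) (B : PerturbationSpace n β)
    (hl : |l - l₀| < ε₀) :
    IsEigenvalue (schrodingerOp fun x => A x + B x) l ↔ ∃ w : Fin n → (ℝ →ᵇ ℝ), w ≠ 0 ∧
      (∃ c : ℝ, w = c • (Pi.single j w₀ : Fin n → (ℝ →ᵇ ℝ)) +
        ContinuousLinearMap.pi (fun k => (K k).comp (ContinuousLinearMap.proj k))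
          (𝔅 B w - (l - l₀) • w)) ∧
      L₀.comp (ContinuousLinearMap.proj j) (𝔅 B w - (l - l₀) • w) = 0 ∧
      ContinuousLinearMap.pi (fun q : {k // E k} × Bool =>
        (L q.1 q.2).comp (ContinuousLinearMap.proj q.1.1)) (𝔅 B w - (l - l₀) • w) = 0 := by
  have hAB : Continuous fun x => A x + B x := hA.add B.2.1
  -- The eigenvalue equation at l is the decoupled equation at l₀ with forcing 𝔅 B w - (l - l₀) w.
  have hrhs : ∀ (w : Fin n → (ℝ →ᵇ ℝ)) i x,
      (A x i i - l₀) * damp η (w i) x + damp η ((𝔅 B w - (l - l₀) • w) i) x =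
      ∑ k, (A x + B x) i k * damp η (w k) x - l * damp η (w i) x := by
    intro w i x
    have h1 : ∑ k, A x i k * damp η (w k) x = A x i i * damp η (w i) x :=
      Finset.sum_eq_single i (fun k _ hk => by rw [hdiag x hk.symm, zero_mul]) (by simp)
    have h2 : damp η ((𝔅 B w - (l - l₀) • w) i) x =
        ∑ k, B x i k * damp η (w k) x - (l - l₀) * damp η (w i) x := by
      have : (𝔅 B w - (l - l₀) • w) i x = 𝔅 B w i x - (l - l₀) * w i x := rfl
      rw [damp, this, h𝔅, mul_sub, Finset.mul_sum]
      congr 1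
      · exact Finset.sum_congr rfl fun k _ => by rw [damp]; ring
      · rw [damp]; ring
    simp only [Matrix.add_apply, add_mul, Finset.sum_add_distrib, h1, h2]
    ring
  constructor
  · rintro ⟨v, hv⟩
    obtain ⟨u, u', hu, -, ⟨i₀, x₀, hne⟩, h0⟩ := hv.exists_isSystemSol hAB
    -- Uniform exponential decay is needed only in this direction: it places every L² eigenfunction
    -- in the weighted space.
    obtain ⟨D, hD⟩ := hdec l hl B u u' hu h0
    choose w hw using fun i => exists_damp_eq (hu i).continuous (hD i)
    have hsol : ∀ i, IsSol (fun x => A x i i - l₀) (damp η ((𝔅 B w - (l - l₀) • w) i))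
        (damp η (w i)) (u' i) := fun i => by
      have e1 : damp η (w i) = u i := funext (hw i)
      refine ⟨fun x => by rw [e1]; exact (hu i).deriv_fst x, fun x =>
        ((hu i).deriv_snd x).congr_deriv ?_⟩
      rw [hrhs]
      simp [hw]
    have hK : ∀ k, k ≠ j → w k = K k ((𝔅 B w - (l - l₀) • w) k) ∧
        (E k → ∀ b, L k b ((𝔅 B w - (l - l₀) • w) k) = 0) := fun k hkj =>
      hk k hkj _ _ _ (hsol k) (h0 k).1.2 (h0 k).2.2
    obtain ⟨⟨c, hc⟩, hL₀⟩ := hj _ _ _ (hsol j) (h0 j).1.2 (h0 j).2.2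
    refine ⟨w, fun h => hne ?_, ⟨c, ?_⟩, hL₀, ?_⟩
    · rw [← hw i₀, h]
      simp [damp]
    · funext k
      rcases eq_or_ne k j with rfl | hkj
      · simpa using hc
      · simpa [hkj] using (hK k hkj).1
    · funext q
      exact (hK q.1 fun h => hEj (h ▸ q.1.2)).2 q.1.2 q.2
  · rintro ⟨w, hw0, ⟨c, hc⟩, hL₀, hL⟩
    have hsol : ∀ i, ∃ y', IsSol (fun x => A x i i - l₀) (damp η ((𝔅 B w - (l - l₀) • w) i))
        (damp η (w i)) y' := fun i => by
      rcases eq_or_ne i j with rfl | hij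
      · obtain ⟨y', hy'⟩ := hj' ((𝔅 B w - (l - l₀) • w) i) hL₀ c
        refine ⟨y', ?_⟩
        have e : w i = c • w₀ + K i ((𝔅 B w - (l - l₀) • w) i) := by
          simpa using congrFun hc i
        rwa [← e] at hy'
      · obtain ⟨y', hy'⟩ := hk' i hij ((𝔅 B w - (l - l₀) • w) i)
          (fun hE b => congrFun hL (⟨i, hE⟩, b))
        refine ⟨y', ?_⟩
        have e : w i = K i ((𝔅 B w - (l - l₀) • w) i) := by
          simpa [hij] using congrFun hc i
        rwa [← e] at hy'
    choose y' hy' using hsol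
    have hu : IsSystemSol (fun x => A x + B x) l (fun i => damp η (w i)) y' := fun i =>
      ⟨(hy' i).deriv_fst, fun x => ((hy' i).deriv_snd x).congr_deriv (by
        rw [hrhs]; simp)⟩
    obtain ⟨i₀, hi₀⟩ := Function.ne_iff.1 hw0
    have hx₀ : ∃ x, w i₀ x ≠ 0 := by
      by_contra! h
      exact hi₀ (BoundedContinuousFunction.ext h)
    obtain ⟨x₀, hx₀⟩ := hx₀
    obtain ⟨v, hv, -⟩ := hu.exists_isEigenfunction hAB (M := M + ‖B‖) (fun x i k =>
      (abs_add_le _ _).trans (add_le_add (hM x i k) (B.abs_apply_le_norm hβ x i k))) hη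
      (C := ‖w‖) (fun i x => (abs_damp_le η (w i) x).trans (mul_le_mul_of_nonneg_right
        (norm_le_pi_norm w i) (Real.exp_nonneg _)))
      ⟨i₀, x₀, mul_ne_zero (Real.exp_pos _).ne' hx₀⟩
    exact ⟨v, hv⟩

namespace FundamentalPair

variable {q : ℝ → ℝ} {p : ℝ}

theorem nonempty_pair_of_abs_trace_le (F : FundamentalPair q) (hp : 0 < p)
    (hq : ∀ x, q (x + p) = q x) (ht : |F.trace p| ≤ 2)
    (hs : |F.trace p| = 2 → ∃ σ : ℝ, |σ| = 1 ∧ F.c p = σ ∧ F.s p = 0 ∧ F.c' p = 0 ∧ F.s' p = σ) :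
    Nonempty (DichotomyPair q 0) := by
  rcases ht.lt_or_eq with h | h
  · refine F.nonempty_pair_of_elliptic hp hq ?_
    rw [← sq_abs]
    nlinarith [abs_nonneg (F.trace p)]
  · obtain ⟨σ, h1, h2, h3, h4, h5⟩ := hs h
    exact F.nonempty_pair_of_scalar hp hq h1 h2 h3 h4 h5

theorem exists_pair_of_two_lt_abs_trace (F : FundamentalPair q) (hp : 0 < p)
    (hq : ∀ x, q (x + p) = q x) (ht : 2 < |F.trace p|) :
    ∃ α > 0, Nonempty (DichotomyPair q α) := by
  have h1 : 1 < |F.trace p| / 2 := by linarith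
  refine ⟨_, div_pos (Real.arcosh_pos h1) hp,
    F.nonempty_pair_of_hyperbolic hp (Real.arcosh_pos h1) hq ?_⟩
  rw [Real.cosh_arcosh h1.le]
  ring

end FundamentalPair

/-- The solution operator, the solvability conditions and their moments for one component. -/
theorem DichotomyPair.exists_component {q : ℝ → ℝ} {α β η : ℝ} (Q : DichotomyPair q α) {E : Prop}
    (hE : E → α = 0) (hE' : ¬ E → η < α) (hη : 0 < η) (hβ : 1 < β) {w₀ : ℝ →ᵇ ℝ} (hw₀ : w₀ ≠ 0) :
    ∃ (K : (ℝ →ᵇ ℝ) →L[ℝ] (ℝ →ᵇ ℝ)) (L : Bool → (ℝ →ᵇ ℝ) →L[ℝ] ℝ),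
      (∀ g w y', IsSol q (damp η g) (damp η w) y' → Tendsto y' atTop (𝓝 0) →
        Tendsto y' atBot (𝓝 0) → w = K g ∧ (E → ∀ b, L b g = 0)) ∧
      (∀ g, (E → ∀ b, L b g = 0) → ∃ y', IsSol q (damp η g) (damp η (K g)) y') ∧
      (E → ∀ z : Bool → ℝ, ∃ h : ℝ → ℝ, Continuous h ∧ (∃ D, ∀ x, |h x| ≤ D * (1 + |x|) ^ (-β)) ∧
        ∀ g, (∀ x, damp η g x = h x * damp η w₀ x) → ∀ b, L b g = z b) := by
  by_cases hcase : E
  · obtain rfl := hE hcase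
    have b1 : ∀ x, |Q.φ x| ≤ Q.C := fun x => by simpa using Q.φ_le x
    have b2 : ∀ x, |Q.ψ x| ≤ Q.C := fun x => by simpa using Q.ψ_le x
    obtain ⟨K, hK, hK'⟩ := Q.exists_partial_inverse hη
    obtain ⟨L₁, hL₁⟩ := exists_pairing hη Q.sol_φ.continuous b1
    obtain ⟨L₂, hL₂⟩ := exists_pairing hη Q.sol_ψ.continuous b2
    refine ⟨K, fun b => cond b L₁ L₂, fun g w y' hy h0 h1 => ?_, fun g hg => ?_, fun _ z => ?_⟩
    · obtain ⟨e1, e2, e3⟩ := hK g w y' hy h0 h1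
      refine ⟨e1, fun _ b => ?_⟩
      cases b
      · exact (hL₂ g).trans e3
      · exact (hL₁ g).trans e2
    · exact hK' g ((hL₁ g).symm.trans (hg hcase true)) ((hL₂ g).symm.trans (hg hcase false))
    · obtain ⟨x₀, hx₀⟩ : ∃ x, w₀ x ≠ 0 := by
        by_contra! h
        exact hw₀ (BoundedContinuousFunction.ext h)
      have b3 : ∀ x, |damp η w₀ x| ≤ ‖w₀‖ := fun x => (abs_damp_le η w₀ x).trans
        (mul_le_of_le_one_right (norm_nonneg _)
          (Real.exp_le_one_iff.2 (by nlinarith [abs_nonneg x])))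
      obtain ⟨h, hc, hD, h1, h2⟩ := exists_moments Q.sol_φ Q.sol_ψ Q.wronskian
        (C := max Q.C ‖w₀‖) (fun x => (b1 x).trans (le_max_left _ _))
        (fun x => (b2 x).trans (le_max_left _ _)) (continuous_damp η w₀)
        (fun x => (b3 x).trans (le_max_right _ _)) (x₀ := x₀)
        (mul_ne_zero (Real.exp_pos _).ne' hx₀) (continuous_weight β) (weight_pos β)
        (integrable_weight hβ) (z true) (z false)
      refine ⟨h, hc, hD, fun g hg b => ?_⟩
      cases b
      · refine (hL₂ g).trans ?_
        simpa only [hg] using h2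
      · refine (hL₁ g).trans ?_
        simpa only [hg] using h1
  · obtain ⟨K, hK, hK'⟩ := Q.exists_inverse hη (hE' hcase)
    exact ⟨K, 0, fun g w y' hy h0 h1 => ⟨hK g w y' hy h0 h1, fun h => absurd h hcase⟩,
      fun g _ => hK' g, fun h => absurd h hcase⟩

/-- A row and column perturbation realizes any values of the solvability functionals. -/
theorem exists_perturbation_moments {n : ℕ} {β η : ℝ} {j : Fin n} {w₀ : ℝ →ᵇ ℝ} {E : Fin n → Prop}
    (hEj : ¬ E j) {L : Fin n → Bool → (ℝ →ᵇ ℝ) →L[ℝ] ℝ}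
    (hm : ∀ k, k ≠ j → E k → ∀ z : Bool → ℝ, ∃ h : ℝ → ℝ, Continuous h ∧
      (∃ D, ∀ x, |h x| ≤ D * (1 + |x|) ^ (-β)) ∧
      ∀ g, (∀ x, damp η g x = h x * damp η w₀ x) → ∀ b, L k b g = z b)
    {𝔅 : PerturbationSpace n β →L[ℝ] ((Fin n → (ℝ →ᵇ ℝ)) →L[ℝ] (Fin n → (ℝ →ᵇ ℝ)))}
    (h𝔅 : ∀ B w i x, 𝔅 B w i x = ∑ k, B x i k * w k x) (z : {k // E k} × Bool → ℝ) :
    ∃ B ∈ minimalSubspace n β j, ∀ q : {k // E k} × Bool,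
      L q.1 q.2 (𝔅 B (Pi.single j w₀) q.1) = z q := by
  classical
  have hm' : ∀ k, ∃ h : ℝ → ℝ, Continuous h ∧ (∃ D, ∀ x, |h x| ≤ D * (1 + |x|) ^ (-β)) ∧
      ∀ hE : E k, ∀ g, (∀ x, damp η g x = h x * damp η w₀ x) → ∀ b, L k b g = z (⟨k, hE⟩, b) := by
    intro k
    by_cases hE : E k
    · obtain ⟨h, h1, h2, h3⟩ := hm k (fun e => hEj (e ▸ hE)) hE fun b => z (⟨k, hE⟩, b)
      exact ⟨h, h1, h2, fun _ => h3⟩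
    · exact ⟨fun _ => 0, continuous_const, ⟨0, fun x => by simp⟩, fun h => absurd h hE⟩
  choose h hc hD hmom using hm'
  choose D hD using hD
  have hD' : ∀ k x, |h k x| ≤ (∑ i, |D i|) * (1 + |x|) ^ (-β) := fun k x =>
    (hD k x).trans (mul_le_mul_of_nonneg_right ((le_abs_self _).trans
      (Finset.single_le_sum (f := fun i => |D i|) (fun i _ => abs_nonneg _) (Finset.mem_univ k)))
      (weight_pos β x).le)
  -- Since the vector sits in component j, component k of its image involves only the entry b_kj.
  -- The entries of column j are independent of each other, so the moments of different components
  -- are prescribed separately.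
  obtain ⟨B, hB, hBh⟩ := PerturbationSpace.exists_cross j h hc hD'
  refine ⟨B, hB, fun q => hmom q.1 q.1.2 _ (fun x => ?_) q.2⟩
  have hq : q.1.1 ≠ j := fun e => hEj (e ▸ q.1.2)
  rw [damp, h𝔅, Finset.sum_eq_single j (fun k _ hk => by simp [hk]) (by simp)]
  rw [Pi.single_eq_same, damp, ← hBh q.1.1 hq x]
  exact mul_left_comm _ _ _

theorem IsSystemSol.of_component {n : ℕ} {A : ℝ → Matrix (Fin n) (Fin n) ℝ} {l : ℝ}
    (hdiag : ∀ x, (A x).IsDiag) {k : Fin n} {y y' : ℝ → ℝ}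
    (hy : IsSol (fun x => A x k k - l) 0 y y') :
    IsSystemSol A l (Pi.single k y) (Pi.single k y') := by
  intro i
  have h1 : ∀ x, ∑ m, A x i m * (Pi.single k y : Fin n → ℝ → ℝ) m x =
      A x i i * (Pi.single k y : Fin n → ℝ → ℝ) i x := fun x =>
    Finset.sum_eq_single i (fun m _ hm => by rw [hdiag x hm.symm, zero_mul]) (by simp)
  simp only [h1]
  rcases eq_or_ne i k with rfl | hik
  · simp only [Pi.single_eq_same]
    exact ⟨hy.deriv_fst, fun x => (hy.deriv_snd x).congr_deriv (by
      simp only [Pi.zero_apply]; ring)⟩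
  · simp only [Pi.single_eq_of_ne hik]
    exact ⟨fun x => hasDerivAt_const x _, fun x => (hasDerivAt_const x (0 : ℝ)).congr_deriv (by simp)⟩

/-- If the eigenfunctions to a simple eigenvalue are concentrated in one component, the other
components of a diagonal system have no decaying solutions. -/
theorem eq_zero_of_isSimpleEigenvalue {n : ℕ} {A : ℝ → Matrix (Fin n) (Fin n) ℝ} {l₀ M : ℝ}
    (hA : Continuous A) (hM : ∀ x i k, |A x i k| ≤ M) (hdiag : ∀ x, (A x).IsDiag)
    (hsimple : IsSimpleEigenvalue (schrodingerOp A) l₀) {j : Fin n} {u : L2Space n}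
    (hu : IsEigenfunction (schrodingerOp A) l₀ u) (huj : ∀ i, i ≠ j → ∀ᵐ x : ℝ, u x i = 0)
    {k : Fin n} (hk : k ≠ j) {y y' : ℝ → ℝ} (hy : IsSol (fun x => A x k k - l₀) 0 y y') {C η : ℝ}
    (hη : 0 < η) (hb : ∀ x, |y x| ≤ C * Real.exp (-η * |x|)) (x : ℝ) : y x = 0 := by
  by_contra hne
  have hC : 0 ≤ C := by simpa using (abs_nonneg _).trans (hb 0)
  obtain ⟨w, hw, hwy⟩ := (IsSystemSol.of_component hdiag hy).exists_isEigenfunction hA hM hη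
    (C := C) (fun i x => by
      rcases eq_or_ne i k with rfl | hik
      · simpa using hb x
      · simp only [Pi.single_eq_of_ne hik, Pi.zero_apply, abs_zero]
        positivity) ⟨k, x, by simpa using hne⟩
  obtain ⟨c, hc⟩ := hsimple.2 u w hu hw
  have h0 : y = fun _ => 0 := by
    refine (Continuous.ae_eq_iff_eq volume hy.continuous continuous_const).1 ?_
    filter_upwards [hwy, huj k hk, Lp.coeFn_smul c u] with t e1 e2 e3
    have e4 := e1 k
    rw [hc, e3] at e4
    simp only [Pi.smul_apply, Pi.single_eq_same] at e4
    rw [← e4, PiLp.smul_apply, e2, smul_zero]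
  exact hne (congrFun h0 x)

/-- The classical representative of an eigenfunction with a single nonvanishing component. -/
theorem IsEigenfunction.exists_component {n : ℕ} {A : ℝ → Matrix (Fin n) (Fin n) ℝ} {l₀ : ℝ}
    (hA : Continuous A) (hdiag : ∀ x, (A x).IsDiag) {j : Fin n} {u : L2Space n}
    (hu : IsEigenfunction (schrodingerOp A) l₀ u) (huj : ∀ i, i ≠ j → ∀ᵐ x : ℝ, u x i = 0) :
    ∃ y y', IsSol (fun x => A x j j - l₀) 0 y y' ∧ (∃ x, y x ≠ 0) ∧
      (Tendsto y atTop (𝓝 0) ∧ Tendsto y' atTop (𝓝 0)) ∧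
      (Tendsto y atBot (𝓝 0) ∧ Tendsto y' atBot (𝓝 0)) := by
  obtain ⟨v, v', hv, hvu, ⟨i₀, x₀, hne⟩, h0⟩ := hu.exists_isSystemSol hA
  have hz : ∀ i, i ≠ j → ∀ x, v i x = 0 := fun i hi => by
    refine congrFun ((Continuous.ae_eq_iff_eq volume (hv i).continuous continuous_const).1 ?_)
    filter_upwards [hvu, huj i hi] with t e1 e2
    rw [← e1 i, e2]
  have hi₀ : i₀ = j := by
    by_contra h
    exact hne (hz i₀ h x₀)
  subst hi₀
  refine ⟨v i₀, v' i₀, ⟨(hv i₀).deriv_fst, fun x => ((hv i₀).deriv_snd x).congr_deriv ?_⟩,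
    ⟨x₀, hne⟩, h0 i₀⟩
  have h1 : ∑ m, A x i₀ m * v m x = A x i₀ i₀ * v i₀ x :=
    Finset.sum_eq_single i₀ (fun m _ hm => by rw [hdiag x hm.symm, zero_mul]) (by simp)
  rw [h1]
  simp only [Pi.zero_apply]
  ring

/-! ### The main theorem. -/

theorem theorem2 (n : ℕ) (β p l₀ : ℝ) (hβ : 1 < β) (hp : 0 < p)
    (A Ap : ℝ → Matrix (Fin n) (Fin n) ℝ)
    (hA : Continuous A)
    (hdiag : ∀ x, (A x).IsDiag)
    (hper : ∀ x, Ap (x + p) = Ap x)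
    (hdecay : BddAbove (range fun x : ℝ => ‖A x - Ap x‖ * (1 + |x|) ^ β))
    (hsimple : IsSimpleEigenvalue (schrodingerOp A) l₀)
    (j : Fin n) (u : L2Space n) (hu : IsEigenfunction (schrodingerOp A) l₀ u)
    (huj : ∀ i, i ≠ j → ∀ᵐ x : ℝ, u x i = 0)
    (Φ : ℝ → Matrix (Fin n ⊕ Fin n) (Fin n ⊕ Fin n) ℝ)
    (hΦ : IsFundamentalMatrix Ap l₀ Φ)
    (hexp : ¬ Module.End.HasEigenvalue (Matrix.toLin' (Φ p)) (Real.exp (p * l₀)))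
    (hss : UnimodularSemisimple (Φ p))
    (Y : Submodule ℝ (PerturbationSpace n β)) (hY : minimalSubspace n β j ≤ Y) :
    ∃ m : ℕ, unimodularCount (Φ p) = 2 * m ∧
      ∃ ε > 0, ∃ U : Set Y, IsOpen U ∧ 0 ∈ U ∧
        IsSubmanifoldOfCodim (2 * m) (persistenceSet A l₀ ε Y ∩ U) := by
  classical
  have hβ0 : 0 < β := by linarith
  -- the periodic limit
  obtain ⟨C, hC⟩ := hdecay
  have hCe : ∀ x i k, |A x i k - Ap x i k| ≤ C * (1 + |x|) ^ (-β) := fun x i k => by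
    rw [le_mul_weight_iff]
    exact (mul_le_mul_of_nonneg_right (Matrix.norm_entry_le_entrywise_sup_norm (A x - Ap x))
      (by positivity)).trans (hC ⟨x, rfl⟩)
  have hlim : ∀ i k, Tendsto (fun x => A x i k - Ap x i k) atTop (𝓝 0) := fun i k =>
    squeeze_zero_norm (fun x => hCe x i k) (by simpa using (tendsto_weight hβ0).const_mul C)
  have hpere : ∀ i k x, Ap (x + p) i k = Ap x i k := fun i k x => by rw [hper]
  have hApe : ∀ i k, Continuous fun x => Ap x i k := fun i k =>
    continuous_of_periodic hp (hA.matrix_elem i k) (hpere i k) (hlim i k)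
  have hAp : Continuous Ap := continuous_matrix hApe
  -- An off-diagonal entry of the periodic limit is periodic and tends to zero, because that entry
  -- of `A` vanishes.
  have hdiagp : ∀ x, (Ap x).IsDiag := fun x i k hik =>
    periodic_eq_zero hp (hpere i k) (by
      have := (hlim i k).neg
      simpa [hdiag _ hik] using this) x
  choose M₁ hM₁ using fun i k => exists_bound_of_periodic hp (hApe i k) (hpere i k)
  have hM₁' : ∀ x i k, |Ap x i k| ≤ ∑ i, ∑ k, |M₁ i k| := fun x i k => by
    refine (hM₁ i k x).trans ((le_abs_self _).trans ?_)
    refine (Finset.single_le_sum (f := fun k => |M₁ i k|) (fun _ _ => abs_nonneg _)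
      (Finset.mem_univ k)).trans ?_
    exact Finset.single_le_sum (f := fun i => ∑ k, |M₁ i k|)
      (fun _ _ => Finset.sum_nonneg fun _ _ => abs_nonneg _) (Finset.mem_univ i)
  set M : ℝ := ∑ i, ∑ k, |M₁ i k|
  have hC0 : 0 ≤ C := nonneg_of_mul_nonneg_left ((abs_nonneg _).trans (hCe 0 j j)) (weight_pos β 0)
  have hMA : ∀ x i k, |A x i k| ≤ C + M := fun x i k => by
    have h1 : C * (1 + |x|) ^ (-β) ≤ C := mul_le_of_le_one_right hC0
      (Real.rpow_le_one_of_one_le_of_nonpos (by linarith [abs_nonneg x]) (by linarith))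
    have h2 := hCe x i k
    have h3 := hM₁' x i k
    have h4 := abs_add_le (A x i k - Ap x i k) (Ap x i k)
    rw [sub_add_cancel] at h4
    linarith
  -- Floquet theory of the periodic limit
  obtain ⟨F, hF⟩ := hΦ.exists_fundamentalPair hdiagp
  -- The elliptic components; their number is m.
  set E : Fin n → Prop := fun k => |(F k).trace p| ≤ 2
  have hdet : ∀ k, (F k).c p * (F k).s' p - (F k).c' p * (F k).s p = 1 := fun k =>
    (F k).wronskian p
  rw [hF p] at hss
  have hscal : ∀ k, |(F k).trace p| = 2 → ∃ σ : ℝ, |σ| = 1 ∧ (F k).c p = σ ∧ (F k).s p = 0 ∧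
      (F k).c' p = 0 ∧ (F k).s' p = σ := fun k hk =>
    ⟨(F k).trace p / 2, by rw [abs_div, hk]; norm_num,
      hss.eq_scalar (hdet k) (by rw [abs_div, hk]; norm_num) (by
        rw [mul_div_cancel₀ _ (two_ne_zero' ℝ)]; rfl)⟩
  refine ⟨Fintype.card {k // E k}, by rw [hF p, unimodularCount_fromBlocks_diagonal _ _ _ _ hdet]; rfl,
    ?_⟩
  have hperq : ∀ k x, Ap (x + p) k k - l₀ = Ap x k k - l₀ := fun k x => by rw [hper]
  have hpair : ∀ k, ∃ α, (E k → α = 0) ∧ (¬ E k → 0 < α) ∧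
      Nonempty (DichotomyPair (fun x => Ap x k k - l₀) α) := fun k => by
    by_cases h : E k
    · exact ⟨0, fun _ => rfl, fun h' => absurd h h',
        (F k).nonempty_pair_of_abs_trace_le hp (hperq k) h (hscal k)⟩
    · obtain ⟨α, hα, hP⟩ := (F k).exists_pair_of_two_lt_abs_trace hp (hperq k) (not_le.1 h)
      exact ⟨α, fun h' => absurd h' h, fun _ => hα, hP⟩
  choose α hα0 hα1 hP using hpair
  have P := fun k => (hP k).some
  have hα : ∀ k, 0 ≤ α k := fun k => by
    by_cases h : E k
    · exact (hα0 k h).ge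
    · exact (hα1 k h).le
  choose η₁ hη₁ ε₁ hε₁ hnear using fun k =>
    exists_dichotomyPair_near (hApe k k) (fun x => hM₁' x k k) hp (hpere k k) (F k)
      (or_iff_not_imp_left.2 fun h => hscal k (not_not.1 h))
  -- the diagonal entries as perturbations of the periodic ones
  have hr : ∀ k, Continuous fun x => A x k k - Ap x k k := fun k =>
    (hA.matrix_elem k k).sub (hApe k k)
  have hqr : ∀ k, (fun x => Ap x k k - l₀ + (A x k k - Ap x k k)) = fun x => A x k k - l₀ :=
    fun k => by funext x; ring
  have hρc : Continuous fun x : ℝ => C * (1 + |x|) ^ (-β) := (continuous_weight β).const_mul C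
  have hρi : Integrable fun x : ℝ => C * (1 + |x|) ^ (-β) := (integrable_weight hβ).const_mul C
  have G : ∀ k, FundamentalPair fun x => A x k k - l₀ := fun k =>
    (nonempty_fundamentalPair ((hA.matrix_elem k k).sub continuous_const) (M := C + M + |l₀|)
      fun x => (abs_sub _ _).trans (add_le_add_left (hMA x k k) _)).some
  obtain ⟨y, y', hy, ⟨x₀, hx₀⟩, ⟨ht0, ht1⟩, ht2, ht3⟩ := hu.exists_component hA hdiag huj
  -- An elliptic equation has no nontrivial decaying solution, even after the perturbation, whereas
  -- component j carries the eigenfunction.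
  have hEj : ¬ E j := fun h => by
    have hPj := P j
    rw [hα0 j h] at hPj
    obtain ⟨Q⟩ := nonempty_pair_of_perturbed_elliptic hPj (hr j) hρc hρi (fun x => hCe x j j)
      (by rw [hqr]; exact G j)
    rw [hqr] at Q
    exact hx₀ (Q.eq_zero_of_tendsto hy ht0 ht1 x₀)
  -- In the hyperbolic case a decaying solution would be a second eigenfunction independent of `u`,
  -- contrary to simplicity.
  have hQ : ∀ k, k ≠ j → Nonempty (DichotomyPair (fun x => A x k k - l₀) (α k)) := fun k hk => by
    by_cases h : E k
    · have hPk := P k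
      rw [hα0 k h] at hPk ⊢
      have := nonempty_pair_of_perturbed_elliptic hPk (hr k) hρc hρi (fun x => hCe x k k)
        (by rw [hqr]; exact G k)
      rwa [hqr] at this
    · have := nonempty_pair_of_perturbed_hyperbolic (P k) (hα k) (hr k) hρc hρi
        (fun x => hCe x k k) (by rw [hqr]; exact G k) (fun z z' hz D hD => by
          rw [hqr] at hz
          exact eq_zero_of_isSimpleEigenvalue hA hMA hdiag hsimple hu huj hk hz (hα1 k h)
            fun x => (hD x).1)
      rwa [hqr] at this
  obtain ⟨D, ψ, ψ', hD1, hD2, hψ, hW, hD3⟩ := (P j).exists_resonant_pair (hα j) (hr j) hρc hρi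
    (fun x => hCe x j j) (by rw [hqr]; exact G j) (by rw [hqr]; exact hy) hx₀ ht0 ht1 ht2 ht3
  rw [hqr] at hψ
  -- a common rate and a common spectral window
  have : Nonempty (Fin n) := ⟨j⟩
  obtain ⟨η, hη, hηlt⟩ := exists_pos_lt (fun k => min (η₁ k) (if E k then 1 else α k)) fun k => by
    refine lt_min (hη₁ k) ?_
    split_ifs with h
    exacts [one_pos, hα1 k h]
  obtain ⟨ε₀, hε₀, hε₀lt⟩ := exists_pos_lt ε₁ hε₁
  have hη1 : ∀ k, η ≤ η₁ k := fun k => ((hηlt k).trans_le (min_le_left _ _)).le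
  have hηα : ∀ k, ¬ E k → η < α k := fun k hk => by
    have := (hηlt k).trans_le (min_le_right _ _)
    rwa [if_neg hk] at this
  have hD0 : 0 ≤ D := by simpa using (abs_nonneg _).trans (hD1 0)
  obtain ⟨w₀, hw₀⟩ := exists_damp_eq (η := η) (C := D) hy.continuous fun x =>
    (hD1 x).trans (mul_le_mul_of_nonneg_left (Real.exp_le_exp.2 (by
      nlinarith [abs_nonneg x, hηα j hEj])) hD0)
  have hw₀0 : w₀ ≠ 0 := by
    rintro rfl
    exact hx₀ (by rw [← hw₀ x₀]; simp [damp])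
  -- solution operators
  obtain ⟨Kj, hKj, hKj'⟩ := exists_resonant_inverse hy hψ hW hη (hηα j hEj) hD1 hD2 hD3 w₀ hw₀
  have hD4 : ∀ x, |y x| ≤ D := fun x => (hD1 x).trans (mul_le_of_le_one_right hD0
    (Real.exp_le_one_iff.2 (by nlinarith [abs_nonneg x, hα j])))
  obtain ⟨L₀, hL₀⟩ := exists_pairing hη hy.continuous hD4
  have hcomp : ∀ k, ∃ (K : (ℝ →ᵇ ℝ) →L[ℝ] (ℝ →ᵇ ℝ)) (L : Bool → (ℝ →ᵇ ℝ) →L[ℝ] ℝ), k ≠ j →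
      (∀ g w y', IsSol (fun x => A x k k - l₀) (damp η g) (damp η w) y' → Tendsto y' atTop (𝓝 0) →
        Tendsto y' atBot (𝓝 0) → w = K g ∧ (E k → ∀ b, L b g = 0)) ∧
      (∀ g, (E k → ∀ b, L b g = 0) →
        ∃ y', IsSol (fun x => A x k k - l₀) (damp η g) (damp η (K g)) y') ∧
      (E k → ∀ z : Bool → ℝ, ∃ h : ℝ → ℝ, Continuous h ∧ (∃ D, ∀ x, |h x| ≤ D * (1 + |x|) ^ (-β)) ∧
        ∀ g, (∀ x, damp η g x = h x * damp η w₀ x) → ∀ b, L b g = z b) := fun k => by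
    by_cases hk : k = j
    -- Placeholders at j; the resonant operator replaces the first one below.
    · exact ⟨0, 0, fun h => absurd hk h⟩
    · obtain ⟨Q⟩ := hQ k hk
      obtain ⟨K, L, h⟩ := Q.exists_component (hα0 k) (hηα k) hη hβ hw₀0
      exact ⟨K, L, fun _ => h⟩
  choose K₀ L hKL using hcomp
  set K : Fin n → (ℝ →ᵇ ℝ) →L[ℝ] (ℝ →ᵇ ℝ) := Function.update K₀ j Kj
  have hKself : K j = Kj := Function.update_self ..
  have hKne : ∀ k, k ≠ j → K k = K₀ k := fun k hk => Function.update_of_ne hk ..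
  obtain ⟨𝔅, h𝔅⟩ := PerturbationSpace.exists_multiplication n hβ0.le
  have hcard : Fintype.card ({k // E k} × Bool) = 2 * Fintype.card {k // E k} := by
    rw [Fintype.card_prod, Fintype.card_bool, mul_comm]
  rw [← hcard]
  have hdec : ∀ l, |l - l₀| < ε₀ → ∀ (B : PerturbationSpace n β) v v',
      IsSystemSol (fun x => A x + B x) l v v' →
      (∀ i, (Tendsto (v i) atTop (𝓝 0) ∧ Tendsto (v' i) atTop (𝓝 0)) ∧
        (Tendsto (v i) atBot (𝓝 0) ∧ Tendsto (v' i) atBot (𝓝 0))) →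
      ∃ D, ∀ i x, |v i x| ≤ D * Real.exp (-η * |x|) := by
    intro l hl B v v' hv hv0
    choose a ha hPa using fun k => hnear k l (hl.trans (hε₀lt k))
    refine hv.exists_exp_decay hβ (hA.add B.2.1) hAp hdiagp (C := C + ‖B‖) (fun x i k => ?_) hη.le
      (fun i => (ha i).imp_right (hη1 i).trans) (fun i => (hPa i).some) hv0
    have h1 := hCe x i k
    have h2 := B.abs_apply_le x i k
    have h3 := abs_add_le (A x i k - Ap x i k) (B x i k)
    have h4 : A x i k + B x i k - Ap x i k = A x i k - Ap x i k + B x i k := by ring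
    change |A x i k + B x i k - Ap x i k| ≤ _
    rw [h4, add_mul]
    exact h3.trans (add_le_add h1 h2)
  refine exists_isSubmanifoldOfCodim_of_reduction 𝔅
    (ContinuousLinearMap.pi fun k => (K k).comp (ContinuousLinearMap.proj k)) (Pi.single j w₀)
    (L₀.comp (ContinuousLinearMap.proj j))
    (ContinuousLinearMap.pi fun q : {k // E k} × Bool =>
      (L q.1 q.2).comp (ContinuousLinearMap.proj q.1.1)) l₀ ?_ ?_ Y ?_
    (fun l B => IsEigenvalue (schrodingerOp fun x => A x + B x) l) ε₀ hε₀
    (isEigenvalue_iff_exists hβ0.le hη hA hMA hdiag hEj ?_ ?_ ?_ ?_ hdec h𝔅)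
  -- Nondegeneracy in l: the functional of component j takes the value ∫ y² > 0 on the
  -- eigenfunction.
  · have h1 : L₀ w₀ = ∫ s, y s ^ 2 := by
      rw [hL₀]
      simp only [hw₀, pow_two]
    have hi : Integrable fun s => y s ^ 2 := by
      have := integrable_mul_damp hη hy.continuous hD4 w₀
      simpa only [hw₀, ← pow_two] using this
    simp only [ContinuousLinearMap.comp_apply, ContinuousLinearMap.proj_apply, Pi.single_eq_same, h1]
    intro h0
    have h2 := (Continuous.ae_eq_iff_eq volume (hy.continuous.pow 2) continuous_const).1
      ((integral_eq_zero_iff_of_nonneg (fun s => sq_nonneg (y s)) hi).1 h0)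
    exact hx₀ (pow_eq_zero_iff two_ne_zero |>.1 (congrFun h2 x₀))
  · funext q
    have hq : q.1.1 ≠ j := fun e => hEj (e ▸ q.1.2)
    simp [hq]
  · intro z
    obtain ⟨B, hB, hBz⟩ := exists_perturbation_moments hEj (fun k hk => (hKL k hk).2.2) h𝔅 z
    exact ⟨B, hY hB, funext hBz⟩
  · intro g w z' hz h0 h1
    rw [hKself, hL₀]
    exact hKj g w z' hz h0 h1
  · intro g hg c
    rw [hKself]
    exact hKj' g ((hL₀ g).symm.trans hg) c
  · intro k hk
    rw [hKne k hk]
    exact (hKL k hk).1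
  · intro k hk
    rw [hKne k hk]
    exact (hKL k hk).2.1
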